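/- **Setting.** Identify $\mathbb R^4$ with the quaternions by $(x^1,x^2,x^3,x^4)\mapsto x^1+ix^2+jx^3+kx^4$. Let $L_i,L_j$ be the matrices of left multiplication by $i,j$, and $R_i,R_j,R_k$ those of right multiplication. Let $\omega(x,y)=\langle L_ix,y\rangle$, $\epsilon_1,\dots,\epsilon_4$ the standard basis, $\epsilon=\frac12(\epsilon_1-i\epsilon_3)$, $\bar\epsilon=\frac12(\epsilon_1+i\epsilon_3)$. Let $\vec{\mathcal G}=\{G\in SO(4):GL_i=L_iG\}$ and let $\mathcal G=\vec{\mathcal G}\ltimes\mathbb R^4$ with $(G,T)(G',T')=(GG',GT'+T)$, with complexification $\mathcal G^{\mathbb C}$. Let $\mathcal G_0=\{q^1-q^2R_i-q^3R_j-q^4R_k:\ q\in\mathbb R^4,|q|=1\}\subset\vec{\mathcal G}$, and let $\mathcal B_0$ be the group of those $B\in\mathcal G_0^{\mathbb C}$ with $B\epsilon\in\mathbb R_+^*\epsilon$. Let $\tau(G,T)=(-L_jGL_j,-L_jT)$; write $[\cdot]_k$ for the projection of the complexified Lie algebra onto the $i^k$-eigenspace of $\tau$. Then $\Lambda\mathcal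 G_\tau$ (resp. $\Lambda\mathcal G^{\mathbb C}_\tau$) is the group of smooth loops $\lambda\mapsto g_\lambda$, $\lambda\in S^1$, in $\mathcal G$ (resp. $\mathcal G^{\mathbb C}$) with $g_{i\lambda}=\tau(g_\lambda)$, and $\Lambda^+_{\mathcal B_0}\mathcal G^{\mathbb C}_\tau$ consists of those loops in $\Lambda\mathcal G^{\mathbb C}_\tau$ that extend holomorphically to the unit disk with value in $(\mathcal B_0,0)$ at $\lambda=0$. For a loop $\sum_n V_{2n+1}\lambda^{2n+1}$ in $\mathbb C^4$ put $$P\Big(\sum_n V_{2n+1}\lambda^{2n+1}\Big)=\sum_{n\le0}V_{2n-1}\lambda^{2n-1}+\sum_{n\ge0}\overline{V_{-2n-1}}\,\lambda^{2n+1}.$$ Let $\Omega\subset\mathbb C$ be open and simply connected, $z_0\in\Omega$. A conformal Lagrangian immersion $X:\Omega\to\mathbb R^4$ is *Hamiltonian stationary* if the first variation of area vanishes for every compactly supported smooth field $V$ along $X$ with $\omega(V,dX)=dh$ for some $h\in C_c^\infty(\Omega,\mathbb R)$. A *lift* of $X$ is a smooth map $(F,X):\Omega\to\mathcal G$, equal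 to $(1,0)$ at $z_0$, with $F^{-1}dX=e^fK(\epsilon_1dx+\epsilon_3dy)$ for some smooth $f:\Omega\to\mathbb R$ and $K:\Omega\to\mathcal G_0$. With $\alpha=(F,X)^{-1}d(F,X)$, $\alpha_k=[\alpha]_k$ and $\alpha_k=\alpha_k'+\alpha_k''$ the decomposition into $dz$ and $d\bar z$ parts, let $$\alpha_\lambda=\lambda^{-2}\alpha_2'+\lambda^{-1}\alpha_{-1}'+\alpha_0+\lambda\alpha_1''+\lambda^2\alpha_2''.$$ A map $U_\lambda:\Omega\to\Lambda\mathcal G_\tau$ is an *extended lift* of the Hamiltonian stationary conformal Lagrangian immersion $X$ if, for some lift $(F,X)$ of $X$, $dU_\lambda=U_\lambda\alpha_\lambda$ and $U_\lambda(z_0)=1$ for all $\lambda\in S^1$. **Theorem.** Let $\beta:\Omega\to\mathbb R$ be harmonic with $\beta(z_0)=0$ and let $a,b:\Omega\to\mathbb C$ be holomorphic. Then $\beta$ has a harmonic conjugate $\gamma$ on $\Omega$ with $\gamma(z_0)=0$ (so $\beta+i\gamma$ is holomorphic). For the potential $$\mu_\lambda=\Big(\tfrac{\lambda^{-2}}2\tfrac{\partial\beta}{\partial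 z}L_i,\ \lambda^{-1}(a\epsilon+bL_i\bar\epsilon)\Big)dz$$ there is a map $H_\lambda:\Omega\to\Lambda\mathcal G^{\mathbb C}_\tau$ with $dH_\lambda=H_\lambda\mu_\lambda$, $H_\lambda(z_0)=1$. Put $\beta_\lambda=\frac12(\lambda^{-2}+\lambda^2)\beta+\frac i2(\lambda^{-2}-\lambda^2)\gamma$ and $U_\lambda=(F_\lambda,X_\lambda)$ with $$F_\lambda(z)=e^{\frac12\beta_\lambda(z)L_i},$$ $$X_\lambda(z)=e^{\frac12\beta_\lambda(z)L_i}P\Big(e^{-\frac12\beta_\lambda(z)L_i}\int_{z_0}^ze^{\frac{\lambda^{-2}}4(\beta(v)+i\gamma(v))L_i}\lambda^{-1}(a(v)\epsilon+b(v)L_i\bar\epsilon)\,dv\Big).$$ Then: 1. $U_\lambda$ takes values in $\Lambda\mathcal G_\tau$. 2. For every $z\in\Omega$, $H_\lambda(z)=U_\lambda(z)V_\lambda(z)$ for some $V_\lambda(z)\in\Lambda^+_{\mathcal B_0}\mathcal G^{\mathbb C}_\tau$, and $U_\lambda(z)$ is the only element of $\Lambda\mathcal G_\tau$ with this property. 3.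 For each $\lambda_0\in S^1$: $U_\lambda$ is an extended lift of some Hamiltonian stationary conformal Lagrangian immersion if and only if $X_{\lambda_0}:\Omega\to\mathbb R^4$ is an immersion. -/

import Mathlib

open scoped Matrix ContDiff

namespace HamStat

noncomputable section

/-! ### Quaternionic matrices and the symmetry groups -/

abbrev Mat (R : Type) := Matrix (Fin 4) (Fin 4) R

abbrev Vec (R : Type) := Fin 4 → R

/-- Left multiplication by `i` on `ℍ ≃ ℝ⁴`; this is the complex structure `J`. -/
def Li (R : Type) [CommRing R] : Mat R :=
  !![0, -1, 0, 0; 1, 0, 0, 0; 0, 0, 0, -1; 0, 0, 1, 0]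

/-- Left multiplication by `j`. -/
def Lj (R : Type) [CommRing R] : Mat R :=
  !![0, 0, -1, 0; 0, 0, 0, 1; 1, 0, 0, 0; 0, -1, 0, 0]

/-- Right multiplication by `i`. -/
def Ri (R : Type) [CommRing R] : Mat R :=
  !![0, -1, 0, 0; 1, 0, 0, 0; 0, 0, 0, 1; 0, 0, -1, 0]

/-- Right multiplication by `j`. -/
def Rj (R : Type) [CommRing R] : Mat R :=
  !![0, 0, -1, 0; 0, 0, 0, -1; 1, 0, 0, 0; 0, 1, 0, 0]

/-- Right multiplication by `k`. -/
def Rk (R : Type) [CommRing R] : Mat R :=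
  !![0, 0, 0, -1; 0, 0, 1, 0; 0, -1, 0, 0; 1, 0, 0, 0]

/-- For `R = ℝ`, the linear isometries commuting with `J`, i.e. a copy of `U(2)` in `SO(4)`; for
`R = ℂ`, its complexification. -/
def linGroup (R : Type) [CommRing R] : Set (Mat R) :=
  {G | Gᵀ * G = 1 ∧ G.det = 1 ∧ G * Li R = Li R * G}

/-- The subgroup `𝒢₀` (a copy of `SU(2)`) for `R = ℝ`, its complexification for `R = ℂ`. -/
def G0 (R : Type) [CommRing R] : Set (Mat R) :=
  {K | ∃ q : Vec R, ∑ i, q i ^ 2 = 1 ∧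
    K = q 0 • (1 : Mat R) - q 1 • Ri R - q 2 • Rj R - q 3 • Rk R}

/-- `ε = (1, 0, -i, 0) / 2`. -/
def eps : Vec ℂ := ![1 / 2, 0, -Complex.I / 2, 0]

/-- The complex conjugate of `ε`. -/
def epsBar : Vec ℂ := ![1 / 2, 0, Complex.I / 2, 0]

/-- The Borel-type subgroup of the elements of the complexified `𝒢₀` that preserve the
half-line `ℝ₊* ε`. -/
def B0 : Set (Mat ℂ) :=
  {B | B ∈ G0 ℂ ∧ ∃ r : ℝ, 0 < r ∧ B *ᵥ eps = (r : ℂ) • eps}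

/-- Pairs (rotation component, translation component), with complex entries. -/
@[ext] structure Motion where
  rot : Mat ℂ
  trans : Vec ℂ

/-- The product `(G, T) (G', T') = (G G', G T' + T)`. -/
instance : Mul Motion := ⟨fun g h => ⟨g.rot * h.rot, g.rot *ᵥ h.trans + g.trans⟩⟩

instance : One Motion := ⟨⟨1, 0⟩⟩

/-- The complexified group of affine symmetries. -/
def GC : Set Motion := {g | g.rot ∈ linGroup ℂ}

/-- The group `𝒢` of affine symmetries: the elements of `GC` with real entries. -/
def G : Set Motion :=
  {g | g ∈ GC ∧ (∀ i j, (g.rot i j).im = 0) ∧ ∀ i, (g.trans i).im = 0}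

/-- The order four automorphism `τ`, conjugation by `(-L_j, 0)`. -/
def tau (g : Motion) : Motion := ⟨-(Lj ℂ * g.rot * Lj ℂ), -(Lj ℂ *ᵥ g.trans)⟩

/-! ### The Lie algebra and its grading -/

/-- Pairs (rotation component, translation component) in the complexified Lie algebra. -/
abbrev LieElt := Mat ℂ × Vec ℂ

/-- The automorphism of the Lie algebra induced by `τ`. -/
def tauLie (ξ : LieElt) : LieElt := (-(Lj ℂ * ξ.1 * Lj ℂ), -(Lj ℂ *ᵥ ξ.2))

/-- The projection onto the eigenspace of `tauLie` for the eigenvalue `i ^ k`. -/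
def proj (k : ℤ) (ξ : LieElt) : LieElt :=
  (1 / 4 : ℂ) • ∑ m ∈ Finset.range 4, Complex.I ^ (-(k * (m : ℤ))) • tauLie^[m] ξ

/-! ### Loops -/

/-- Loops `λ ↦ g_λ`, `λ ∈ S¹`. -/
abbrev Loop := Circle → Motion

def SmoothLoop (g : Loop) : Prop :=
  (∀ i j, ContDiff ℝ ∞ fun θ : ℝ => (g (Circle.exp θ)).rot i j) ∧
  ∀ i, ContDiff ℝ ∞ fun θ : ℝ => (g (Circle.exp θ)).trans i

/-- The twisting condition `g_{iλ} = τ (g_λ)`. -/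
def Twisted (g : Loop) : Prop :=
  ∀ l l' : Circle, (l' : ℂ) = Complex.I * l → g l' = tau (g l)

/-- The twisted loop group of `𝒢`. -/
def LoopG : Set Loop := {g | SmoothLoop g ∧ Twisted g ∧ ∀ l, g l ∈ G}

/-- The twisted loop group of the complexification of `𝒢`. -/
def LoopGC : Set Loop := {g | SmoothLoop g ∧ Twisted g ∧ ∀ l, g l ∈ GC}

/-- The twisted loops that extend holomorphically to the unit disk, with value at `0` in
`(B₀, 0)`. -/
def LoopPlus : Set Loop :=
  {g | g ∈ LoopGC ∧ ∃ e : ℂ → Motion, (∀ l : Circle, e l = g l) ∧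
    (∀ i j, DiffContOnCl ℂ (fun w => (e w).rot i j) (Metric.ball 0 1)) ∧
    (∀ i, DiffContOnCl ℂ (fun w => (e w).trans i) (Metric.ball 0 1)) ∧
    (e 0).rot ∈ B0 ∧ (e 0).trans = 0}

/-- The Fourier coefficient of `λ ^ n` of a loop of vectors. -/
def fourierVec (v : Circle → Vec ℂ) (n : ℤ) : Vec ℂ := fun i =>
  (1 / (2 * Real.pi) : ℂ) *
    ∫ θ in (0 : ℝ)..2 * Real.pi, v (Circle.exp θ) i * ((Circle.exp θ : Circle) : ℂ) ^ (-n)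

/-- The projection of twisted loops in `ℂ⁴` onto twisted loops in `ℝ⁴`, along the loops that extend
holomorphically to the disk:
`P (∑ V_{2n+1} λ^{2n+1}) = ∑_{n ≤ 0} V_{2n-1} λ^{2n-1} + ∑_{n ≥ 0} conj (V_{-2n-1}) λ^{2n+1}`. -/
def P (v : Circle → Vec ℂ) (l : Circle) : Vec ℂ := fun i =>
  (∑' m : ℕ, fourierVec v (-(2 * (m : ℤ) + 1)) i * (l : ℂ) ^ (-(2 * (m : ℤ) + 1))) +
  ∑' m : ℕ, (starRingEnd ℂ) (fourierVec v (-(2 * (m : ℤ) + 1)) i) * (l : ℂ) ^ (2 * (m : ℤ) + 1)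

/-! ### Differential forms on a plane domain -/

/-- `df = p dz + q dz̄` at the point `z`. -/
def HasDzDzbar (f : ℂ → ℂ) (p q z : ℂ) : Prop :=
  HasFDerivAt f (p • ContinuousLinearMap.id ℝ ℂ + q • (Complex.conjCLE : ℂ →L[ℝ] ℂ)) z

/-- `∂f/∂z` for a real-valued function `f`. -/
def dz (f : ℂ → ℝ) (z : ℂ) : ℂ :=
  (1 / 2) * ((fderiv ℝ f z 1 : ℂ) - Complex.I * (fderiv ℝ f z Complex.I : ℂ))

/-- `∂f/∂z̄` for a real-valued function `f`. -/
def dzbar (f : ℂ → ℝ) (z : ℂ) : ℂ :=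
  (1 / 2) * ((fderiv ℝ f z 1 : ℂ) + Complex.I * (fderiv ℝ f z Complex.I : ℂ))

/-- `dU = U α` on `Ω`, where `α = α' dz + α'' dz̄`. -/
def SolvesOn (Ω : Set ℂ) (U : ℂ → Motion) (α' α'' : ℂ → LieElt) : Prop :=
  ∀ z ∈ Ω,
    (∀ i j, HasDzDzbar (fun w => (U w).rot i j)
      (((U z).rot * (α' z).1) i j) (((U z).rot * (α'' z).1) i j) z) ∧
    ∀ i, HasDzDzbar (fun w => (U w).trans i)
      (((U z).rot *ᵥ (α' z).2) i) (((U z).rot *ᵥ (α'' z).2) i) z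

/-- The `dz` coefficient of the Maurer-Cartan form `(F, X)⁻¹ d(F, X) = (F⁻¹ dF, F⁻¹ dX)`. -/
def mcDz (F : ℂ → Mat ℝ) (X : ℂ → Vec ℝ) (z : ℂ) : LieElt :=
  (((F z).map Complex.ofReal)⁻¹ * Matrix.of fun i j => dz (fun w => F w i j) z,
    ((F z).map Complex.ofReal)⁻¹ *ᵥ fun i => dz (fun w => X w i) z)

/-- The `dz̄` coefficient of the Maurer-Cartan form of `(F, X)`. -/
def mcDzbar (F : ℂ → Mat ℝ) (X : ℂ → Vec ℝ) (z : ℂ) : LieElt :=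
  (((F z).map Complex.ofReal)⁻¹ * Matrix.of fun i j => dzbar (fun w => F w i j) z,
    ((F z).map Complex.ofReal)⁻¹ *ᵥ fun i => dzbar (fun w => X w i) z)

/-- The `dz` coefficient of
`α_λ = λ⁻² α₂' + λ⁻¹ α₋₁' + α₀ + λ α₁'' + λ² α₂''`, for `α` the Maurer-Cartan form of `(F, X)`. -/
def extDz (F : ℂ → Mat ℝ) (X : ℂ → Vec ℝ) (l : ℂ) (z : ℂ) : LieElt :=
  l ^ (-2 : ℤ) • proj 2 (mcDz F X z) + l⁻¹ • proj (-1) (mcDz F X z) + proj 0 (mcDz F X z)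

/-- The `dz̄` coefficient of `α_λ`. -/
def extDzbar (F : ℂ → Mat ℝ) (X : ℂ → Vec ℝ) (l : ℂ) (z : ℂ) : LieElt :=
  proj 0 (mcDzbar F X z) + l • proj 1 (mcDzbar F X z) + l ^ 2 • proj 2 (mcDzbar F X z)

/-! ### Conformal Lagrangian immersions and Hamiltonian stationarity -/

/-- The symplectic form `ω = dx¹ ∧ dx² + dx³ ∧ dx⁴`, i.e. `ω (x, y) = ⟨J x, y⟩`. -/
def omega (x y : Vec ℝ) : ℝ := (Li ℝ *ᵥ x) ⬝ᵥ y

/-- `∂X/∂x`, where `z = x + i y`. -/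
def dx (X : ℂ → Vec ℝ) (z : ℂ) : Vec ℝ := fderiv ℝ X z 1

/-- `∂X/∂y`, where `z = x + i y`. -/
def dy (X : ℂ → Vec ℝ) (z : ℂ) : Vec ℝ := fderiv ℝ X z Complex.I

def IsImmersion (Ω : Set ℂ) (X : ℂ → Vec ℝ) : Prop :=
  ContDiffOn ℝ ∞ X Ω ∧ ∀ z ∈ Ω, Function.Injective (fderiv ℝ X z)

structure IsConformalLagrangianImmersion (Ω : Set ℂ) (X : ℂ → Vec ℝ) : Prop where
  immersion : IsImmersion Ω X
  conformal : ∀ z ∈ Ω, dx X z ⬝ᵥ dx X z = dy X z ⬝ᵥ dy X z ∧ dx X z ⬝ᵥ dy X z = 0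
  lagrangian : ∀ z ∈ Ω, omega (dx X z) (dy X z) = 0

/-- The area density of `X` with respect to `dx dy`, from the first fundamental form. -/
def areaDensity (X : ℂ → Vec ℝ) (z : ℂ) : ℝ :=
  Real.sqrt ((dx X z ⬝ᵥ dx X z) * (dy X z ⬝ᵥ dy X z) - (dx X z ⬝ᵥ dy X z) ^ 2)

/-- `X` is a critical point of the area among Hamiltonian variations: for every compactly supported
smooth field `V` along `X` such that the 1-form `ω (V, dX)` equals `dh` for some compactly
supported smooth function `h` on `Ω`, the first variation of the area in the direction `V`
vanishes. -/
def IsHamiltonianStationary (Ω : Set ℂ) (X : ℂ → Vec ℝ) : Prop :=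
  ∀ (V : ℂ → Vec ℝ) (h : ℂ → ℝ),
    ContDiff ℝ ∞ V → HasCompactSupport V → tsupport V ⊆ Ω →
    ContDiff ℝ ∞ h → HasCompactSupport h → tsupport h ⊆ Ω →
    (∀ z ∈ Ω, omega (V z) (dx X z) = fderiv ℝ h z 1 ∧
      omega (V z) (dy X z) = fderiv ℝ h z Complex.I) →
    HasDerivAt (fun t : ℝ => ∫ z in tsupport V, areaDensity (fun w => X w + t • V w) z) 0 0

/-- Lifted conformal Lagrangian immersions `(F, X) : Ω → 𝒢` based at `z₀`: the translation
component of the Maurer-Cartan form is `F⁻¹ dX = e^f K (ε₁ dx + ε₃ dy)`, with `K` smooth and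
`𝒢₀`-valued and `f` smooth. -/
def IsLCLI (Ω : Set ℂ) (z₀ : ℂ) (F : ℂ → Mat ℝ) (X : ℂ → Vec ℝ) : Prop :=
  (∀ i j, ContDiffOn ℝ ∞ (fun z => F z i j) Ω) ∧ ContDiffOn ℝ ∞ X Ω ∧
  (∀ z ∈ Ω, F z ∈ linGroup ℝ) ∧ F z₀ = 1 ∧ X z₀ = 0 ∧
  ∃ (K : ℂ → Mat ℝ) (f : ℂ → ℝ),
    (∀ i j, ContDiffOn ℝ ∞ (fun z => K z i j) Ω) ∧ ContDiffOn ℝ ∞ f Ω ∧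
    ∀ z ∈ Ω, K z ∈ G0 ℝ ∧
      dx X z = Real.exp (f z) • ((F z * K z) *ᵥ Pi.single 0 1) ∧
      dy X z = Real.exp (f z) • ((F z * K z) *ᵥ Pi.single 2 1)

/-- `U : Ω → ΛG_τ` is an extended lift, based at `z₀`, of the Hamiltonian stationary conformal
Lagrangian immersion `X`: for some lift `(F, X)` of `X`, with Maurer-Cartan form `α`, it satisfies
`dU_λ = U_λ α_λ` and `U_λ (z₀) = 1` for all `λ ∈ S¹`. -/
def IsExtendedLiftOf (Ω : Set ℂ) (z₀ : ℂ) (U : ℂ → Loop) (X : ℂ → Vec ℝ) : Prop :=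
  IsConformalLagrangianImmersion Ω X ∧ IsHamiltonianStationary Ω X ∧
  (∀ z ∈ Ω, U z ∈ LoopG) ∧
  ∃ F : ℂ → Mat ℝ, IsLCLI Ω z₀ F X ∧
    ∀ l : Circle, U z₀ l = 1 ∧ SolvesOn Ω (fun z => U z l) (extDz F X l) (extDzbar F X l)

/-! ### The Weierstrass data -/

/-- `γ` is the harmonic conjugate of `β` on `Ω` that vanishes at `z₀`. -/
def IsHarmonicConjugate (Ω : Set ℂ) (z₀ : ℂ) (β γ : ℂ → ℝ) : Prop :=
  DifferentiableOn ℂ (fun z => (β z : ℂ) + Complex.I * (γ z : ℂ)) Ω ∧ γ z₀ = 0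

open Classical in
/-- `∫_{z₀}^z g (v) dv` for a holomorphic function `g` on the simply connected domain `Ω ∋ z₀`: the
primitive of `g` on `Ω` that vanishes at `z₀` (unique on `Ω`). -/
def integralFrom (Ω : Set ℂ) (z₀ : ℂ) (g : ℂ → Vec ℂ) (z : ℂ) : Vec ℂ :=
  if h : ∃ Φ : ℂ → Vec ℂ, Φ z₀ = 0 ∧ ∀ w ∈ Ω, HasDerivAt Φ (g w) w then h.choose z else 0

/-- The vector `a ε + b L_i ε̄`. -/
def wvec (a b : ℂ → ℂ) (z : ℂ) : Vec ℂ := a z • eps + b z • (Li ℂ *ᵥ epsBar)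

/-- The `dz` coefficient of the potential `μ_λ`; its `dz̄` coefficient is zero. -/
def potential (β : ℂ → ℝ) (a b : ℂ → ℂ) (l : ℂ) (z : ℂ) : LieElt :=
  ((l ^ (-2 : ℤ) / 2 * dz β z) • Li ℂ, l⁻¹ • wvec a b z)

/-- `H : Ω → ΛG^ℂ_τ` is the solution of `dH_λ = H_λ μ_λ`, `H_λ (z₀) = 1`. -/
def IntegratesPotential (Ω : Set ℂ) (z₀ : ℂ) (β : ℂ → ℝ) (a b : ℂ → ℂ) (H : ℂ → Loop) : Prop :=
  (∀ z ∈ Ω, H z ∈ LoopGC) ∧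
  ∀ l : Circle, H z₀ l = 1 ∧ SolvesOn Ω (fun z => H z l) (potential β a b l) (fun _ => 0)

/-- `β_λ = (λ⁻² + λ²) β / 2 + i (λ⁻² - λ²) γ / 2`. -/
def betaLoop (β γ : ℂ → ℝ) (l : ℂ) (z : ℂ) : ℂ :=
  (1 / 2) * (l ^ (-2 : ℤ) + l ^ 2) * β z + (Complex.I / 2) * (l ^ (-2 : ℤ) - l ^ 2) * γ z

/-- `e^{c L_i}`. -/
def expLi (c : ℂ) : Mat ℂ := NormedSpace.exp (c • Li ℂ)

/-- `η_λ (z) = ∫_{z₀}^z e^{λ⁻² (β + iγ) L_i / 4} λ⁻¹ (a ε + b L_i ε̄) dv`. -/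
def etaLoop (Ω : Set ℂ) (z₀ : ℂ) (β γ : ℂ → ℝ) (a b : ℂ → ℂ) (l : ℂ) (z : ℂ) : Vec ℂ :=
  integralFrom Ω z₀ (fun v =>
    expLi (l ^ (-2 : ℤ) / 4 * ((β v : ℂ) + Complex.I * (γ v : ℂ))) *ᵥ (l⁻¹ • wvec a b v)) z

/-- `U_λ = (e^{β_λ L_i / 2}, e^{β_λ L_i / 2} P (e^{-β_λ L_i / 2} η_λ))`. -/
def weierstrassMap (Ω : Set ℂ) (z₀ : ℂ) (β γ : ℂ → ℝ) (a b : ℂ → ℂ) (z : ℂ) : Loop := fun l =>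
  ⟨expLi (betaLoop β γ l z / 2),
    expLi (betaLoop β γ l z / 2) *ᵥ
      P (fun l' => expLi (-(betaLoop β γ l' z / 2)) *ᵥ etaLoop Ω z₀ β γ a b l' z) l⟩

/-- The `ℝ⁴`-valued translation component `X_λ` of a map `U : Ω → ΛG_τ`. -/
def translationPart (U : ℂ → Loop) (l : Circle) (z : ℂ) : Vec ℝ := fun i => ((U z l).trans i).re

end

end HamStat

open HamStat

/-! Put `φ = β + iγ`. The rotation part of the potential is a multiple of `L_i`, so the equation for
`H` integrates explicitly: `H_λ = (e^{λ⁻² φ L_i / 4}, η_λ)` with `η_λ` a primitive. On the unit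
circle `β_λ / 2 = λ⁻² φ / 4 + λ² φ̄ / 4` is real, so `e^{β_λ L_i / 2}` is a real rotation; it
differs from the rotation of `H_λ` by the factor `e^{-λ² φ̄ L_i / 4}`, which is holomorphic in `λ`
and equal to `1` at `λ = 0`. The translation `v_λ = e^{-β_λ L_i / 2} η_λ` splits into `P v_λ`, its
negative half plus the conjugate of that half and therefore real, and a remainder with positive odd
powers only. This is the factorization `H = U V` (`holLoop_eq`, `frameLoop_mem`, `plusLoop_mem`).
For uniqueness (`left_factor_unique`), two factorizations produce a loop that is real on the circle
and holomorphic in the disk, hence constant, and `B₀` contains no real element other than `1`.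

For the geometric part, multiplication by `λ^{±2}` commutes with the negative projection up to a
single Laurent coefficient of index `±1`. Hence `F_λ⁻¹ dX_λ = λ⁻¹ Y dz + λ Ȳ dz̄` with `Y`
(`frameVec`) independent of `λ` (`hasWirt_transPart`), and `L_j Y = i Y`. A vector with this
eigenvalue is determined by its real part, so `X_λ` is an immersion exactly when `Y` has no zero,
for every `λ` alike (`isImmersion_translationPart`).

If `Y` has no zero, `X₁` has the frame `F u, F L_j u` with `u = 2 Re Y`, so it is conformal and
Lagrangian. The equation `∂Y/∂z̄ = (φ' / 4) L_i Ȳ` (`hasWirt_frameVec`) gives `ΔX = L_i (β_x X_x +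
β_y X_y)`; two integrations by parts and the harmonicity of `β` then make the first variation vanish
(`isHamiltonianStationary_of_laplacian`). Conversely, any extended lift, read at `λ = 1`, identifies
`Y` with `e^f K (ε₁ - i ε₃) / 2`, which is not zero (`frameVec_ne_zero`).

All loops live in one commutative Banach algebra `LA`, the uniform limits of Laurent polynomials on
an annulus around the circle. Laurent coefficients then decay geometrically, projections are
continuous linear maps that can be differentiated through, and identities between them need checking
on monomials only. -/

namespace HamStat

open Filter Topology

/-! ### Primitives on simply connected domains -/

/-- On a simply connected space, functions given locally up to additive constants glue. -/
theorem exists_glue_of_locally_const_sub {X E : Type*} [TopologicalSpace X]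
    [SimplyConnectedSpace X] [LocallyPathConnectedSpace X] [AddCommGroup E]
    (U : X → Set X) (hU : ∀ i, IsOpen (U i)) (hmem : ∀ x, x ∈ U x) (F : X → X → E)
    (hF : ∀ i j, ∀ x ∈ U i ∩ U j, ∀ᶠ y in 𝓝 x, F i y - F j y = F i x - F j x) :
    ∃ Φ : X → E, ∀ x, ∃ c, ∀ᶠ y in 𝓝 x, Φ y = F x y + c := by
  -- With `E` discrete, the bundle whose transition maps are the locally constant translations by `F
  -- i - F j` is a covering space.
  let _ : TopologicalSpace E := ⊥
  have : DiscreteTopology E := ⟨rfl⟩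
  let Z : FiberBundleCore X X E :=
    { baseSet := U
      isOpen_baseSet := hU
      indexAt := id
      mem_baseSet_at := hmem
      coordChange := fun i j x v => v + (F i x - F j x)
      coordChange_self := by intros; simp
      continuousOn_coordChange := by
        rintro i j ⟨x, v⟩ ⟨hx, -⟩
        refine ContinuousAt.continuousWithinAt ?_
        refine (continuousAt_const (y := v + (F i x - F j x))).congr ?_
        have h1 : ∀ᶠ p : X × E in 𝓝 (x, v), F i p.1 - F j p.1 = F i x - F j x :=
          (continuous_fst.tendsto (x, v)).eventually (hF i j x hx)
        have h2 : ∀ᶠ p : X × E in 𝓝 (x, v), p.2 = v :=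
          (continuous_snd.tendsto (x, v)).eventually
            (p := fun e => e = v) ((isOpen_discrete {v}).mem_nhds rfl)
        filter_upwards [h1, h2] with p hp1 hp2
        rw [hp1, hp2]
      coordChange_comp := by intros; abel }
  have cov : IsCoveringMap (Bundle.TotalSpace.proj : Z.TotalSpace → X) :=
    FiberBundle.isCoveringMap (F := E) (E := Z.Fiber)
  obtain ⟨x₀⟩ : Nonempty X := inferInstance
  -- Simple connectedness enters here: the identity of `X` lifts to the covering, which gives a
  -- global section.
  obtain ⟨s, ⟨-, hs⟩, -⟩ := cov.existsUnique_continuousMap_lifts (ContinuousMap.id X) x₀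
    (⟨x₀, (0 : E)⟩ : Z.TotalSpace) rfl
  have hs' : ∀ x, (s x).1 = x := fun x => congrFun hs x
  -- The fibre coordinate of `s x` is taken in the chart indexed by `x` itself. Near `x`, in the
  -- fixed chart of `x`, the section is locally constant, and that value is the additive constant.
  refine ⟨fun x => (show E from (s x).2) + F x x, fun x => ?_⟩
  have hcont : ContinuousAt (fun y => (Z.localTriv x (s y)).2) x := by
    have hsx : s x ∈ (Z.localTriv x).source := by
      rw [Z.mem_localTriv_source, hs']; exact hmem x
    exact (continuous_snd.continuousAt).comp
      (((Z.localTriv x).continuousAt hsx).comp s.continuous.continuousAt)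
  refine ⟨(Z.localTriv x (s x)).2, ?_⟩
  have hev : ∀ᶠ y in 𝓝 x, (Z.localTriv x (s y)).2 = (Z.localTriv x (s x)).2 :=
    hcont.eventually (p := fun e => e = (Z.localTriv x (s x)).2)
      ((isOpen_discrete {(Z.localTriv x (s x)).2}).mem_nhds rfl)
  filter_upwards [hev] with y hy
  rw [← hy]
  change _ = F x y + ((show E from (s y).2) + (F (s y).1 (s y).1 - F x (s y).1))
  rw [hs' y]
  abel

/-- Holomorphic functions with values in a Banach space have primitives on simply connected
domains. -/
theorem exists_primitive {E : Type*} [NormedAddCommGroup E] [NormedSpace ℂ E] [CompleteSpace E]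
    {Ω : Set ℂ} (hΩo : IsOpen Ω) (hΩ : IsSimplyConnected Ω) {g : ℂ → E}
    (hg : DifferentiableOn ℂ g Ω) (z₀ : ℂ) :
    ∃ Φ : ℂ → E, Φ z₀ = 0 ∧ ∀ w ∈ Ω, HasDerivAt Φ (g w) w := by
  classical
  have := hΩ.simplyConnectedSpace
  have := hΩo.locallyPathConnectedSpace
  choose r hr hrΩ using fun x : Ω => Metric.isOpen_iff.1 hΩo x x.2
  choose F hF using fun x : Ω => (hg.mono (hrΩ x)).isExactOn_ball
  obtain ⟨Φ, hΦ⟩ := exists_glue_of_locally_const_sub (X := Ω)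
    (fun i => (↑) ⁻¹' Metric.ball (i : ℂ) (r i))
    (fun i => Metric.isOpen_ball.preimage continuous_subtype_val)
    (fun x => Metric.mem_ball_self (hr x)) (fun i x => F i x) (by
      rintro i j x ⟨hxi, hxj⟩
      have hconst : ∀ y ∈ Metric.ball (i : ℂ) (r i) ∩ Metric.ball (j : ℂ) (r j),
          F i y - F j y = F i x - F j x := by
        intro y hy
        have hopen := (Metric.isOpen_ball (x := (i : ℂ)) (ε := r i)).inter
          (Metric.isOpen_ball (x := (j : ℂ)) (ε := r j))
        have hd : ∀ y ∈ Metric.ball (i : ℂ) (r i) ∩ Metric.ball (j : ℂ) (r j),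
            HasDerivAt (fun y => F i y - F j y) 0 y := fun y hy => by
          have h := (hF i y hy.1).sub (hF j y hy.2)
          rwa [sub_self] at h
        exact hopen.is_const_of_deriv_eq_zero
          (((convex_ball _ _).inter (convex_ball _ _)).isPreconnected)
          (fun y hy => (hd y hy).differentiableAt.differentiableWithinAt)
          (fun y hy => (hd y hy).deriv) hy ⟨hxi, hxj⟩
      have hn : ∀ᶠ y : Ω in 𝓝 x,
          (y : ℂ) ∈ Metric.ball (i : ℂ) (r i) ∩ Metric.ball (j : ℂ) (r j) :=
        continuous_subtype_val.continuousAt.eventually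
          ((Metric.isOpen_ball.inter Metric.isOpen_ball).mem_nhds ⟨hxi, hxj⟩)
      filter_upwards [hn] with y hy using hconst y hy)
  -- The value `0` off `Ω` is immaterial, since `Ω` is open and derivatives are taken at its points
  -- only. Subtracting `Ψ z₀` normalizes even when `z₀` is outside `Ω`.
  let Ψ : ℂ → E := fun z => if h : z ∈ Ω then Φ ⟨z, h⟩ else 0
  refine ⟨fun z => Ψ z - Ψ z₀, by simp, fun w hw => ?_⟩
  obtain ⟨c, hc⟩ := hΦ ⟨w, hw⟩
  have hev : ∀ᶠ y in 𝓝 w, Ψ y = F ⟨w, hw⟩ y + c := by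
    rw [nhds_subtype_eq_comap] at hc
    obtain ⟨t, ht, hts⟩ := hc
    filter_upwards [ht, hΩo.mem_nhds hw] with y hy hyΩ
    simp only [Ψ, hyΩ, dif_pos]
    exact hts (a := ⟨y, hyΩ⟩) hy
  have h1 := ((hF ⟨w, hw⟩ w (Metric.mem_ball_self (hr _))).add_const c).congr_of_eventuallyEq hev
  exact h1.sub_const _

/-- A primitive is determined by its value at one point of a connected domain. -/
theorem eqOn_of_hasDerivAt_eq {E : Type*} [NormedAddCommGroup E] [NormedSpace ℂ E]
    {Ω : Set ℂ} (hΩo : IsOpen Ω) (hΩ : IsPreconnected Ω) {f g f' : ℂ → E}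
    (hf : ∀ w ∈ Ω, HasDerivAt f (f' w) w) (hg : ∀ w ∈ Ω, HasDerivAt g (f' w) w)
    {z₀ : ℂ} (hz₀ : z₀ ∈ Ω) (h : f z₀ = g z₀) : Set.EqOn f g Ω := by
  intro z hz
  have hd : ∀ y ∈ Ω, HasDerivAt (fun y => f y - g y) 0 y := fun y hy => by
    have h := (hf y hy).sub (hg y hy)
    rwa [sub_self] at h
  have := hΩo.is_const_of_deriv_eq_zero hΩ
    (fun y hy => (hd y hy).differentiableAt.differentiableWithinAt)
    (fun y hy => (hd y hy).deriv) hz hz₀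
  simpa [h, sub_eq_zero] using this

end HamStat


/-! ### The Banach algebra of Laurent series on an annulus -/

namespace HamStat

noncomputable section

open Filter Topology

/-- The closed annulus `1/2 ≤ |s| ≤ 2`. -/
def annulus : Set ℂ := {s | 1 / 2 ≤ ‖s‖ ∧ ‖s‖ ≤ 2}

theorem isCompact_annulus : IsCompact annulus := by
  refine Metric.isCompact_of_isClosed_isBounded ?_ ?_
  · exact (isClosed_le continuous_const continuous_norm).inter
      (isClosed_le continuous_norm continuous_const)
  · exact (Metric.isBounded_closedBall (x := (0 : ℂ)) (r := 2)).subset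
      (fun s hs => by simpa using hs.2)

instance : CompactSpace annulus := isCompact_iff_compactSpace.1 isCompact_annulus

theorem ne_zero_of_mem_annulus {s : ℂ} (hs : s ∈ annulus) : s ≠ 0 := by
  rintro rfl
  have := hs.1
  norm_num at this

/-- The monomial `s ↦ s ^ n` as a continuous function on the annulus. -/
def annulusMonomial (n : ℤ) : C(annulus, ℂ) where
  toFun s := (s : ℂ) ^ n
  continuous_toFun := continuous_subtype_val.zpow₀ n fun s => Or.inl (ne_zero_of_mem_annulus s.2)

theorem annulusMonomial_mul (m n : ℤ) :
    annulusMonomial m * annulusMonomial n = annulusMonomial (m + n) := by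
  ext s
  exact (zpow_add₀ (ne_zero_of_mem_annulus s.2) m n).symm

theorem annulusMonomial_zero : annulusMonomial 0 = 1 := by
  ext s
  simp [annulusMonomial]

/-- The monomials form a submonoid. -/
def annulusMonomials : Submonoid C(annulus, ℂ) where
  carrier := Set.range annulusMonomial
  one_mem' := ⟨0, annulusMonomial_zero⟩
  mul_mem' := by
    rintro _ _ ⟨m, rfl⟩ ⟨n, rfl⟩
    exact ⟨m + n, (annulusMonomial_mul m n).symm⟩

/-- The closure of the Laurent polynomials in the continuous functions on the annulus. -/
def laurentSubalgebra : Subalgebra ℂ C(annulus, ℂ) :=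
  (Algebra.adjoin ℂ (annulusMonomials : Set C(annulus, ℂ))).topologicalClosure

/-- The Banach algebra of uniform limits of Laurent polynomials on the annulus. -/
def LA : Type := laurentSubalgebra

instance : NormedCommRing LA := inferInstanceAs (NormedCommRing laurentSubalgebra)

instance : NormedAlgebra ℂ LA := inferInstanceAs (NormedAlgebra ℂ laurentSubalgebra)

instance : CompleteSpace LA :=
  (Subalgebra.isClosed_topologicalClosure
    (Algebra.adjoin ℂ (annulusMonomials : Set C(annulus, ℂ)))).completeSpace_coe

/-- The underlying continuous function on the annulus. -/
def LA.toCont : LA →L[ℂ] C(annulus, ℂ) := laurentSubalgebra.toSubmodule.subtypeL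

theorem LA.norm_toCont (f : LA) : ‖LA.toCont f‖ = ‖f‖ := rfl

/-- The monomial `s ^ n` in the Laurent algebra. -/
def mono (n : ℤ) : LA :=
  ⟨annulusMonomial n, subset_closure (Algebra.subset_adjoin ⟨n, rfl⟩)⟩

theorem toCont_mono (n : ℤ) : LA.toCont (mono n) = annulusMonomial n := rfl

theorem mono_mul (m n : ℤ) : mono m * mono n = mono (m + n) :=
  Subtype.ext (annulusMonomial_mul m n)

theorem mono_zero : mono 0 = 1 := Subtype.ext annulusMonomial_zero

/-- Continuous linear maps on the Laurent algebra are determined by their values on monomials. -/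
theorem LA.clm_ext {G : Type*} [NormedAddCommGroup G] [NormedSpace ℂ G] {S T : LA →L[ℂ] G}
    (h : ∀ n, S (mono n) = T (mono n)) : S = T := by
  ext ⟨f, hf⟩
  -- The monomials are closed under multiplication, so the algebra they generate is just their
  -- linear span; density carries the equality to the closure.
  have hpoly : ∀ p ∈ Algebra.adjoin ℂ (annulusMonomials : Set C(annulus, ℂ)),
      ∀ hp : p ∈ laurentSubalgebra, S ⟨p, hp⟩ = T ⟨p, hp⟩ := by
    intro p hp
    rw [← Subalgebra.mem_toSubmodule, Algebra.adjoin_eq_span, Submonoid.closure_eq] at hp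
    induction hp using Submodule.span_induction with
    | mem x hx => rintro hp; obtain ⟨n, rfl⟩ := hx; exact h n
    | zero => intro hp; exact (map_zero S).trans (map_zero T).symm
    | add x y hx hy ihx ihy =>
      intro hp
      have hx' : x ∈ laurentSubalgebra := subset_closure (by
        rw [← Submonoid.closure_eq annulusMonomials, ← Algebra.adjoin_eq_span] at hx; exact hx)
      have hy' : y ∈ laurentSubalgebra := subset_closure (by
        rw [← Submonoid.closure_eq annulusMonomials, ← Algebra.adjoin_eq_span] at hy; exact hy)
      have := congrArg₂ (· + ·) (ihx hx') (ihy hy')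
      exact (map_add S (⟨x, hx'⟩ : LA) ⟨y, hy'⟩).trans
        (this.trans (map_add T (⟨x, hx'⟩ : LA) ⟨y, hy'⟩).symm)
    | smul c x hx ihx =>
      intro hp
      have hx' : x ∈ laurentSubalgebra := subset_closure (by
        rw [← Submonoid.closure_eq annulusMonomials, ← Algebra.adjoin_eq_span] at hx; exact hx)
      have := congrArg (c • ·) (ihx hx')
      exact (map_smul S c (⟨x, hx'⟩ : LA)).trans
        (this.trans (map_smul T c (⟨x, hx'⟩ : LA)).symm)
  have hclosed : IsClosed {x : laurentSubalgebra | S x = T x} :=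
    isClosed_eq S.continuous T.continuous
  have hdense : Dense {x : laurentSubalgebra |
      (x : C(annulus, ℂ)) ∈ Algebra.adjoin ℂ (annulusMonomials : Set C(annulus, ℂ))} := by
    rw [Subtype.dense_iff]
    intro x hx
    refine closure_mono ?_ hx
    intro p hp
    exact ⟨⟨p, subset_closure hp⟩, hp, rfl⟩
  have hsub := hclosed.closure_subset_iff.2
    (fun x (hx : (x : C(annulus, ℂ)) ∈ _) => hpoly x hx x.2)
  exact hsub (hdense ⟨f, hf⟩)

/-- The point `r e^{iθ}` of the annulus. -/
def annulusPoint (r : ℝ) (hr : 1 / 2 ≤ r ∧ r ≤ 2) (θ : ℝ) : annulus :=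
  ⟨r * (Circle.exp θ : ℂ), by
    have : ‖(r : ℂ) * (Circle.exp θ : ℂ)‖ = r := by
      rw [norm_mul, Circle.norm_coe, mul_one, Complex.norm_real, Real.norm_of_nonneg (by linarith)]
    simpa only [annulus, Set.mem_ofPred_eq, this] using hr⟩

theorem continuous_annulusPoint (r : ℝ) (hr : 1 / 2 ≤ r ∧ r ≤ 2) :
    Continuous (annulusPoint r hr) := by
  unfold annulusPoint
  fun_prop

theorem continuous_coef_integrand (r : ℝ) (hr : 1 / 2 ≤ r ∧ r ≤ 2) (n : ℤ) (f : LA) :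
    Continuous fun θ => LA.toCont f (annulusPoint r hr θ) * (annulusPoint r hr θ : ℂ) ^ (-n) :=
  ((LA.toCont f).continuous.comp (continuous_annulusPoint r hr)).mul
    ((continuous_subtype_val.comp (continuous_annulusPoint r hr)).zpow₀ _
      fun θ => Or.inl (ne_zero_of_mem_annulus (annulusPoint r hr θ).2))

theorem norm_annulusPoint (r : ℝ) (hr : 1 / 2 ≤ r ∧ r ≤ 2) (θ : ℝ) :
    ‖(annulusPoint r hr θ : ℂ)‖ = r := by
  simp only [annulusPoint, norm_mul, Circle.norm_coe, mul_one, Complex.norm_real]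
  exact Real.norm_of_nonneg (by linarith)

/-- Cauchy's estimate on the circle of radius `r`: the integrand is bounded by the sup norm times `r
^ (-n)`. -/
theorem norm_coef_le (r : ℝ) (hr : 1 / 2 ≤ r ∧ r ≤ 2) (n : ℤ) (f : LA) :
    ‖(1 / (2 * Real.pi) : ℂ) * ∫ θ in (0 : ℝ)..2 * Real.pi,
      LA.toCont f (annulusPoint r hr θ) * (annulusPoint r hr θ : ℂ) ^ (-n)‖ ≤ r ^ (-n) * ‖f‖ := by
  have hpi := Real.pi_pos
  have h := intervalIntegral.norm_integral_le_of_norm_le_const (a := 0) (b := 2 * Real.pi)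
    (f := fun θ => LA.toCont f (annulusPoint r hr θ) * (annulusPoint r hr θ : ℂ) ^ (-n))
    (C := r ^ (-n) * ‖f‖) (by
      intro θ _
      rw [norm_mul, norm_zpow, norm_annulusPoint, mul_comm]
      have := (LA.toCont f).norm_coe_le_norm (annulusPoint r hr θ)
      rw [LA.norm_toCont] at this
      have h0 : 0 ≤ r ^ (-n) := zpow_nonneg (by linarith) _
      gcongr)
  rw [norm_mul]
  have h2 : ‖(1 / (2 * Real.pi) : ℂ)‖ = 1 / (2 * Real.pi) := by
    rw [norm_div, norm_mul, Complex.norm_real, Real.norm_of_nonneg hpi.le]; simp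
  rw [h2]
  rw [sub_zero, abs_of_pos (by positivity)] at h
  calc _ ≤ 1 / (2 * Real.pi) * (r ^ (-n) * ‖f‖ * (2 * Real.pi)) := by gcongr
    _ = _ := by field_simp

/-- The `n`-th Laurent coefficient, computed on the circle of radius `r`. -/
def coefAt (r : ℝ) (hr : 1 / 2 ≤ r ∧ r ≤ 2) (n : ℤ) : LA →L[ℂ] ℂ :=
  LinearMap.mkContinuous
    { toFun := fun f => (1 / (2 * Real.pi) : ℂ) * ∫ θ in (0 : ℝ)..2 * Real.pi,
        LA.toCont f (annulusPoint r hr θ) * (annulusPoint r hr θ : ℂ) ^ (-n)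
      map_add' := fun f g => by
        rw [← mul_add, ← intervalIntegral.integral_add
          ((continuous_coef_integrand r hr n f).intervalIntegrable _ _)
          ((continuous_coef_integrand r hr n g).intervalIntegrable _ _)]
        simp only [map_add, ContinuousMap.add_apply, add_mul]
      map_smul' := fun c f => by
        simp only [map_smul, ContinuousMap.smul_apply, smul_eq_mul, mul_assoc,
          intervalIntegral.integral_const_mul, RingHom.id_apply]
        ring }
    (r ^ (-n)) (norm_coef_le r hr n)

theorem integral_circleExp_zpow (n : ℤ) :
    (1 / (2 * Real.pi) : ℂ) * ∫ θ in (0 : ℝ)..2 * Real.pi, (Circle.exp θ : ℂ) ^ n =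
      if n = 0 then 1 else 0 := by
  have hpi : (Real.pi : ℂ) ≠ 0 := by exact_mod_cast Real.pi_ne_zero
  have hz : ∀ θ : ℝ, (Circle.exp θ : ℂ) ^ n = Complex.exp (((n : ℂ) * Complex.I) * θ) := by
    intro θ
    rw [Circle.coe_exp, ← Complex.exp_int_mul]
    congr 1
    ring
  simp_rw [hz]
  split_ifs with h
  · subst h
    simp
    field_simp
  · have hn : (n : ℂ) * Complex.I ≠ 0 := mul_ne_zero (by exact_mod_cast h) Complex.I_ne_zero
    rw [integral_exp_mul_complex hn]
    have h1 : Complex.exp ((n : ℂ) * Complex.I * ((2 * Real.pi : ℝ) : ℂ)) = 1 := by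
      rw [Complex.exp_eq_one_iff]
      exact ⟨n, by push_cast; ring⟩
    rw [h1]
    simp

theorem coefAt_mono (r : ℝ) (hr : 1 / 2 ≤ r ∧ r ≤ 2) (n m : ℤ) :
    coefAt r hr n (mono m) = if m = n then 1 else 0 := by
  have hr0 : (r : ℂ) ≠ 0 := by
    have : r ≠ 0 := by linarith [hr.1]
    exact_mod_cast this
  have h : ∀ θ, LA.toCont (mono m) (annulusPoint r hr θ) * (annulusPoint r hr θ : ℂ) ^ (-n) =
      (r : ℂ) ^ (m - n) * (Circle.exp θ : ℂ) ^ (m - n) := by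
    intro θ
    rw [toCont_mono]
    change (annulusPoint r hr θ : ℂ) ^ m * _ = _
    rw [← zpow_add₀ (ne_zero_of_mem_annulus (annulusPoint r hr θ).2), ← mul_zpow]
    rfl
  change (1 / (2 * Real.pi) : ℂ) * ∫ θ in (0 : ℝ)..2 * Real.pi,
        LA.toCont (mono m) (annulusPoint r hr θ) * (annulusPoint r hr θ : ℂ) ^ (-n) = _
  simp_rw [h]
  rw [intervalIntegral.integral_const_mul, mul_left_comm, integral_circleExp_zpow]
  by_cases hmn : m = n
  · simp [hmn]
  · simp [hmn, sub_eq_zero]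

/-- The `n`-th Laurent coefficient. -/
def coef (n : ℤ) : LA →L[ℂ] ℂ := coefAt 1 (by norm_num) n

theorem coef_mono (n m : ℤ) : coef n (mono m) = if m = n then 1 else 0 := coefAt_mono _ _ _ _

/-- Independence of the radius without deforming a contour: the two functionals are continuous and
agree on monomials. -/
theorem coef_eq_coefAt (r : ℝ) (hr : 1 / 2 ≤ r ∧ r ≤ 2) (n : ℤ) : coef n = coefAt r hr n :=
  LA.clm_ext fun m => by rw [coef_mono, coefAt_mono]

/-- For negative indices the inner circle of radius `1 / 2` gives geometric decay; for nonnegative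
indices the outer circle of radius `2` plays that role. -/
theorem norm_coef_neg_le (n : ℕ) (f : LA) : ‖coef (-n) f‖ ≤ (1 / 2) ^ n * ‖f‖ := by
  rw [coef_eq_coefAt (1 / 2) (by norm_num)]
  refine (norm_coef_le _ _ _ _).trans_eq ?_
  rw [neg_neg, zpow_natCast]

theorem norm_coef_nat_le (n : ℕ) (f : LA) : ‖coef n f‖ ≤ (1 / 2) ^ n * ‖f‖ := by
  rw [coef_eq_coefAt 2 (by norm_num)]
  refine (norm_coef_le _ _ _ _).trans_eq ?_
  rw [zpow_neg, zpow_natCast, one_div, inv_pow]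

/-- The point of the annulus given by a point of the unit circle. -/
def circlePoint (l : Circle) : annulus := ⟨l, by
  change 1 / 2 ≤ ‖(l : ℂ)‖ ∧ ‖(l : ℂ)‖ ≤ 2
  rw [Circle.norm_coe]
  norm_num⟩

/-- Evaluation at a point of the unit circle, as an algebra homomorphism. -/
def evalHom (l : Circle) : LA →ₐ[ℂ] ℂ where
  toFun f := LA.toCont f (circlePoint l)
  map_one' := rfl
  map_mul' _ _ := rfl
  map_zero' := rfl
  map_add' _ _ := rfl
  commutes' _ := rfl

/-- Evaluation at a point of the unit circle. -/
def eval (l : Circle) : LA →L[ℂ] ℂ :=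
  (ContinuousMap.evalCLM ℂ (circlePoint l)).comp LA.toCont

theorem eval_mul (l : Circle) (f g : LA) : eval l (f * g) = eval l f * eval l g := rfl

theorem eval_mono (l : Circle) (n : ℤ) : eval l (mono n) = (l : ℂ) ^ n := rfl

theorem coef_eq_integral (n : ℤ) (f : LA) :
    coef n f = (1 / (2 * Real.pi) : ℂ) *
      ∫ θ in (0 : ℝ)..2 * Real.pi, eval (Circle.exp θ) f * (Circle.exp θ : ℂ) ^ (-n) := by
  have h : ∀ θ, annulusPoint 1 (by norm_num) θ = circlePoint (Circle.exp θ) := fun θ =>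
    Subtype.ext (by simp [annulusPoint, circlePoint])
  change (1 / (2 * Real.pi) : ℂ) * ∫ θ in (0 : ℝ)..2 * Real.pi,
        LA.toCont f (annulusPoint 1 _ θ) * (annulusPoint 1 _ θ : ℂ) ^ (-n) = _
  simp_rw [h]
  rfl

end

end HamStat


/-! ### The odd negative and positive parts of a Laurent series -/

namespace HamStat

noncomputable section

open Filter Topology

theorem summable_odd_geometric : Summable fun m : ℕ => (1 / 2 : ℝ) ^ (2 * m + 1) := by
  have h : Summable fun m : ℕ => ((1 / 2 : ℝ) ^ 2) ^ m * (1 / 2) :=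
    (summable_geometric_of_lt_one (by norm_num) (by norm_num)).mul_right _
  refine h.congr fun m => ?_
  rw [pow_succ (1 / 2 : ℝ) (2 * m), pow_mul]

theorem opNorm_coef_neg_le (n : ℕ) : ‖coef (-n)‖ ≤ (1 / 2) ^ n :=
  ContinuousLinearMap.opNorm_le_bound _ (by positivity) (norm_coef_neg_le n)

theorem opNorm_coef_nat_le (n : ℕ) : ‖coef n‖ ≤ (1 / 2) ^ n :=
  ContinuousLinearMap.opNorm_le_bound _ (by positivity) (norm_coef_nat_le n)

theorem norm_circle_zpow (l : Circle) (n : ℤ) : ‖(l : ℂ) ^ n‖ = 1 := by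
  rw [norm_zpow, Circle.norm_coe, one_zpow]

/-- Summability holds in operator norm and not merely pointwise, so the projections built from these
series are continuous linear maps and commute with derivatives in `z`. -/
theorem summable_neg (l : Circle) :
    Summable fun m : ℕ => (l : ℂ) ^ (-(2 * (m : ℤ) + 1)) • coef (-(2 * (m : ℤ) + 1)) := by
  refine Summable.of_norm_bounded summable_odd_geometric fun m => ?_
  rw [norm_smul, norm_circle_zpow, one_mul]
  exact_mod_cast opNorm_coef_neg_le (2 * m + 1)

theorem summable_pos (l : Circle) :
    Summable fun m : ℕ => (l : ℂ) ^ (2 * (m : ℤ) + 1) • coef (2 * (m : ℤ) + 1) := by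
  refine Summable.of_norm_bounded summable_odd_geometric fun m => ?_
  rw [norm_smul, norm_circle_zpow, one_mul]
  exact_mod_cast opNorm_coef_nat_le (2 * m + 1)

/-- The odd negative part of a Laurent series, evaluated at a point of the unit circle. -/
def negPart (l : Circle) : LA →L[ℂ] ℂ :=
  ∑' m : ℕ, (l : ℂ) ^ (-(2 * (m : ℤ) + 1)) • coef (-(2 * (m : ℤ) + 1))

/-- The odd positive part of a Laurent series, evaluated at a point of the unit circle. -/
def posPart (l : Circle) : LA →L[ℂ] ℂ :=
  ∑' m : ℕ, (l : ℂ) ^ (2 * (m : ℤ) + 1) • coef (2 * (m : ℤ) + 1)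

theorem hasSum_negPart (l : Circle) (f : LA) :
    HasSum (fun m : ℕ => coef (-(2 * (m : ℤ) + 1)) f * (l : ℂ) ^ (-(2 * (m : ℤ) + 1)))
      (negPart l f) := by
  have := (summable_neg l).hasSum.mapL (ContinuousLinearMap.apply ℂ ℂ f)
  refine this.congr_fun ?_
  intro m
  simp [mul_comm]

theorem hasSum_posPart (l : Circle) (f : LA) :
    HasSum (fun m : ℕ => coef (2 * (m : ℤ) + 1) f * (l : ℂ) ^ (2 * (m : ℤ) + 1))
      (posPart l f) := by
  have := (summable_pos l).hasSum.mapL (ContinuousLinearMap.apply ℂ ℂ f)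
  refine this.congr_fun ?_
  intro m
  simp [mul_comm]

theorem negPart_mono_odd (l : Circle) (k : ℕ) :
    negPart l (mono (-(2 * (k : ℤ) + 1))) = (l : ℂ) ^ (-(2 * (k : ℤ) + 1)) := by
  refine (hasSum_negPart l _).unique ?_
  refine (hasSum_ite_eq k ((l : ℂ) ^ (-(2 * (k : ℤ) + 1)))).congr_fun fun m => ?_
  rw [coef_mono]
  by_cases h : m = k
  · subst h; simp
  · rw [if_neg h, if_neg (by omega), zero_mul]

theorem negPart_mono_of_ne (l : Circle) {n : ℤ} (h : ∀ k : ℕ, n ≠ -(2 * (k : ℤ) + 1)) :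
    negPart l (mono n) = 0 := by
  refine (hasSum_negPart l _).unique ?_
  refine hasSum_zero.congr_fun fun m => ?_
  rw [coef_mono, if_neg (h m), zero_mul]

theorem posPart_mono_odd (l : Circle) (k : ℕ) :
    posPart l (mono (2 * (k : ℤ) + 1)) = (l : ℂ) ^ (2 * (k : ℤ) + 1) := by
  refine (hasSum_posPart l _).unique ?_
  refine (hasSum_ite_eq k ((l : ℂ) ^ (2 * (k : ℤ) + 1))).congr_fun fun m => ?_
  rw [coef_mono]
  by_cases h : m = k
  · subst h; simp
  · rw [if_neg h, if_neg (by omega), zero_mul]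

theorem posPart_mono_of_ne (l : Circle) {n : ℤ} (h : ∀ k : ℕ, n ≠ 2 * (k : ℤ) + 1) :
    posPart l (mono n) = 0 := by
  refine (hasSum_posPart l _).unique ?_
  refine hasSum_zero.congr_fun fun m => ?_
  rw [coef_mono, if_neg (h m), zero_mul]

/-- Multiplication by a fixed element of the Laurent algebra. -/
def mulL (g : LA) : LA →L[ℂ] LA := ContinuousLinearMap.mul ℂ LA g

theorem mulL_apply (g f : LA) : mulL g f = g * f := rfl

theorem coef_mono_mul (n m : ℤ) (f : LA) : coef n (mono m * f) = coef (n - m) f := by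
  have : (coef n).comp (mulL (mono m)) = coef (n - m) := LA.clm_ext fun k => by
    rw [ContinuousLinearMap.comp_apply, mulL_apply, mono_mul, coef_mono, coef_mono]
    exact if_congr (by omega) rfl rfl
  exact DFunLike.congr_fun this f

/-- The shift by two moves the coefficient of index `1` down to index `-1`, where the negative part
starts to see it; the other negative terms are merely multiplied. This boundary term is one of the
two sources of `residue`. -/
theorem negPart_mono_neg_two_mul (l : Circle) (f : LA) :
    negPart l (mono (-2) * f) =
      (l : ℂ) ^ (-2 : ℤ) * negPart l f + (l : ℂ) ^ (-1 : ℤ) * coef 1 f := by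
  have hl : (l : ℂ) ≠ 0 := Circle.coe_ne_zero l
  refine (hasSum_negPart l _).unique ?_
  have h := (hasSum_negPart l f).mul_left ((l : ℂ) ^ (-2 : ℤ))
  -- The term `m = 0` of the shifted series is the one coming from `coef 1 f`; without it the series
  -- is the old one times `λ⁻²`.
  have h' := (hasSum_nat_add_iff' (f := fun m : ℕ => coef (-(2 * (m : ℤ) + 1)) (mono (-2) * f) *
    (l : ℂ) ^ (-(2 * (m : ℤ) + 1))) 1
    (g := (l : ℂ) ^ (-2 : ℤ) * negPart l f + (l : ℂ) ^ (-1 : ℤ) * coef 1 f)).1 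
  refine h' ?_
  have e : (l : ℂ) ^ (-2 : ℤ) * negPart l f + (l : ℂ) ^ (-1 : ℤ) * coef 1 f -
      ∑ m ∈ Finset.range 1, coef (-(2 * (m : ℤ) + 1)) (mono (-2) * f) *
        (l : ℂ) ^ (-(2 * (m : ℤ) + 1)) = (l : ℂ) ^ (-2 : ℤ) * negPart l f := by
    rw [Finset.sum_range_one, coef_mono_mul]
    norm_num
    ring
  rw [e]
  refine h.congr_fun fun m => ?_
  rw [coef_mono_mul, mul_left_comm, ← zpow_add₀ hl]
  push_cast
  congr 2
  ring_nf

/-- The opposite shift carries index `-1` to `+1`, so one term is lost. It follows from the previous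
shift applied to `mono 2 * f`. -/
theorem negPart_mono_two_mul (l : Circle) (f : LA) :
    negPart l (mono 2 * f) = (l : ℂ) ^ (2 : ℤ) * negPart l f - (l : ℂ) * coef (-1) f := by
  have hl : (l : ℂ) ≠ 0 := Circle.coe_ne_zero l
  have h := negPart_mono_neg_two_mul l (mono 2 * f)
  rw [← mul_assoc, mono_mul, neg_add_cancel, mono_zero, one_mul, coef_mono_mul] at h
  rw [h, mul_add, ← mul_assoc, ← mul_assoc, ← zpow_add₀ hl, ← zpow_add₀ hl]
  norm_num

/-- Checked on monomials: even powers cancel, and each odd power is doubled and belongs to exactly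
one of the two halves. -/
theorem eval_sub_eval_neg (l : Circle) (f : LA) :
    eval l f - eval (-l) f = 2 * (negPart l f + posPart l f) := by
  have : eval l - eval (-l) = (2 : ℂ) • (negPart l + posPart l) := LA.clm_ext fun n => by
    simp only [sub_apply, smul_apply, add_apply, eval_mono, smul_eq_mul]
    change _ - (-(l : ℂ)) ^ n = _
    rcases Int.even_or_odd n with hn | hn
    · rw [hn.neg_zpow, negPart_mono_of_ne l (by intro k; obtain ⟨j, rfl⟩ := hn; omega),
        posPart_mono_of_ne l (by intro k; obtain ⟨j, rfl⟩ := hn; omega)]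
      ring
    · rw [hn.neg_zpow]
      obtain ⟨j, rfl⟩ := hn
      rcases le_or_gt 0 j with hj | hj
      · lift j to ℕ using hj
        rw [negPart_mono_of_ne l (by intro k; omega), posPart_mono_odd]
        ring
      · obtain ⟨k, hk⟩ : ∃ k : ℕ, 2 * j + 1 = -(2 * (k : ℤ) + 1) := ⟨(-j - 1).toNat, by omega⟩
        rw [hk, posPart_mono_of_ne l (by intro k; omega), negPart_mono_odd]
        ring
  exact DFunLike.congr_fun this f

theorem mono_pow (n : ℤ) (k : ℕ) : mono n ^ k = mono (n * k) := by
  induction k with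
  | zero => simp [mono_zero]
  | succ k ih => rw [pow_succ, ih, mono_mul]; congr 1; push_cast; ring

/-- A functional that only sees the leading term of `s⁻¹ exp (c s²)`. -/
theorem apply_mono_neg_one_mul_exp {T : LA →L[ℂ] ℂ} (hT : ∀ k : ℕ, T (mono (2 * (k : ℤ) + 1)) = 0)
    (c : ℂ) : T (mono (-1) * NormedSpace.exp (c • mono 2)) = T (mono (-1)) := by
  have h := (NormedSpace.exp_series_hasSum_exp' (𝕂 := ℂ) (c • mono 2)).mapL
    (T.comp (mulL (mono (-1))))
  refine h.unique ?_
  refine (hasSum_ite_eq 0 (T (mono (-1)))).congr_fun fun k => ?_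
  simp only [ContinuousLinearMap.comp_apply, mulL_apply, smul_pow, mono_pow]
  rcases k with _ | k
  · simp [mono_zero]
  · have : T (mono (-1 + 2 * ((k + 1 : ℕ) : ℤ))) = 0 := by
      rw [← hT k]; congr 2; push_cast; ring
    rw [mul_smul_comm, mul_smul_comm, mono_mul, map_smul, map_smul, this]
    simp

/-- The series `s⁻¹ exp (c s²)` involves only the powers `-1, 1, 3, …`, of which the negative part
keeps the first, independently of `c`. -/
theorem negPart_mono_neg_one_mul_exp (l : Circle) (c : ℂ) :
    negPart l (mono (-1) * NormedSpace.exp (c • mono 2)) = (l : ℂ) ^ (-1 : ℤ) := by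
  rw [apply_mono_neg_one_mul_exp fun k => negPart_mono_of_ne l (by intro j; omega)]
  simpa using negPart_mono_odd l 0

theorem coef_mono_neg_one_mul_exp (c : ℂ) :
    coef (-1) (mono (-1) * NormedSpace.exp (c • mono 2)) = 1 := by
  rw [apply_mono_neg_one_mul_exp fun k => by rw [coef_mono, if_neg (by omega)]]
  simp [coef_mono]

end

end HamStat


namespace HamStat

noncomputable section

open Filter Topology

/-! ### Rotations generated by `L_i` over a commutative Banach algebra -/

theorem Li_mul_Li (R : Type) [CommRing R] : Li R * Li R = -1 := by
  ext i j
  fin_cases i <;> fin_cases j <;> simp [Li, Matrix.mul_apply, Fin.sum_univ_four]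

theorem Lj_mul_Lj (R : Type) [CommRing R] : Lj R * Lj R = -1 := by
  ext i j
  fin_cases i <;> fin_cases j <;> simp [Lj, Matrix.mul_apply, Fin.sum_univ_four]

theorem Lj_mul_Li (R : Type) [CommRing R] : Lj R * Li R = -(Li R * Lj R) := by
  ext i j
  fin_cases i <;> fin_cases j <;> simp [Li, Lj, Matrix.mul_apply, Fin.sum_univ_four]

theorem Li_transpose (R : Type) [CommRing R] : (Li R)ᵀ = -Li R := by
  ext i j
  fin_cases i <;> fin_cases j <;> simp [Li]

theorem Li_mulVec {R : Type} [CommRing R] (x : Vec R) :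
    Li R *ᵥ x = ![-x 1, x 0, -x 3, x 2] := by
  ext i
  fin_cases i <;> simp [Li, Matrix.mulVec, dotProduct, Fin.sum_univ_four]

theorem Lj_mulVec {R : Type} [CommRing R] (x : Vec R) :
    Lj R *ᵥ x = ![-x 2, x 3, x 0, -x 1] := by
  ext i
  fin_cases i <;> simp [Lj, Matrix.mulVec, dotProduct, Fin.sum_univ_four]

theorem Li_mulVec_Li_mulVec {R : Type} [CommRing R] (x : Vec R) :
    Li R *ᵥ (Li R *ᵥ x) = -x := by
  rw [Matrix.mulVec_mulVec, Li_mul_Li, Matrix.neg_mulVec, Matrix.one_mulVec]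

theorem Lj_mulVec_Lj_mulVec {R : Type} [CommRing R] (x : Vec R) :
    Lj R *ᵥ (Lj R *ᵥ x) = -x := by
  rw [Matrix.mulVec_mulVec, Lj_mul_Lj, Matrix.neg_mulVec, Matrix.one_mulVec]

theorem Lj_mulVec_Li_mulVec {R : Type} [CommRing R] (x : Vec R) :
    Lj R *ᵥ (Li R *ᵥ x) = -(Li R *ᵥ (Lj R *ᵥ x)) := by
  rw [Matrix.mulVec_mulVec, Lj_mul_Li, Matrix.neg_mulVec, Matrix.mulVec_mulVec]

/-- The matrix `c + s L_i`. -/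
def rotCS {R : Type} [CommRing R] (c s : R) : Mat R := c • 1 + s • Li R

theorem rotCS_mul {R : Type} [CommRing R] (c s c' s' : R) :
    rotCS c s * rotCS c' s' = rotCS (c * c' - s * s') (c * s' + s * c') := by
  simp only [rotCS, add_mul, mul_add, smul_mul_assoc, mul_smul_comm, Li_mul_Li, one_mul, mul_one]
  module

theorem rotCS_mulVec {R : Type} [CommRing R] (c s : R) (x : Vec R) :
    rotCS c s *ᵥ x = c • x + s • (Li R *ᵥ x) := by
  simp [rotCS, Matrix.add_mulVec, Matrix.smul_mulVec]

section Banach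

set_option linter.unusedSectionVars false

variable {R : Type} [NormedCommRing R] [NormedAlgebra ℂ R] [CompleteSpace R]

/-- The cosine in a commutative Banach algebra. -/
def cosR (x : R) : R :=
  (1 / 2 : ℂ) • (NormedSpace.exp (Complex.I • x) + NormedSpace.exp (-(Complex.I • x)))

/-- The sine in a commutative Banach algebra. -/
def sinR (x : R) : R :=
  (-Complex.I / 2) • (NormedSpace.exp (Complex.I • x) - NormedSpace.exp (-(Complex.I • x)))

/-- `e^{x L_i}` over a commutative Banach algebra. -/
def rotE (x : R) : Mat R := rotCS (cosR x) (sinR x)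

theorem cosR_zero : cosR (0 : R) = 1 := by
  simp only [cosR, smul_zero, neg_zero, NormedSpace.exp_zero]
  module

theorem sinR_zero : sinR (0 : R) = 0 := by simp [sinR]

theorem cosR_neg (x : R) : cosR (-x) = cosR x := by
  simp only [cosR, smul_neg, neg_neg, add_comm]

theorem sinR_neg (x : R) : sinR (-x) = -sinR x := by
  simp only [sinR, smul_neg, neg_neg]
  module

theorem rotE_zero : rotE (0 : R) = 1 := by
  simp [rotE, rotCS, cosR_zero, sinR_zero]

theorem exp_add_comm (x y : R) :
    NormedSpace.exp (x + y) = NormedSpace.exp x * NormedSpace.exp y :=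
  NormedSpace.exp_add_of_mem_ball (𝕂 := ℂ)
    ((NormedSpace.expSeries_radius_eq_top ℂ R).symm ▸ edist_lt_top _ _)
    ((NormedSpace.expSeries_radius_eq_top ℂ R).symm ▸ edist_lt_top _ _)

theorem rotE_add (x y : R) : rotE (x + y) = rotE x * rotE y := by
  -- The scalars `1 / 2` and `-i / 2` enter only through `h2` and `h3`. With these two relations,
  -- the addition formulas become polynomial identities in four independent exponentials.
  have h2 : algebraMap ℂ R (1 / 2) * 2 = 1 := by
    rw [← map_ofNat (algebraMap ℂ R) 2, ← map_mul, ← map_one (algebraMap ℂ R)]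
    norm_num
  have h3 : algebraMap ℂ R (-Complex.I / 2) ^ 2 = -algebraMap ℂ R (1 / 2) ^ 2 := by
    rw [← map_pow, ← map_pow, ← map_neg, div_pow, neg_sq, Complex.I_sq]
    norm_num
  rw [rotE, rotE, rotE, rotCS_mul]
  simp only [cosR, sinR, smul_add, neg_add, exp_add_comm]
  simp only [← smul_add]
  generalize NormedSpace.exp (Complex.I • x) = a
  generalize NormedSpace.exp (-(Complex.I • x)) = a'
  generalize NormedSpace.exp (Complex.I • y) = b
  generalize NormedSpace.exp (-(Complex.I • y)) = b'
  simp only [Algebra.smul_def]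
  generalize algebraMap ℂ R (1 / 2) = h at *
  generalize algebraMap ℂ R (-Complex.I / 2) = s at *
  congr 1
  · linear_combination (a - a') * (b - b') * h3 - h * (a * b + a' * b') * h2
  · linear_combination -s * (a * b - a' * b') * h2

theorem rotE_mul_rotE_neg (x : R) : rotE x * rotE (-x) = 1 := by
  rw [← rotE_add, add_neg_cancel, rotE_zero]

theorem rotE_neg_mul_rotE (x : R) : rotE (-x) * rotE x = 1 := by
  rw [← rotE_add, neg_add_cancel, rotE_zero]

theorem rotE_mulVec (x : R) (y : Vec R) :
    rotE x *ᵥ y = cosR x • y + sinR x • (Li R *ᵥ y) := rotCS_mulVec _ _ _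

theorem rotE_mulVec_Li (x : R) (y : Vec R) :
    rotE x *ᵥ (Li R *ᵥ y) = Li R *ᵥ (rotE x *ᵥ y) := by
  simp only [rotE_mulVec, Matrix.mulVec_add, Matrix.mulVec_smul]

/-- `L_j` anticommutes with `L_i`, so moving it past a rotation inverts the rotation. This matches
the sign change of `β_λ` under `λ ↦ i λ`. -/
theorem Lj_mulVec_rotE (x : R) (y : Vec R) :
    Lj R *ᵥ (rotE x *ᵥ y) = rotE (-x) *ᵥ (Lj R *ᵥ y) := by
  simp only [rotE_mulVec, Matrix.mulVec_add, Matrix.mulVec_smul, cosR_neg, sinR_neg,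
    Lj_mulVec_Li_mulVec, smul_neg, neg_smul]

end Banach

theorem normedExp_eq (z : ℂ) : NormedSpace.exp z = Complex.exp z := by
  rw [Complex.exp_eq_exp_ℂ]

theorem cosR_eq (z : ℂ) : cosR z = Complex.cos z := by
  rw [cosR, normedExp_eq, normedExp_eq, Complex.cos, smul_eq_mul, smul_eq_mul, mul_comm z, neg_mul]
  ring_nf

theorem sinR_eq (z : ℂ) : sinR z = Complex.sin z := by
  rw [sinR, normedExp_eq, normedExp_eq, Complex.sin, smul_eq_mul, smul_eq_mul, mul_comm z, neg_mul]
  ring_nf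

theorem rotE_eq (z : ℂ) : rotE z = rotCS (Complex.cos z) (Complex.sin z) := by
  rw [rotE, cosR_eq, sinR_eq]

/-- The embedding of `ℂ × ℂ` into the matrices given by the spectral decomposition of `L_i`. -/
def spectralHom : ℂ × ℂ →+* Mat ℂ where
  toFun x := rotCS ((x.1 + x.2) / 2) (-Complex.I / 2 * (x.1 - x.2))
  map_one' := by simp [rotCS]
  map_mul' x y := by
    rw [rotCS_mul]
    congr 1
    · simp only [Prod.fst_mul, Prod.snd_mul]
      linear_combination (1 / 4 * (x.1 - x.2) * (y.1 - y.2)) * Complex.I_sq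
    · simp only [Prod.fst_mul, Prod.snd_mul]
      ring
  map_zero' := by simp [rotCS]
  map_add' x y := by
    simp only [rotCS, Prod.fst_add, Prod.snd_add]
    module

theorem continuous_spectralHom : Continuous spectralHom := by
  change Continuous fun x : ℂ × ℂ => rotCS ((x.1 + x.2) / 2) (-Complex.I / 2 * (x.1 - x.2))
  unfold rotCS
  fun_prop

/-- `exp` commutes with continuous ring homomorphisms, and `c L_i` is the image of its eigenvalue
pair `(i c, -i c)` under `spectralHom`; the matrix exponential becomes two scalar ones. -/
theorem expLi_eq_rotE (c : ℂ) : expLi c = rotE c := by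
  have h1 : c • Li ℂ = spectralHom (Complex.I * c, -(Complex.I * c)) := by
    change _ = rotCS _ _
    have h0 : (Complex.I * c + -(Complex.I * c)) / 2 = 0 := by ring
    have h2 : -Complex.I / 2 * (Complex.I * c - -(Complex.I * c)) = c := by
      linear_combination (-c) * Complex.I_sq
    rw [h0, h2, rotCS, zero_smul, zero_add]
  have h3 : NormedSpace.exp (spectralHom (Complex.I * c, -(Complex.I * c))) =
      spectralHom (NormedSpace.exp (Complex.I * c, -(Complex.I * c))) := by
    open scoped Matrix.Norms.Operator in
    exact (NormedSpace.map_exp spectralHom continuous_spectralHom _).symm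
  rw [expLi, h1, h3]
  change rotCS _ _ = _
  rw [Prod.fst_exp, Prod.snd_exp, normedExp_eq, normedExp_eq, rotE]
  simp only [cosR, sinR, normedExp_eq, smul_eq_mul]
  congr 1
  ring_nf

theorem eval_exp (l : Circle) (x : LA) : eval l (NormedSpace.exp x) = Complex.exp (eval l x) := by
  rw [← normedExp_eq]
  let _ : NormedAlgebra ℚ LA := NormedAlgebra.restrictScalars ℚ ℂ LA
  exact NormedSpace.map_exp (evalHom l) (eval l).continuous x

theorem eval_cosR (l : Circle) (x : LA) : eval l (cosR x) = cosR (eval l x) := by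
  simp only [cosR, map_smul, map_add, eval_exp, map_neg, normedExp_eq]

theorem eval_sinR (l : Circle) (x : LA) : eval l (sinR x) = sinR (eval l x) := by
  simp only [sinR, map_smul, map_sub, eval_exp, map_neg, normedExp_eq]

theorem clm_Li_mulVec (T : LA →L[ℂ] ℂ) (y : Vec LA) (i : Fin 4) :
    T ((Li LA *ᵥ y) i) = (Li ℂ *ᵥ fun j => T (y j)) i := by
  rw [Li_mulVec, Li_mulVec]
  fin_cases i <;> simp

theorem clm_Lj_mulVec (T : LA →L[ℂ] ℂ) (y : Vec LA) (i : Fin 4) :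
    T ((Lj LA *ᵥ y) i) = (Lj ℂ *ᵥ fun j => T (y j)) i := by
  rw [Lj_mulVec, Lj_mulVec]
  fin_cases i <;> simp

theorem eval_rotE_mulVec (l : Circle) (x : LA) (y : Vec LA) (i : Fin 4) :
    eval l ((rotE x *ᵥ y) i) = (rotE (eval l x) *ᵥ fun j => eval l (y j)) i := by
  rw [rotE_mulVec, rotE_mulVec]
  simp only [Pi.add_apply, Pi.smul_apply, smul_eq_mul, map_add, eval_mul, eval_cosR, eval_sinR,
    clm_Li_mulVec]

/-! ### Wirtinger derivatives -/

section Wirtinger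

set_option linter.unusedSectionVars false

variable {E : Type*} [NormedAddCommGroup E] [NormedSpace ℂ E]

/-- The real-linear map `e ↦ e p + ē q`. -/
def wirt (p q : E) : ℂ →L[ℝ] E :=
  (ContinuousLinearMap.id ℝ ℂ).smulRight p + (Complex.conjCLE : ℂ →L[ℝ] ℂ).smulRight q

theorem wirt_apply (p q : E) (e : ℂ) : wirt p q e = e • p + (starRingEnd ℂ) e • q := rfl

/-- `df = p dz + q dz̄` at `z`, for a function with values in a complex normed space. -/
def HasWirt (f : ℂ → E) (p q : E) (z : ℂ) : Prop := HasFDerivAt f (wirt p q) z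

theorem hasWirt_iff {f : ℂ → ℂ} {p q z : ℂ} : HasWirt f p q z ↔ HasDzDzbar f p q z := by
  unfold HasWirt HasDzDzbar
  have : wirt p q =
      p • ContinuousLinearMap.id ℝ ℂ + q • (Complex.conjCLE : ℂ →L[ℝ] ℂ) := by
    ext e <;> simp [wirt_apply, mul_comm]
  rw [this]

theorem wirt_inj {p q p' q' : E} (h : wirt p q = wirt p' q') : p = p' ∧ q = q' := by
  have h1 : p + q = p' + q' := by simpa [wirt_apply] using DFunLike.congr_fun h 1
  have h2 : p - q = p' - q' := by
    have h2 := DFunLike.congr_fun h Complex.I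
    rw [wirt_apply, wirt_apply, Complex.conj_I, neg_smul, neg_smul, ← sub_eq_add_neg,
      ← sub_eq_add_neg, ← smul_sub, ← smul_sub] at h2
    exact smul_right_injective _ Complex.I_ne_zero h2
  constructor
  · have := congrArg₂ (fun x y => (1 / 2 : ℂ) • (x + y)) h1 h2
    convert this using 1 <;> module
  · have := congrArg₂ (fun x y => (1 / 2 : ℂ) • (x - y)) h1 h2
    convert this using 1 <;> module

theorem HasWirt.unique {f : ℂ → E} {p q p' q' : E} {z : ℂ} (h : HasWirt f p q z)
    (h' : HasWirt f p' q' z) : p = p' ∧ q = q' :=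
  wirt_inj (HasFDerivAt.unique h h')

theorem hasWirt_of_hasDerivAt {f : ℂ → E} {f' : E} {z : ℂ} (h : HasDerivAt f f' z) :
    HasWirt f f' 0 z := by
  have := h.hasFDerivAt.restrictScalars ℝ
  refine this.congr_fderiv ?_
  ext e <;> simp [wirt_apply]

theorem hasDerivAt_of_hasWirt {f : ℂ → E} {f' : E} {z : ℂ} (h : HasWirt f f' 0 z) :
    HasDerivAt f f' z := by
  rw [hasDerivAt_iff_hasFDerivAt]
  refine hasFDerivAt_of_restrictScalars ℝ h ?_
  ext e <;> simp [wirt_apply]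

theorem HasWirt.add {f g : ℂ → E} {p q p' q' : E} {z : ℂ} (h : HasWirt f p q z)
    (h' : HasWirt g p' q' z) : HasWirt (fun z => f z + g z) (p + p') (q + q') z := by
  refine (HasFDerivAt.add h h').congr_fderiv ?_
  refine ContinuousLinearMap.ext fun e => ?_
  simp only [add_apply, wirt_apply]
  module

theorem HasWirt.clm {G : Type*} [NormedAddCommGroup G] [NormedSpace ℂ G] (T : E →L[ℂ] G)
    {f : ℂ → E} {p q : E} {z : ℂ} (h : HasWirt f p q z) :
    HasWirt (fun z => T (f z)) (T p) (T q) z := by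
  refine ((T.restrictScalars ℝ).hasFDerivAt.comp z h).congr_fderiv ?_
  refine ContinuousLinearMap.ext fun e => ?_
  simp [wirt_apply]

theorem HasWirt.conj {f : ℂ → ℂ} {p q z : ℂ} (h : HasWirt f p q z) :
    HasWirt (fun z => (starRingEnd ℂ) (f z)) ((starRingEnd ℂ) q) ((starRingEnd ℂ) p) z := by
  refine ((Complex.conjCLE : ℂ →L[ℝ] ℂ).hasFDerivAt.comp z h).congr_fderiv ?_
  refine ContinuousLinearMap.ext fun e => ?_
  simp [wirt_apply, add_comm]

theorem HasWirt.smul_const {f : ℂ → ℂ} {p q z : ℂ} (h : HasWirt f p q z) (x : E) :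
    HasWirt (fun z => f z • x) (p • x) (q • x) z :=
  h.clm (ContinuousLinearMap.toSpanSingleton ℂ x)

theorem hasWirt_pi {ι : Type*} [Fintype ι] {f : ℂ → ι → E} {p q : ι → E} {z : ℂ} :
    HasWirt f p q z ↔ ∀ i, HasWirt (fun z => f z i) (p i) (q i) z := by
  unfold HasWirt
  rw [hasFDerivAt_pi']
  rfl

variable {R : Type} [NormedCommRing R] [NormedAlgebra ℂ R] [CompleteSpace R]

theorem HasWirt.mul {f g : ℂ → R} {p q p' q' : R} {z : ℂ} (h : HasWirt f p q z)
    (h' : HasWirt g p' q' z) :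
    HasWirt (fun z => f z * g z) (p * g z + f z * p') (q * g z + f z * q') z := by
  let _ : NormedAlgebra ℝ R := NormedAlgebra.restrictScalars ℝ ℂ R
  refine (HasFDerivAt.mul h h').congr_fderiv ?_
  refine ContinuousLinearMap.ext fun e => ?_
  simp only [add_apply, smul_apply, wirt_apply, smul_eq_mul, mul_add, mul_smul_comm, smul_add]
  rw [mul_comm (g z), mul_comm (g z)]
  abel

theorem HasWirt.exp {f : ℂ → R} {p q : R} {z : ℂ} (h : HasWirt f p q z) :
    HasWirt (fun z => NormedSpace.exp (f z)) (NormedSpace.exp (f z) * p)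
      (NormedSpace.exp (f z) * q) z := by
  have h1 : HasFDerivAt (NormedSpace.exp : R → R) (NormedSpace.exp (f z) • (1 : R →L[ℂ] R)) (f z) :=
    hasFDerivAt_exp
  refine ((h1.restrictScalars ℝ).comp z h).congr_fderiv ?_
  refine ContinuousLinearMap.ext fun e => ?_
  simp [wirt_apply, mul_add]

theorem HasWirt.congr_values {f : ℂ → E} {p q p' q' : E} {z : ℂ} (h : HasWirt f p q z)
    (hp : p = p') (hq : q = q') : HasWirt f p' q' z := hp ▸ hq ▸ h

theorem HasWirt.cosR {f : ℂ → R} {p q : R} {z : ℂ} (h : HasWirt f p q z) :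
    HasWirt (fun z => cosR (f z)) (-(sinR (f z) * p)) (-(sinR (f z) * q)) z := by
  have h1 := (h.clm (Complex.I • ContinuousLinearMap.id ℂ R)).exp
  have h2 := (h.clm (-(Complex.I • ContinuousLinearMap.id ℂ R))).exp
  have h3 := (h1.add h2).clm ((1 / 2 : ℂ) • ContinuousLinearMap.id ℂ R)
  refine HasWirt.congr_values h3 ?_ ?_ <;>
  · simp only [neg_apply, smul_apply, ContinuousLinearMap.id_apply, HamStat.sinR, mul_neg,
      mul_smul_comm, smul_mul_assoc, sub_mul]
    module

theorem HasWirt.sinR {f : ℂ → R} {p q : R} {z : ℂ} (h : HasWirt f p q z) :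
    HasWirt (fun z => sinR (f z)) (HamStat.cosR (f z) * p) (HamStat.cosR (f z) * q) z := by
  have h1 := (h.clm (Complex.I • ContinuousLinearMap.id ℂ R)).exp
  have h2 := ((h.clm (-(Complex.I • ContinuousLinearMap.id ℂ R))).exp).clm
    (-ContinuousLinearMap.id ℂ R)
  have h3 := (h1.add h2).clm ((-Complex.I / 2) • ContinuousLinearMap.id ℂ R)
  have hI : -Complex.I / 2 * Complex.I = 1 / 2 := by linear_combination (-1 / 2) * Complex.I_sq
  have e : (fun z => HamStat.sinR (f z)) = fun z => ((-Complex.I / 2) • ContinuousLinearMap.id ℂ R)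
      (NormedSpace.exp ((Complex.I • ContinuousLinearMap.id ℂ R) (f z)) +
        (-ContinuousLinearMap.id ℂ R)
          (NormedSpace.exp ((-(Complex.I • ContinuousLinearMap.id ℂ R)) (f z)))) := by
    funext z
    simp only [neg_apply, smul_apply, ContinuousLinearMap.id_apply, HamStat.sinR, sub_eq_add_neg]
  rw [e]
  refine HasWirt.congr_values h3 ?_ ?_ <;>
  · simp only [neg_apply, smul_apply, ContinuousLinearMap.id_apply, HamStat.cosR, mul_neg, neg_neg,
      mul_smul_comm, smul_mul_assoc, add_mul, ← smul_add, smul_smul, hI]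

/-- The vector `L_i y` depends continuously and linearly on `y`. -/
def LiL (R : Type) [NormedCommRing R] [NormedAlgebra ℂ R] : Vec R →L[ℂ] Vec R where
  toFun y := Li R *ᵥ y
  map_add' := Matrix.mulVec_add _
  map_smul' c y := Matrix.mulVec_smul _ c y
  cont := by
    change Continuous fun y : Vec R => Li R *ᵥ y
    fun_prop

/-- Product rule with the rotation factored out on the left, so that gauge transformations can be
read off directly. -/
theorem HasWirt.rotE_mulVec {x : ℂ → R} {xp xq : R} {y : ℂ → Vec R} {yp yq : Vec R} {z : ℂ}
    (hx : HasWirt x xp xq z) (hy : HasWirt y yp yq z) :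
    HasWirt (fun z => rotE (x z) *ᵥ y z) (rotE (x z) *ᵥ (xp • (Li R *ᵥ y z) + yp))
      (rotE (x z) *ᵥ (xq • (Li R *ᵥ y z) + yq)) z := by
  have hL : HasWirt (fun z => Li R *ᵥ y z) (Li R *ᵥ yp) (Li R *ᵥ yq) z := hy.clm (LiL R)
  rw [hasWirt_pi] at hy hL ⊢
  intro i
  have h := (hx.cosR.mul (hy i)).add (hx.sinR.mul (hL i))
  simp only [HamStat.rotE_mulVec, Matrix.mulVec_add, Matrix.mulVec_smul, Li_mulVec_Li_mulVec]
  refine HasWirt.congr_values h ?_ ?_ <;>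
  · simp only [Pi.add_apply, Pi.smul_apply, Pi.neg_apply, smul_eq_mul]
    ring

end Wirtinger

end

end HamStat


namespace HamStat

noncomputable section

open Filter Topology

/-! ### The loop `e^{-β_λ L_i / 2} η_λ` in the Laurent algebra and its derivatives -/

/-- The integrand `e^{λ⁻² φ L_i / 4} λ⁻¹ (a ε + b L_i ε̄)` as a vector over the Laurent algebra. -/
def integrandLA (φ a b : ℂ → ℂ) (z : ℂ) : Vec LA :=
  rotE ((φ z / 4) • mono (-2)) *ᵥ fun i => wvec a b z i • mono (-1)

/-- `β_λ / 2` as an element of the Laurent algebra, for `β = Re φ`. -/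
def halfBetaLA (φ : ℂ → ℂ) (z : ℂ) : LA :=
  (φ z / 4) • mono (-2) + (starRingEnd ℂ (φ z) / 4) • mono 2

/-- `e^{-β_λ L_i / 2} η_λ` as a vector over the Laurent algebra. -/
def gaugedLA (φ : ℂ → ℂ) (η : ℂ → Vec LA) (z : ℂ) : Vec LA :=
  rotE (-halfBetaLA φ z) *ᵥ η z

/-- The real projection of a vector over the Laurent algebra. -/
def realProj (l : Circle) (f : Vec LA) : Vec ℂ := fun i =>
  negPart l (f i) + starRingEnd ℂ (negPart l (f i))

/-- The combination of the Laurent coefficients at `±1` that measures the failure of the real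
projection to commute with multiplication by real functions. -/
def residue (f : Vec LA) : Vec ℂ := fun i => coef 1 (f i) - starRingEnd ℂ (coef (-1) (f i))

/-- The coefficient of `λ⁻¹ dz` in `F_λ⁻¹ dX_λ`. -/
def frameVec (φ a b : ℂ → ℂ) (η : ℂ → Vec LA) (z : ℂ) : Vec ℂ :=
  wvec a b z - (deriv φ z / 4) • (Li ℂ *ᵥ residue (gaugedLA φ η z))

/-- The value `β_λ / 2` at `λ = l`. -/
def halfBeta (φ : ℂ → ℂ) (l : ℂ) (z : ℂ) : ℂ :=
  φ z / 4 * l ^ (-2 : ℤ) + starRingEnd ℂ (φ z) / 4 * l ^ (2 : ℤ)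

/-- The translation component `X_λ`. -/
def transPart (φ : ℂ → ℂ) (η : ℂ → Vec LA) (l : Circle) (z : ℂ) : Vec ℂ :=
  rotE (halfBeta φ l z) *ᵥ realProj l (gaugedLA φ η z)

theorem eval_halfBetaLA (φ : ℂ → ℂ) (l : Circle) (z : ℂ) :
    eval l (halfBetaLA φ z) = halfBeta φ l z := by
  simp [halfBetaLA, halfBeta, eval_mono]

theorem conj_Li_mulVec (x : Vec ℂ) (i : Fin 4) :
    starRingEnd ℂ ((Li ℂ *ᵥ x) i) = (Li ℂ *ᵥ fun j => starRingEnd ℂ (x j)) i := by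
  rw [Li_mulVec, Li_mulVec]
  fin_cases i <;> simp

variable {φ a b : ℂ → ℂ} {η : ℂ → Vec LA} {z : ℂ}

theorem hasWirt_halfBetaLA (hφ : DifferentiableAt ℂ φ z) :
    HasWirt (halfBetaLA φ) ((deriv φ z / 4) • mono (-2))
      ((starRingEnd ℂ (deriv φ z) / 4) • mono 2) z := by
  have h := hasWirt_of_hasDerivAt hφ.hasDerivAt
  have h1 := h.smul_const ((1 / 4 : ℂ) • mono (-2))
  have h2 := h.conj.smul_const ((1 / 4 : ℂ) • mono 2)
  have e : halfBetaLA φ = fun z => φ z • (1 / 4 : ℂ) • mono (-2) +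
      starRingEnd ℂ (φ z) • (1 / 4 : ℂ) • mono 2 := by
    funext z
    rw [halfBetaLA]
    module
  rw [e]
  refine HasWirt.congr_values (h1.add h2) ?_ ?_
  · rw [map_zero]; module
  · module

theorem hasWirt_halfBeta (hφ : DifferentiableAt ℂ φ z) (l : Circle) :
    HasWirt (halfBeta φ l) (deriv φ z / 4 * (l : ℂ) ^ (-2 : ℤ))
      (starRingEnd ℂ (deriv φ z) / 4 * (l : ℂ) ^ (2 : ℤ)) z := by
  have h := (hasWirt_halfBetaLA hφ).clm (eval l)
  simp only [eval_halfBetaLA, map_smul, eval_mono, smul_eq_mul] at h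
  exact h

/-- The `λ⁻²` part of `β_λ / 2` is exactly the exponent in the integrand and cancels. What remains
is `λ⁻¹` times a power series in `λ²`, whose only negative power is the first. -/
theorem rotE_neg_halfBetaLA_mulVec_integrandLA :
    rotE (-halfBetaLA φ z) *ᵥ integrandLA φ a b z =
      rotE ((-(starRingEnd ℂ (φ z) / 4)) • mono 2) *ᵥ fun i => wvec a b z i • mono (-1) := by
  rw [integrandLA, Matrix.mulVec_mulVec, ← rotE_add]
  congr 2
  rw [halfBetaLA]
  module

theorem hasWirt_gaugedLA (hφ : DifferentiableAt ℂ φ z)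
    (hη : HasDerivAt η (integrandLA φ a b z) z) :
    HasWirt (gaugedLA φ η)
      (-((deriv φ z / 4) • mono (-2)) • (Li LA *ᵥ gaugedLA φ η z) +
        rotE ((-(starRingEnd ℂ (φ z) / 4)) • mono 2) *ᵥ fun i => wvec a b z i • mono (-1))
      (-((starRingEnd ℂ (deriv φ z) / 4) • mono 2) • (Li LA *ᵥ gaugedLA φ η z)) z := by
  have h1 := (hasWirt_halfBetaLA hφ).clm (-ContinuousLinearMap.id ℂ LA)
  have h2 := h1.rotE_mulVec (hasWirt_of_hasDerivAt hη)
  refine HasWirt.congr_values h2 ?_ ?_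
  · rw [← rotE_neg_halfBetaLA_mulVec_integrandLA, Matrix.mulVec_add, Matrix.mulVec_smul,
      rotE_mulVec_Li]
    rfl
  · rw [add_zero, Matrix.mulVec_smul, rotE_mulVec_Li]
    rfl

/-- `T` gives the same value on `s⁻¹ e^{c s²}` for every `c`. Hence the average defining the cosine
returns `t` and the difference defining the sine returns `0`, so `T` does not see the rotation. -/
theorem apply_rotE_mono_two {T : LA →L[ℂ] ℂ} {t : ℂ}
    (hT : ∀ c : ℂ, T (mono (-1) * NormedSpace.exp (c • mono 2)) = t) (c : ℂ) (w : Vec ℂ)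
    (i : Fin 4) :
    T ((rotE (c • mono 2) *ᵥ fun i => w i • mono (-1)) i) = w i * t := by
  have hcos : T (cosR (c • mono 2) * mono (-1)) = t := by
    rw [mul_comm, cosR, mul_smul_comm, mul_add, map_smul, map_add, smul_smul, ← neg_smul, hT, hT,
      smul_eq_mul]
    ring
  have hsin : T (sinR (c • mono 2) * mono (-1)) = 0 := by
    rw [mul_comm, sinR, mul_smul_comm, mul_sub, map_smul, map_sub, smul_smul, ← neg_smul, hT, hT,
      sub_self, smul_zero]
  have e : (Li LA *ᵥ fun i => w i • mono (-1)) i = ((Li ℂ *ᵥ w) i) • mono (-1) := by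
    rw [Li_mulVec, Li_mulVec]
    fin_cases i <;> simp
  rw [rotE_mulVec, Pi.add_apply, Pi.smul_apply, Pi.smul_apply, e, smul_eq_mul, smul_eq_mul,
    mul_smul_comm, mul_smul_comm, map_add, map_smul, map_smul, hcos, hsin]
  simp

/-- The shift formulas leave the boundary terms `coef 1` in the `dz` part and `coef (-1)` in the
`dz̄` part of the negative projection. Adding the conjugate brings `conj (coef (-1))` into the `dz`
part, where the two combine to `residue`; all of it carries the single power `λ⁻¹`. -/
theorem hasWirt_realProj (l : Circle) (hφ : DifferentiableAt ℂ φ z)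
    (hη : HasDerivAt η (integrandLA φ a b z) z) :
    HasWirt (fun z => realProj l (gaugedLA φ η z))
      (-(deriv φ z / 4 * (l : ℂ) ^ (-2 : ℤ)) • (Li ℂ *ᵥ realProj l (gaugedLA φ η z)) +
        (l : ℂ)⁻¹ • frameVec φ a b η z)
      (-(starRingEnd ℂ (deriv φ z) / 4 * (l : ℂ) ^ (2 : ℤ)) •
          (Li ℂ *ᵥ realProj l (gaugedLA φ η z)) +
        (l : ℂ) • fun i => starRingEnd ℂ (frameVec φ a b η z i)) z := by
  rw [hasWirt_pi]
  intro i
  have h := (hasWirt_pi.1 (hasWirt_gaugedLA hφ hη) i).clm (negPart l)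
  have h2 := h.add h.conj
  have hl : starRingEnd ℂ (l : ℂ) = (l : ℂ)⁻¹ := (Circle.coe_inv_eq_conj l).symm
  have hl0 : (l : ℂ) ≠ 0 := Circle.coe_ne_zero l
  have hp : negPart l ((-((deriv φ z / 4) • mono (-2)) • (Li LA *ᵥ gaugedLA φ η z) +
        rotE ((-(starRingEnd ℂ (φ z) / 4)) • mono 2) *ᵥ fun i => wvec a b z i • mono (-1)) i) =
      -(deriv φ z / 4) * ((l : ℂ) ^ (-2 : ℤ) * (Li ℂ *ᵥ fun j => negPart l (gaugedLA φ η z j)) i +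
        (l : ℂ)⁻¹ * (Li ℂ *ᵥ fun j => coef 1 (gaugedLA φ η z j)) i) + wvec a b z i * (l : ℂ)⁻¹ := by
    rw [Pi.add_apply, map_add, apply_rotE_mono_two (negPart_mono_neg_one_mul_exp l), Pi.smul_apply,
      smul_eq_mul, neg_mul, smul_mul_assoc, map_neg, map_smul, negPart_mono_neg_two_mul,
      clm_Li_mulVec, clm_Li_mulVec, zpow_neg_one, smul_eq_mul]
    ring
  have hq : negPart l ((-((starRingEnd ℂ (deriv φ z) / 4) • mono 2) •
        (Li LA *ᵥ gaugedLA φ η z)) i) =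
      -(starRingEnd ℂ (deriv φ z) / 4) *
        ((l : ℂ) ^ (2 : ℤ) * (Li ℂ *ᵥ fun j => negPart l (gaugedLA φ η z j)) i -
        (l : ℂ) * (Li ℂ *ᵥ fun j => coef (-1) (gaugedLA φ η z j)) i) := by
    rw [Pi.smul_apply, smul_eq_mul, neg_mul, smul_mul_assoc, map_neg, map_smul,
      negPart_mono_two_mul, clm_Li_mulVec, clm_Li_mulVec, smul_eq_mul]
    ring
  rw [hp, hq] at h2
  have hsplit : (Li ℂ *ᵥ realProj l (gaugedLA φ η z)) i =
      (Li ℂ *ᵥ fun j => negPart l (gaugedLA φ η z j)) i +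
        starRingEnd ℂ ((Li ℂ *ᵥ fun j => negPart l (gaugedLA φ η z j)) i) := by
    rw [conj_Li_mulVec, ← Pi.add_apply, ← Matrix.mulVec_add]
    rfl
  have hres : (Li ℂ *ᵥ residue (gaugedLA φ η z)) i =
      (Li ℂ *ᵥ fun j => coef 1 (gaugedLA φ η z j)) i -
        starRingEnd ℂ ((Li ℂ *ᵥ fun j => coef (-1) (gaugedLA φ η z j)) i) := by
    rw [conj_Li_mulVec, ← Pi.sub_apply, ← Matrix.mulVec_sub]
    rfl
  refine HasWirt.congr_values h2 ?_ ?_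
  · simp only [Pi.add_apply, Pi.smul_apply, smul_eq_mul, frameVec, Pi.sub_apply, hsplit, hres,
      map_sub, map_mul, map_neg, map_div₀, map_zpow₀, Complex.conj_conj, hl, map_ofNat,
      zpow_neg, inv_zpow]
    ring
  · simp only [Pi.add_apply, Pi.smul_apply, smul_eq_mul, frameVec, Pi.sub_apply, hsplit, hres,
      map_add, map_sub, map_mul, map_neg, map_div₀, map_zpow₀, Complex.conj_conj, hl, map_ofNat,
      zpow_neg, inv_zpow, inv_inv, map_inv₀]
    ring

/-- Multiplying by `e^{β_λ L_i / 2}` cancels the connection terms in the derivative of the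
projection. So `F_λ⁻¹ dX_λ` depends on `λ` only through `λ⁻¹ dz` and `λ dz̄`, as an extended lift
requires. -/
theorem hasWirt_transPart (l : Circle) (hφ : DifferentiableAt ℂ φ z)
    (hη : HasDerivAt η (integrandLA φ a b z) z) :
    HasWirt (transPart φ η l) (rotE (halfBeta φ l z) *ᵥ ((l : ℂ)⁻¹ • frameVec φ a b η z))
      (rotE (halfBeta φ l z) *ᵥ ((l : ℂ) • fun i => starRingEnd ℂ (frameVec φ a b η z i))) z := by
  refine HasWirt.congr_values ((hasWirt_halfBeta hφ l).rotE_mulVec (hasWirt_realProj l hφ hη)) ?_ ?_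
  · congr 1; module
  · congr 1; module

/-- The `∂/∂z̄` derivative of the frame vector. -/
theorem hasWirt_frameVec (hφ : DifferentiableAt ℂ φ z) (hφ' : DifferentiableAt ℂ (deriv φ) z)
    (ha : DifferentiableAt ℂ a z) (hb : DifferentiableAt ℂ b z)
    (hη : HasDerivAt η (integrandLA φ a b z) z) :
    ∃ p, HasWirt (frameVec φ a b η) p
      ((deriv φ z / 4) • (Li ℂ *ᵥ fun i => starRingEnd ℂ (frameVec φ a b η z i))) z := by
  have hv := hasWirt_pi.1 (hasWirt_gaugedLA hφ hη)
  -- The shifts by `±2` exchange the coefficients of index `1` and `-1`, so the `dz̄` derivative of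
  -- `residue` involves no further coefficient and closes up to `-conj frameVec`. The `dz`
  -- derivative brings in other coefficients and is left unspecified.
  have hres : HasWirt (fun z => residue (gaugedLA φ η z))
      (fun i => coef 1 ((-((deriv φ z / 4) • mono (-2)) • (Li LA *ᵥ gaugedLA φ η z) +
        rotE ((-(starRingEnd ℂ (φ z) / 4)) • mono 2) *ᵥ fun i => wvec a b z i • mono (-1)) i) +
          -starRingEnd ℂ (coef (-1) ((-((starRingEnd ℂ (deriv φ z) / 4) • mono 2) •
            (Li LA *ᵥ gaugedLA φ η z)) i)))
      (fun i => -starRingEnd ℂ (frameVec φ a b η z i)) z := by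
    rw [hasWirt_pi]
    intro i
    have h := ((hv i).clm (coef 1)).add (((hv i).clm (coef (-1))).conj.clm
      (-ContinuousLinearMap.id ℂ ℂ))
    have e : (fun z => residue (gaugedLA φ η z) i) = fun z => coef 1 (gaugedLA φ η z i) +
        (-ContinuousLinearMap.id ℂ ℂ) (starRingEnd ℂ (coef (-1) (gaugedLA φ η z i))) := by
      funext z
      simp [residue, sub_eq_add_neg]
    rw [e]
    refine HasWirt.congr_values h rfl ?_
    have hres : (Li ℂ *ᵥ residue (gaugedLA φ η z)) i =
        (Li ℂ *ᵥ fun j => coef 1 (gaugedLA φ η z j)) i -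
          starRingEnd ℂ ((Li ℂ *ᵥ fun j => coef (-1) (gaugedLA φ η z j)) i) := by
      rw [conj_Li_mulVec, ← Pi.sub_apply, ← Matrix.mulVec_sub]
      rfl
    rw [Pi.add_apply, map_add, apply_rotE_mono_two coef_mono_neg_one_mul_exp, Pi.smul_apply,
      Pi.smul_apply, smul_eq_mul, smul_eq_mul, neg_mul, neg_mul, smul_mul_assoc, smul_mul_assoc,
      map_neg, map_neg, map_smul, map_smul, coef_mono_mul, coef_mono_mul, clm_Li_mulVec,
      clm_Li_mulVec]
    norm_num [frameVec, hres, map_ofNat]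
    ring
  have hw : HasDerivAt (wvec a b) (deriv a z • eps + deriv b z • (Li ℂ *ᵥ epsBar)) z :=
    (ha.hasDerivAt.smul_const eps).add (hb.hasDerivAt.smul_const _)
  have hc : HasWirt (fun z => -(deriv φ z / 4)) (-(deriv (deriv φ) z / 4)) 0 z :=
    hasWirt_of_hasDerivAt ((hφ'.hasDerivAt.div_const 4).neg)
  have hL := hasWirt_pi.1 (hres.clm (LiL ℂ))
  have hw' := hasWirt_pi.1 (hasWirt_of_hasDerivAt hw)
  have key := hasWirt_pi.2 fun i => (hw' i).add (hc.mul (hL i))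
  have e : frameVec φ a b η = fun z i => wvec a b z i +
      -(deriv φ z / 4) * LiL ℂ (residue (gaugedLA φ η z)) i := by
    funext z i
    simp only [frameVec, Pi.sub_apply, Pi.smul_apply, smul_eq_mul, neg_mul, ← sub_eq_add_neg]
    rfl
  rw [e]
  refine ⟨_, HasWirt.congr_values key rfl ?_⟩
  funext i
  have hneg : LiL ℂ (fun i => -starRingEnd ℂ (frameVec φ a b η z i)) i =
      -(Li ℂ *ᵥ fun i => starRingEnd ℂ (frameVec φ a b η z i)) i :=
    congrFun (map_neg (LiL ℂ) fun i => starRingEnd ℂ (frameVec φ a b η z i)) i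
  rw [hneg, ← e]
  simp only [Pi.zero_apply, Pi.smul_apply, smul_eq_mul]
  ring

end

end HamStat


namespace HamStat

noncomputable section

open Filter Topology

/-! ### First variation of the area -/

open MeasureTheory in
/-- Differentiation of `∫ √Q` over a compact set, for a continuously varying positive `Q`. -/
theorem hasDerivAt_setIntegral_sqrt {K Ω : Set ℂ} (hK : IsCompact K) (hΩ : IsOpen Ω) (hKΩ : K ⊆ Ω)
    {Q Q' : ℝ → ℂ → ℝ} (hQ : ContinuousOn (Function.uncurry Q) (Set.univ ×ˢ Ω))
    (hQ' : ContinuousOn (Function.uncurry Q') (Set.univ ×ˢ Ω))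
    (hd : ∀ t, ∀ z ∈ K, HasDerivAt (fun t => Q t z) (Q' t z) t) (hpos : ∀ z ∈ K, 0 < Q 0 z) :
    HasDerivAt (fun t => ∫ z in K, Real.sqrt (Q t z))
      (∫ z in K, Q' 0 z / (2 * Real.sqrt (Q 0 z))) 0 := by
  have hslice : ∀ {f : ℝ → ℂ → ℝ}, ContinuousOn (Function.uncurry f) (Set.univ ×ˢ Ω) →
      ∀ t, ContinuousOn (f t) K := fun hf t =>
    hf.comp (f := fun z => (t, z)) (by fun_prop) fun z hz => ⟨trivial, hKΩ hz⟩
  -- Compactness of `K` makes positivity uniform for small `t`, which keeps the square root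
  -- differentiable and bounds its derivative.
  have hev : ∀ᶠ t in 𝓝 (0 : ℝ), ∀ z ∈ K, 0 < Q t z := by
    refine hK.eventually_forall_of_forall_eventually fun z hz => ?_
    have hc : ContinuousAt (Function.uncurry Q) (0, z) :=
      hQ.continuousAt ((isOpen_univ.prod hΩ).mem_nhds ⟨trivial, hKΩ hz⟩)
    exact hc.eventually (lt_mem_nhds (hpos z hz))
  obtain ⟨ε, hε, hball⟩ := Metric.nhds_basis_closedBall.mem_iff.1 hev
  have hcont : ContinuousOn (fun x : ℝ × ℂ => Q' x.1 x.2 / (2 * Real.sqrt (Q x.1 x.2)))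
      (Metric.closedBall 0 ε ×ˢ K) := by
    have hsub : Metric.closedBall (0 : ℝ) ε ×ˢ K ⊆ Set.univ ×ˢ Ω :=
      Set.prod_mono (Set.subset_univ _) hKΩ
    refine (hQ'.mono hsub).div (continuousOn_const.mul (hQ.mono hsub).sqrt) ?_
    rintro ⟨t, z⟩ ⟨ht, hz⟩
    have := Real.sqrt_pos.2 (hball ht z hz)
    exact (mul_pos two_pos this).ne'
  obtain ⟨C, hC⟩ := ((isCompact_closedBall (0 : ℝ) ε).prod hK).exists_bound_of_continuousOn hcont
  have hKm := hK.measurableSet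
  have : IsFiniteMeasure (volume.restrict K) := ⟨by
    rw [Measure.restrict_apply_univ]; exact hK.measure_lt_top⟩
  refine (hasDerivAt_integral_of_dominated_loc_of_deriv_le (μ := volume.restrict K)
    (F := fun t z => Real.sqrt (Q t z)) (F' := fun t z => Q' t z / (2 * Real.sqrt (Q t z)))
    (s := Metric.closedBall 0 ε) (bound := fun _ => C) (Metric.closedBall_mem_nhds _ hε)
    ?_ ?_ ?_ ?_ (integrable_const _) ?_).2
  · exact Eventually.of_forall fun t => ((hslice hQ t).sqrt).aestronglyMeasurable hKm
  · exact ((hslice hQ 0).sqrt).integrableOn_compact hK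
  · refine ContinuousOn.aestronglyMeasurable ?_ hKm
    exact hcont.comp (f := fun z => ((0 : ℝ), z)) (by fun_prop)
      fun z hz => ⟨Metric.mem_closedBall_self hε.le, hz⟩
  · exact (ae_restrict_iff' hKm).2 (Eventually.of_forall fun z hz t ht => hC (t, z) ⟨ht, hz⟩)
  · exact (ae_restrict_iff' hKm).2 (Eventually.of_forall fun z hz t ht =>
      (hd t z hz).sqrt (hball ht z hz).ne')

theorem continuous_mul_of_tsupport_subset {f g : ℂ → ℝ} {Ω : Set ℂ} (hΩ : IsOpen Ω)
    (hf : ContinuousOn f Ω) (hg : Continuous g) (hgΩ : tsupport g ⊆ Ω) :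
    Continuous fun z => f z * g z := by
  refine continuous_of_tsupport fun x hx => ?_
  have hxΩ : x ∈ Ω := hgΩ (tsupport_mul_subset_right hx)
  exact (hf.continuousAt (hΩ.mem_nhds hxΩ)).mul hg.continuousAt

open MeasureTheory in
theorem integrable_mul_of_tsupport_subset {f g : ℂ → ℝ} {Ω : Set ℂ} (hΩ : IsOpen Ω)
    (hf : ContinuousOn f Ω) (hg : Continuous g) (hgc : HasCompactSupport g)
    (hgΩ : tsupport g ⊆ Ω) : Integrable fun z => f z * g z :=
  (continuous_mul_of_tsupport_subset hΩ hf hg hgΩ).integrable_of_hasCompactSupport hgc.mul_left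

open MeasureTheory in
/-- Integration by parts against a compactly supported function. -/
theorem integral_mul_fderiv_of_tsupport_subset {f g : ℂ → ℝ} {Ω : Set ℂ} (hΩ : IsOpen Ω)
    (hf : ContDiffOn ℝ 1 f Ω) (hg : ContDiff ℝ 1 g) (hgc : HasCompactSupport g)
    (hgΩ : tsupport g ⊆ Ω) (v : ℂ) :
    Integrable (fun z => f z * fderiv ℝ g z v) ∧ Integrable (fun z => fderiv ℝ f z v * g z) ∧
    ∫ z, f z * fderiv ℝ g z v = -∫ z, fderiv ℝ f z v * g z := by
  have h1 : Integrable (fun z => f z * fderiv ℝ g z v) :=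
    integrable_mul_of_tsupport_subset hΩ hf.continuousOn
      ((hg.continuous_fderiv one_ne_zero).clm_apply continuous_const) (hgc.fderiv_apply ℝ v)
      ((tsupport_fderiv_apply_subset ℝ v).trans hgΩ)
  have h2 : Integrable (fun z => fderiv ℝ f z v * g z) :=
    integrable_mul_of_tsupport_subset hΩ
      ((hf.continuousOn_fderiv_of_isOpen hΩ le_rfl).clm_apply continuousOn_const)
      hg.continuous hgc hgΩ
  have h3 : Integrable (fun z => f z * g z) :=
    integrable_mul_of_tsupport_subset hΩ hf.continuousOn hg.continuous hgc hgΩ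
  refine ⟨h1, h2, integral_mul_fderiv_eq_neg_fderiv_mul_of_integrable h2 h1 h3 ?_ ?_⟩
  · intro x hx
    exact (hf.differentiableOn one_ne_zero).differentiableAt (hΩ.mem_nhds (hgΩ hx))
  · intro x _
    exact hg.differentiable one_ne_zero x

theorem omega_neg_swap (x y : Vec ℝ) : omega x y = -((Li ℝ *ᵥ y) ⬝ᵥ x) := by
  simp only [omega, Li_mulVec, dotProduct, Fin.sum_univ_four]
  simp
  ring

theorem contDiffOn_fderiv_apply {E : Type*} [NormedAddCommGroup E] [NormedSpace ℝ E] {f : ℂ → E}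
    {Ω : Set ℂ} (hΩ : IsOpen Ω) (hf : ContDiffOn ℝ ∞ f Ω) (v : ℂ) :
    ContDiffOn ℝ ∞ (fun z => fderiv ℝ f z v) Ω :=
  (hf.fderiv_of_isOpen hΩ (m := ∞) (by simp)).clm_apply contDiffOn_const

open MeasureTheory in
/-- A conformal immersion whose Laplacian is `L_i (β_x X_x + β_y X_y)` with `β` harmonic is
Hamiltonian stationary. -/
theorem isHamiltonianStationary_of_laplacian {Ω : Set ℂ} (hΩ : IsOpen Ω) {X : ℂ → Vec ℝ}
    (hX : IsConformalLagrangianImmersion Ω X) {β : ℂ → ℝ} (hβ : ContDiffOn ℝ ∞ β Ω)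
    (hharm : ∀ z ∈ Ω, fderiv ℝ (fun w => fderiv ℝ β w 1) z 1 +
      fderiv ℝ (fun w => fderiv ℝ β w Complex.I) z Complex.I = 0)
    (hlap : ∀ z ∈ Ω, fderiv ℝ (dx X) z 1 + fderiv ℝ (dy X) z Complex.I =
      Li ℝ *ᵥ (fderiv ℝ β z 1 • dx X z + fderiv ℝ β z Complex.I • dy X z)) :
    IsHamiltonianStationary Ω X := by
  intro V h hV hVc hVΩ hh hhc hhΩ hVh
  have hXs := hX.immersion.1
  have hdxX : ContDiffOn ℝ ∞ (dx X) Ω := contDiffOn_fderiv_apply hΩ hXs 1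
  have hdyX : ContDiffOn ℝ ∞ (dy X) Ω := contDiffOn_fderiv_apply hΩ hXs Complex.I
  have hdxV : ContDiffOn ℝ ∞ (dx V) Ω := contDiffOn_fderiv_apply hΩ hV.contDiffOn 1
  have hdyV : ContDiffOn ℝ ∞ (dy V) Ω := contDiffOn_fderiv_apply hΩ hV.contDiffOn Complex.I
  have hVi : ∀ i, ContDiff ℝ ∞ fun z => V z i := fun i => contDiff_pi.1 hV i
  have hdot : ∀ {f g : ℂ → Vec ℝ}, ContDiffOn ℝ ∞ f Ω → ContDiffOn ℝ ∞ g Ω →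
      ContinuousOn (fun x : ℝ × ℂ => f x.2 ⬝ᵥ g x.2) (Set.univ ×ˢ Ω) := by
    intro f g hf hg
    have hc : ContinuousOn (fun z => f z ⬝ᵥ g z) Ω := by
      simp only [dotProduct]
      exact continuousOn_finsetSum _ fun i _ => (continuousOn_pi.1 hf.continuousOn i).mul
        (continuousOn_pi.1 hg.continuousOn i)
    exact hc.comp continuousOn_snd fun x hx => hx.2
  -- The Gram determinant of the differential of `X + t V`, expanded in `t`; `Q'` is its derivative
  -- in `t`.
  let Q : ℝ → ℂ → ℝ := fun t z =>
    (dx X z ⬝ᵥ dx X z + 2 * t * (dx X z ⬝ᵥ dx V z) + t ^ 2 * (dx V z ⬝ᵥ dx V z)) *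
      (dy X z ⬝ᵥ dy X z + 2 * t * (dy X z ⬝ᵥ dy V z) + t ^ 2 * (dy V z ⬝ᵥ dy V z)) -
    (dx X z ⬝ᵥ dy X z + t * (dx X z ⬝ᵥ dy V z + dx V z ⬝ᵥ dy X z) +
      t ^ 2 * (dx V z ⬝ᵥ dy V z)) ^ 2
  let Q' : ℝ → ℂ → ℝ := fun t z =>
    (2 * (dx X z ⬝ᵥ dx V z) + 2 * t * (dx V z ⬝ᵥ dx V z)) *
      (dy X z ⬝ᵥ dy X z + 2 * t * (dy X z ⬝ᵥ dy V z) + t ^ 2 * (dy V z ⬝ᵥ dy V z)) +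
    (dx X z ⬝ᵥ dx X z + 2 * t * (dx X z ⬝ᵥ dx V z) + t ^ 2 * (dx V z ⬝ᵥ dx V z)) *
      (2 * (dy X z ⬝ᵥ dy V z) + 2 * t * (dy V z ⬝ᵥ dy V z)) -
    2 * (dx X z ⬝ᵥ dy X z + t * (dx X z ⬝ᵥ dy V z + dx V z ⬝ᵥ dy X z) +
      t ^ 2 * (dx V z ⬝ᵥ dy V z)) *
      ((dx X z ⬝ᵥ dy V z + dx V z ⬝ᵥ dy X z) + 2 * t * (dx V z ⬝ᵥ dy V z))
  have hfst : ContinuousOn (fun x : ℝ × ℂ => x.1) (Set.univ ×ˢ Ω) := continuousOn_fst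
  have c1 := hdot hdxX hdxX
  have c2 := hdot hdxX hdxV
  have c3 := hdot hdxV hdxV
  have c4 := hdot hdyX hdyX
  have c5 := hdot hdyX hdyV
  have c6 := hdot hdyV hdyV
  have c7 := hdot hdxX hdyX
  have c8 := hdot hdxX hdyV
  have c9 := hdot hdxV hdyX
  have c10 := hdot hdxV hdyV
  have hQc : ContinuousOn (Function.uncurry Q) (Set.univ ×ˢ Ω) := by
    simp only [Function.uncurry_def, Q]
    fun_prop
  have hQ'c : ContinuousOn (Function.uncurry Q') (Set.univ ×ˢ Ω) := by
    simp only [Function.uncurry_def, Q']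
    fun_prop
  have hQd : ∀ t, ∀ z ∈ tsupport V, HasDerivAt (fun t => Q t z) (Q' t z) t := by
    intro t z _
    have hlin : ∀ x y w : ℝ, HasDerivAt (fun t : ℝ => x + 2 * t * y + t ^ 2 * w)
        (2 * y + 2 * t * w) t := by
      intro x y w
      have h1 := (((hasDerivAt_id t).const_mul 2).mul_const y).const_add x
      have h2 := h1.add (((hasDerivAt_id t).pow 2).mul_const w)
      refine h2.congr_deriv ?_
      simp
    have hlin' : ∀ x y w : ℝ, HasDerivAt (fun t : ℝ => x + t * y + t ^ 2 * w)
        (y + 2 * t * w) t := by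
      intro x y w
      have h1 := ((hasDerivAt_id t).mul_const y).const_add x
      have h2 := h1.add (((hasDerivAt_id t).pow 2).mul_const w)
      refine h2.congr_deriv ?_
      simp
    refine (((hlin _ _ _).mul (hlin _ _ _)).sub ((hlin' _ _ _).pow 2)).congr_deriv ?_
    simp only [Q', Nat.cast_ofNat, Nat.add_one_sub_one, pow_one]
  have hρ : ∀ z ∈ Ω, 0 < dx X z ⬝ᵥ dx X z := by
    intro z hz
    have hne : dx X z ≠ 0 := by
      intro h0
      have := hX.immersion.2 z hz (h0.trans (map_zero (fderiv ℝ X z)).symm)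
      exact one_ne_zero this
    exact lt_of_le_of_ne (Finset.sum_nonneg fun i _ => mul_self_nonneg _)
      (fun h0 => hne (dotProduct_self_eq_zero.1 h0.symm))
  -- By conformality the square root at `t = 0` is the conformal factor, which cancels in the first
  -- variation and leaves the Dirichlet integrand `⟨X_x, V_x⟩ + ⟨X_y, V_y⟩`.
  have hQ0 : ∀ z ∈ Ω, Q 0 z = (dx X z ⬝ᵥ dx X z) ^ 2 := by
    intro z hz
    obtain ⟨h1, h2⟩ := hX.conformal z hz
    simp only [Q, ← h1, h2]
    ring
  have hmain := hasDerivAt_setIntegral_sqrt (hVc : IsCompact (tsupport V)) hΩ hVΩ hQc hQ'c hQd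
    fun z hz => by rw [hQ0 z (hVΩ hz)]; exact pow_pos (hρ z (hVΩ hz)) 2
  have hm : MeasurableSet (tsupport V) := (isClosed_tsupport V).measurableSet
  have hfun : (fun t : ℝ => ∫ z in tsupport V, areaDensity (fun w => X w + t • V w) z) =
      fun t => ∫ z in tsupport V, Real.sqrt (Q t z) := by
    funext t
    refine setIntegral_congr_fun hm fun z hz => ?_
    have hXd : DifferentiableAt ℝ X z :=
      (hXs.differentiableOn (by simp)).differentiableAt (hΩ.mem_nhds (hVΩ hz))
    have hVd : DifferentiableAt ℝ V z := hV.differentiable (by simp) z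
    have hfd : fderiv ℝ (fun w => X w + t • V w) z = fderiv ℝ X z + t • fderiv ℝ V z :=
      (hXd.hasFDerivAt.add (hVd.hasFDerivAt.const_smul t)).fderiv
    have e1 : dx (fun w => X w + t • V w) z = dx X z + t • dx V z := by
      simp only [dx, hfd]; rfl
    have e2 : dy (fun w => X w + t • V w) z = dy X z + t • dy V z := by
      simp only [dy, hfd]; rfl
    simp only [areaDensity, e1, e2, Q, dotProduct_add, add_dotProduct, smul_dotProduct,
      dotProduct_smul, smul_eq_mul]
    rw [dotProduct_comm (dx V z) (dx X z), dotProduct_comm (dy V z) (dy X z)]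
    congr 1
    ring
  rw [hfun]
  refine hmain.congr_deriv ?_
  have hval : ∫ z in tsupport V, Q' 0 z / (2 * Real.sqrt (Q 0 z)) =
      ∫ z in tsupport V, ∑ i, (dx X z i * fderiv ℝ (fun w => V w i) z 1 +
        dy X z i * fderiv ℝ (fun w => V w i) z Complex.I) := by
    refine setIntegral_congr_fun hm fun z hz => ?_
    have hzΩ := hVΩ hz
    obtain ⟨h1, h2⟩ := hX.conformal z hzΩ
    have hp := hρ z hzΩ
    have hVd : DifferentiableAt ℝ V z := hV.differentiable (by simp) z
    have e : ∀ v i, fderiv ℝ (fun w => V w i) z v = fderiv ℝ V z v i := by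
      intro v i
      rw [fderiv_apply hVd]
      rfl
    have hQ'0 : Q' 0 z = 2 * (dx X z ⬝ᵥ dx X z) * (dx X z ⬝ᵥ dx V z + dy X z ⬝ᵥ dy V z) := by
      simp only [Q', ← h1, h2]
      ring
    simp only [hQ0 z hzΩ, Real.sqrt_sq hp.le, hQ'0, e, Finset.sum_add_distrib]
    rw [mul_div_cancel_left₀ _ (by positivity)]
    rfl
  rw [hval]
  have hVi_t : ∀ i, tsupport (fun z => V z i) ⊆ tsupport V := fun i =>
    closure_mono fun z hz hz0 => hz (congrFun hz0 i)
  have hVi_c : ∀ i, HasCompactSupport fun z => V z i := fun i =>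
    hVc.of_isClosed_subset (isClosed_tsupport _) (hVi_t i)
  -- The derivatives of `V` vanish off `tsupport V`, so the integral extends to the whole plane,
  -- where integration by parts has no boundary term.
  rw [setIntegral_eq_integral_of_forall_compl_eq_zero (fun z hz => by
    refine Finset.sum_eq_zero fun i _ => ?_
    have h0 : fderiv ℝ (fun w => V w i) z = 0 := by
      by_contra hne
      exact hz (hVi_t i (support_fderiv_subset ℝ hne))
    simp [h0])]
  have hdxXi : ∀ i, ContDiffOn ℝ 1 (fun z => dx X z i) Ω := fun i =>
    (contDiffOn_pi.1 hdxX i).of_le (by simp)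
  have hdyXi : ∀ i, ContDiffOn ℝ 1 (fun z => dy X z i) Ω := fun i =>
    (contDiffOn_pi.1 hdyX i).of_le (by simp)
  have ibx := fun i => integral_mul_fderiv_of_tsupport_subset hΩ (hdxXi i) ((hVi i).of_le (by simp))
    (hVi_c i) ((hVi_t i).trans hVΩ) 1
  have iby := fun i => integral_mul_fderiv_of_tsupport_subset hΩ (hdyXi i) ((hVi i).of_le (by simp))
    (hVi_c i) ((hVi_t i).trans hVΩ) Complex.I
  have hβx : ContDiffOn ℝ 1 (fun z => fderiv ℝ β z 1) Ω :=
    (contDiffOn_fderiv_apply hΩ hβ 1).of_le (by simp)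
  have hβy : ContDiffOn ℝ 1 (fun z => fderiv ℝ β z Complex.I) Ω :=
    (contDiffOn_fderiv_apply hΩ hβ Complex.I).of_le (by simp)
  have ibhx := integral_mul_fderiv_of_tsupport_subset hΩ hβx (hh.of_le (by simp)) hhc hhΩ 1
  have ibhy := integral_mul_fderiv_of_tsupport_subset hΩ hβy (hh.of_le (by simp)) hhc hhΩ Complex.I
  calc ∫ z, ∑ i, (dx X z i * fderiv ℝ (fun w => V w i) z 1 +
        dy X z i * fderiv ℝ (fun w => V w i) z Complex.I)
      = ∑ i, (-∫ z, fderiv ℝ (fun w => dx X w i) z 1 * V z i) +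
          ∑ i, (-∫ z, fderiv ℝ (fun w => dy X w i) z Complex.I * V z i) := by
        have hi : ∀ i, Integrable fun z => dx X z i * fderiv ℝ (fun w => V w i) z 1 +
            dy X z i * fderiv ℝ (fun w => V w i) z Complex.I := fun i => (ibx i).1.add (iby i).1
        rw [integral_finsetSum _ fun i _ => hi i, ← Finset.sum_add_distrib]
        refine Finset.sum_congr rfl fun i _ => ?_
        rw [integral_add (ibx i).1 (iby i).1, (ibx i).2.2, (iby i).2.2]
    _ = -∫ z, ∑ i, (fderiv ℝ (fun w => dx X w i) z 1 * V z i +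
          fderiv ℝ (fun w => dy X w i) z Complex.I * V z i) := by
        have hi : ∀ i, Integrable fun z => fderiv ℝ (fun w => dx X w i) z 1 * V z i +
            fderiv ℝ (fun w => dy X w i) z Complex.I * V z i := fun i =>
          (ibx i).2.1.add (iby i).2.1
        rw [integral_finsetSum _ fun i _ => hi i, ← Finset.sum_add_distrib,
          ← Finset.sum_neg_distrib]
        refine Finset.sum_congr rfl fun i _ => ?_
        rw [integral_add (ibx i).2.1 (iby i).2.1, neg_add]
    -- Insert the Laplacian. Since `L_i` is skew, pairing `L_i X_x` and `L_i X_y` with `V` gives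
    -- `-h_x` and `-h_y`; outside `Ω` both sides vanish.
    _ = -∫ z, -(fderiv ℝ β z 1 * fderiv ℝ h z 1 +
          fderiv ℝ β z Complex.I * fderiv ℝ h z Complex.I) := by
        congr 2
        funext z
        by_cases hz : z ∈ Ω
        · have e : ∀ {f : ℂ → Vec ℝ}, ContDiffOn ℝ ∞ f Ω → ∀ v i,
              fderiv ℝ (fun w => f w i) z v = fderiv ℝ f z v i := by
            intro f hf v i
            rw [fderiv_apply ((hf.differentiableOn (by simp)).differentiableAt (hΩ.mem_nhds hz))]
            rfl
          obtain ⟨h1, h2⟩ := hVh z hz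
          rw [omega_neg_swap] at h1 h2
          simp only [e hdxX, e hdyX, ← add_mul]
          have h3 := congrArg (· ⬝ᵥ V z) (hlap z hz)
          simp only [Matrix.mulVec_add, Matrix.mulVec_smul, add_dotProduct, smul_dotProduct,
            smul_eq_mul] at h3
          rw [← h1, ← h2]
          calc _ = fderiv ℝ (dx X) z 1 ⬝ᵥ V z + fderiv ℝ (dy X) z Complex.I ⬝ᵥ V z := by
                simp only [dotProduct, ← Finset.sum_add_distrib, ← add_mul]
            _ = _ := by rw [h3]; ring
        · have hV0 : V z = 0 := image_eq_zero_of_notMem_tsupport fun hz' => hz (hVΩ hz')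
          have hh0 : fderiv ℝ h z = 0 := by
            by_contra hne
            exact hz (hhΩ (support_fderiv_subset ℝ hne))
          simp [hV0, hh0]
    -- A second integration by parts moves the derivatives from `h` to `β`, and harmonicity
    -- finishes.
    _ = 0 := by
        rw [integral_neg, neg_neg, integral_add ibhx.1 ibhy.1, ibhx.2.2, ibhy.2.2, ← neg_add,
          ← integral_add ibhx.2.1 ibhy.2.1, neg_eq_zero]
        refine integral_eq_zero_of_ae (Eventually.of_forall fun z => ?_)
        by_cases hz : z ∈ Ω
        · simp only [← add_mul, hharm z hz, zero_mul, Pi.zero_apply]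
        · have hh0 : h z = 0 := image_eq_zero_of_notMem_tsupport fun hz' => hz (hhΩ hz')
          simp [hh0]

end

end HamStat


namespace HamStat

noncomputable section

open Filter Topology

/-! ### Smoothness in the loop parameter -/

/-- Coefficients of order `(1 / 2)^n` against `|w| < 3 / 2` leave the ratio `3 / 4`. The domain
contains the closed unit disk, so the lemma serves both smoothness on the circle and extension to
the disk. -/
theorem differentiableOn_odd_series {c : ℕ → ℂ} {C : ℝ}
    (hc : ∀ m, ‖c m‖ ≤ (1 / 2) ^ (2 * m + 1) * C) :
    DifferentiableOn ℂ (fun w => ∑' m : ℕ, c m * w ^ (2 * m + 1)) (Metric.ball 0 (3 / 2)) := by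
  have hs : Summable fun m : ℕ => (3 / 4 : ℝ) ^ (2 * m + 1) * C := by
    have h : Summable fun m : ℕ => ((3 / 4 : ℝ) ^ 2) ^ m * (3 / 4 * C) :=
      (summable_geometric_of_lt_one (by norm_num) (by norm_num)).mul_right _
    refine h.congr fun m => ?_
    rw [pow_succ (3 / 4 : ℝ) (2 * m), pow_mul]
    ring
  refine Complex.differentiableOn_tsum_of_summable_norm hs (fun m => by fun_prop) Metric.isOpen_ball ?_
  intro m w hw
  have hw' : ‖w‖ ≤ 3 / 2 := (mem_ball_zero_iff.1 hw).le
  have hC : 0 ≤ C := by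
    have := (norm_nonneg _).trans (hc 0)
    nlinarith
  calc ‖c m * w ^ (2 * m + 1)‖ = ‖c m‖ * ‖w‖ ^ (2 * m + 1) := by rw [norm_mul, norm_pow]
    _ ≤ ((1 / 2) ^ (2 * m + 1) * C) * (3 / 2) ^ (2 * m + 1) := by
        gcongr
        exact hc m
    _ = (3 / 4) ^ (2 * m + 1) * C := by
        rw [mul_right_comm, ← mul_pow]
        norm_num

theorem contDiff_circleExp_zpow (n : ℤ) :
    ContDiff ℝ ∞ fun θ : ℝ => ((Circle.exp θ : Circle) : ℂ) ^ n := by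
  have e : (fun θ : ℝ => ((Circle.exp θ : Circle) : ℂ) ^ n) =
      fun θ : ℝ => Complex.exp ((n : ℂ) * (Complex.ofRealCLM θ * Complex.I)) := by
    funext θ
    rw [Circle.coe_exp, ← Complex.exp_int_mul]
    rfl
  rw [e]
  exact (contDiff_const.mul (Complex.ofRealCLM.contDiff.mul contDiff_const)).cexp

theorem contDiff_comp_circleExp_zpow {N : ℂ → ℂ} (hN : DifferentiableOn ℂ N (Metric.ball 0 (3 / 2)))
    (n : ℤ) : ContDiff ℝ ∞ fun θ : ℝ => N (((Circle.exp θ : Circle) : ℂ) ^ n) := by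
  have h1 : ContDiffOn ℝ ∞ N (Metric.ball 0 (3 / 2)) :=
    (hN.contDiffOn Metric.isOpen_ball).restrict_scalars ℝ
  refine h1.comp_contDiff (contDiff_circleExp_zpow n) fun θ => ?_
  rw [mem_ball_zero_iff, norm_circle_zpow]
  norm_num

theorem negPart_eq_series (l : Circle) (f : LA) :
    negPart l f = ∑' m : ℕ, coef (-((2 * m + 1 : ℕ) : ℤ)) f * ((l : ℂ) ^ (-1 : ℤ)) ^ (2 * m + 1) := by
  rw [← (hasSum_negPart l f).tsum_eq]
  refine tsum_congr fun m => ?_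
  rw [← zpow_natCast, ← zpow_mul]
  push_cast
  congr 2
  ring

theorem posPart_eq_series (l : Circle) (f : LA) :
    posPart l f = ∑' m : ℕ, coef ((2 * m + 1 : ℕ) : ℤ) f * ((l : ℂ) ^ (1 : ℤ)) ^ (2 * m + 1) := by
  rw [← (hasSum_posPart l f).tsum_eq]
  refine tsum_congr fun m => ?_
  rw [← zpow_natCast, ← zpow_mul]
  push_cast
  congr 2
  ring

theorem contDiff_negPart (f : LA) : ContDiff ℝ ∞ fun θ : ℝ => negPart (Circle.exp θ) f := by
  simp_rw [negPart_eq_series]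
  exact contDiff_comp_circleExp_zpow (differentiableOn_odd_series fun m => norm_coef_neg_le _ f) (-1)

theorem contDiff_posPart (f : LA) : ContDiff ℝ ∞ fun θ : ℝ => posPart (Circle.exp θ) f := by
  simp_rw [posPart_eq_series]
  exact contDiff_comp_circleExp_zpow (differentiableOn_odd_series fun m => norm_coef_nat_le _ f) 1

theorem contDiff_realProj (f : Vec LA) (i : Fin 4) :
    ContDiff ℝ ∞ fun θ : ℝ => realProj (Circle.exp θ) f i :=
  (contDiff_negPart (f i)).add (Complex.conjCLE.contDiff.comp (contDiff_negPart (f i)))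

/-! ### Twisted vectors over the Laurent algebra -/

/-- The twisting condition `v_{iλ} = -L_j v_λ` for vectors over the Laurent algebra. -/
def TwistedVec (f : Vec LA) : Prop :=
  ∀ l l' : Circle, (l' : ℂ) = Complex.I * l → ∀ i,
    eval l' (f i) = -(Lj ℂ *ᵥ fun j => eval l (f j)) i

theorem circleExp_add_pi_div_two (θ : ℝ) :
    ((Circle.exp (θ + Real.pi / 2) : Circle) : ℂ) = Complex.I * (Circle.exp θ : ℂ) := by
  rw [Circle.coe_exp, Circle.coe_exp]
  push_cast
  rw [add_mul, Complex.exp_add, Complex.exp_pi_div_two_mul_I, mul_comm]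

/-- Applying the twist twice sends `λ` to `-λ` and multiplies by `L_j² = -1`, so twisted vectors are
odd in `λ`. -/
theorem TwistedVec.eval_neg {f : Vec LA} (hf : TwistedVec f) (l : Circle) (i : Fin 4) :
    eval (-l) (f i) = -eval l (f i) := by
  obtain ⟨θ, rfl⟩ : ∃ θ : ℝ, Circle.exp θ = l := ⟨_, Circle.exp_arg l⟩
  have h1 := hf _ _ (circleExp_add_pi_div_two θ)
  have h2 := hf (Circle.exp (θ + Real.pi / 2)) (-Circle.exp θ) (by
    rw [circleExp_add_pi_div_two, ← mul_assoc, Complex.I_mul_I, Circle.coe_neg, neg_one_mul]) i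
  rw [h2]
  have e : (fun j => eval (Circle.exp (θ + Real.pi / 2)) (f j)) =
      -(Lj ℂ *ᵥ fun j => eval (Circle.exp θ) (f j)) := funext h1
  rw [e, Matrix.mulVec_neg, Lj_mulVec_Lj_mulVec, neg_neg]

/-- Oddness leaves no even powers, so the two odd halves exhaust the loop. Smoothness in `θ` follows
from their convergent power series. -/
theorem TwistedVec.eval_eq {f : Vec LA} (hf : TwistedVec f) (l : Circle) (i : Fin 4) :
    eval l (f i) = negPart l (f i) + posPart l (f i) := by
  have h := eval_sub_eval_neg l (f i)
  rw [hf.eval_neg] at h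
  linear_combination h / 2

theorem TwistedVec.contDiff_eval {f : Vec LA} (hf : TwistedVec f) (i : Fin 4) :
    ContDiff ℝ ∞ fun θ : ℝ => eval (Circle.exp θ) (f i) := by
  simp_rw [hf.eval_eq]
  exact (contDiff_negPart _).add (contDiff_posPart _)

/-- Rotating the circle by `π / 2` in the integral, which is allowed by periodicity, turns the twist
into an eigenvalue equation for each coefficient. -/
theorem TwistedVec.coef_eq {f : Vec LA} (hf : TwistedVec f) (n : ℤ) (i : Fin 4) :
    Complex.I ^ n * coef n (f i) = -(Lj ℂ *ᵥ fun j => coef n (f j)) i := by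
  have hI : Complex.I ^ n * Complex.I ^ (-n) = 1 := by
    rw [← zpow_add₀ Complex.I_ne_zero, add_neg_cancel, zpow_zero]
  rw [← clm_Lj_mulVec, ← map_neg, coef_eq_integral, coef_eq_integral]
  have hper : Function.Periodic (fun θ : ℝ => eval (Circle.exp θ) (f i) *
      ((Circle.exp θ : Circle) : ℂ) ^ (-n)) (2 * Real.pi) := fun θ => by
    simp only [Circle.exp_add, Circle.exp_two_pi, mul_one]
  have hshift : ∫ θ in (0 : ℝ)..2 * Real.pi,
        eval (Circle.exp θ) (f i) * ((Circle.exp θ : Circle) : ℂ) ^ (-n) =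
      Complex.I ^ (-n) * ∫ θ in (0 : ℝ)..2 * Real.pi,
        eval (Circle.exp θ) (-(Lj LA *ᵥ f) i) * ((Circle.exp θ : Circle) : ℂ) ^ (-n) := by
    have h := hper.intervalIntegral_add_eq 0 (Real.pi / 2)
    rw [zero_add] at h
    rw [h, ← intervalIntegral.integral_const_mul]
    have h2 := intervalIntegral.integral_comp_add_right (a := 0) (b := 2 * Real.pi)
      (fun θ : ℝ => eval (Circle.exp θ) (f i) * ((Circle.exp θ : Circle) : ℂ) ^ (-n)) (Real.pi / 2)
    rw [zero_add, add_comm (2 * Real.pi)] at h2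
    rw [← h2]
    congr 1
    funext θ
    rw [hf _ _ (circleExp_add_pi_div_two θ) i, circleExp_add_pi_div_two, map_neg, clm_Lj_mulVec,
      mul_zpow]
    ring
  rw [hshift]
  linear_combination (1 / (2 * Real.pi) * ∫ θ in (0 : ℝ)..2 * Real.pi,
        eval (Circle.exp θ) (-(Lj LA *ᵥ f) i) * ((Circle.exp θ : Circle) : ℂ) ^ (-n)) * hI

theorem TwistedVec.negPart_eq {f : Vec LA} (hf : TwistedVec f) {l l' : Circle}
    (hl : (l' : ℂ) = Complex.I * l) (i : Fin 4) :
    negPart l' (f i) = -(Lj ℂ *ᵥ fun j => negPart l (f j)) i := by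
  rw [← clm_Lj_mulVec, ← map_neg]
  refine (hasSum_negPart l' (f i)).unique ((hasSum_negPart l _).congr_fun fun m => ?_)
  rw [map_neg, clm_Lj_mulVec, ← hf.coef_eq, hl, mul_zpow]
  ring

theorem conj_Lj_mulVec (x : Vec ℂ) (i : Fin 4) :
    starRingEnd ℂ ((Lj ℂ *ᵥ x) i) = (Lj ℂ *ᵥ fun j => starRingEnd ℂ (x j)) i := by
  rw [Lj_mulVec, Lj_mulVec]
  fin_cases i <;> simp

theorem TwistedVec.realProj_eq {f : Vec LA} (hf : TwistedVec f) {l l' : Circle}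
    (hl : (l' : ℂ) = Complex.I * l) : realProj l' f = -(Lj ℂ *ᵥ realProj l f) := by
  funext i
  have : (Lj ℂ *ᵥ realProj l f) i = (Lj ℂ *ᵥ fun j => negPart l (f j)) i +
      starRingEnd ℂ ((Lj ℂ *ᵥ fun j => negPart l (f j)) i) := by
    rw [conj_Lj_mulVec, ← Pi.add_apply, ← Matrix.mulVec_add]
    rfl
  rw [Pi.neg_apply, this, realProj, hf.negPart_eq hl, map_neg]
  ring

/-- The coefficient of index `1` and the conjugate of the one of index `-1` have the same
`L_j`-eigenvalue `-i`, so their combination keeps it. -/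
theorem TwistedVec.residue_eq {f : Vec LA} (hf : TwistedVec f) :
    Lj ℂ *ᵥ residue f = -Complex.I • residue f := by
  funext i
  have h1 := hf.coef_eq 1 i
  have h2 := congrArg (starRingEnd ℂ) (hf.coef_eq (-1) i)
  rw [map_neg, conj_Lj_mulVec] at h2
  have : (Lj ℂ *ᵥ residue f) i = (Lj ℂ *ᵥ fun j => coef 1 (f j)) i -
      (Lj ℂ *ᵥ fun j => starRingEnd ℂ (coef (-1) (f j))) i := by
    rw [← Pi.sub_apply, ← Matrix.mulVec_sub]
    rfl
  rw [this]
  simp only [zpow_one, zpow_neg, map_mul, map_neg, Complex.conj_I, Complex.inv_I, neg_neg] at h1 h2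
  simp only [residue, Pi.smul_apply, smul_eq_mul]
  linear_combination h1 - h2

/-! ### The projection `P` on Laurent series -/

/-- On the unit circle `λ̄ = λ⁻¹`, so the second series defining `P` is the conjugate of the first.
-/
theorem P_eq_realProj {v : Circle → Vec ℂ} {f : Vec LA} (hv : ∀ l i, v l i = eval l (f i))
    (l : Circle) : P v l = realProj l f := by
  have hF : ∀ n i, fourierVec v n i = coef n (f i) := fun n i => by
    rw [coef_eq_integral, fourierVec]
    simp_rw [hv]
  funext i
  simp only [P, realProj, hF]
  congr 1
  · exact (hasSum_negPart l (f i)).tsum_eq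
  · rw [← (hasSum_negPart l (f i)).tsum_eq, Complex.conj_tsum]
    refine tsum_congr fun m => ?_
    rw [map_mul, map_zpow₀, ← Circle.coe_inv_eq_conj, Circle.coe_inv, inv_zpow', neg_neg]

end

end HamStat


namespace HamStat

noncomputable section

open Filter Topology

/-! ### Holomorphic functions with real boundary values -/

/-- Where `f` is real, `e^{i c f}` has modulus one, and the maximum principle propagates the bound
inward. The choices `c = ±1` force the imaginary part to vanish. -/
theorem norm_exp_I_mul_le_one {f : ℂ → ℂ} (hf : DiffContOnCl ℂ f (Metric.ball 0 1))
    (hreal : ∀ l : Circle, (f l).im = 0) (c : ℝ) {w : ℂ} (hw : w ∈ Metric.ball (0 : ℂ) 1) :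
    ‖Complex.exp (c * Complex.I * f w)‖ ≤ 1 := by
  have hd : DiffContOnCl ℂ (fun w => Complex.exp (c * Complex.I * f w)) (Metric.ball 0 1) :=
    Complex.differentiable_exp.comp_diffContOnCl (hf.const_smul ((c : ℂ) * Complex.I))
  refine Complex.norm_le_of_forall_mem_frontier_norm_le Metric.isBounded_ball hd ?_
    (subset_closure hw)
  intro z hz
  rw [frontier_ball (0 : ℂ) one_ne_zero, mem_sphere_zero_iff_norm] at hz
  have := hreal ⟨z, mem_sphere_zero_iff_norm.2 hz⟩
  rw [Complex.norm_exp]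
  change (f z).im = 0 at this
  simp [this]

/-- A function holomorphic in the unit disk, continuous up to the boundary, and real on the
boundary is constant. -/
theorem eq_of_real_on_circle {f : ℂ → ℂ} (hf : DiffContOnCl ℂ f (Metric.ball 0 1))
    (hreal : ∀ l : Circle, (f l).im = 0) (l : Circle) : f l = f 0 := by
  have him : ∀ w ∈ Metric.ball (0 : ℂ) 1, (f w).im = 0 := by
    intro w hw
    have h1 := norm_exp_I_mul_le_one hf hreal 1 hw
    have h2 := norm_exp_I_mul_le_one hf hreal (-1) hw
    rw [Complex.norm_exp, Real.exp_le_one_iff] at h1 h2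
    simp at h1 h2
    linarith
  have hopen := Metric.isOpen_ball (x := (0 : ℂ)) (ε := 1)
  -- With `Im f = 0` in the disk, the differential of `Im f`, evaluated at `1` and `i`, yields both
  -- components of `f'`.
  have hderiv : ∀ w ∈ Metric.ball (0 : ℂ) 1, deriv f w = 0 := by
    intro w hw
    have hd : HasDerivAt f (deriv f w) w :=
      (hf.differentiableOn.differentiableAt (hopen.mem_nhds hw)).hasDerivAt
    have h1 : HasFDerivAt (fun w => (f w).im)
        (Complex.imCLM.comp (wirt (deriv f w) 0)) w :=
      Complex.imCLM.hasFDerivAt.comp w (hasWirt_of_hasDerivAt hd)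
    have h2 : HasFDerivAt (fun w => (f w).im) (0 : ℂ →L[ℝ] ℝ) w := by
      refine (hasFDerivAt_const (0 : ℝ) w).congr_of_eventuallyEq ?_
      filter_upwards [hopen.mem_nhds hw] with z hz using him z hz
    have h3 := h1.unique h2
    have e1 := DFunLike.congr_fun h3 1
    have e2 := DFunLike.congr_fun h3 Complex.I
    simp [wirt_apply] at e1 e2
    exact Complex.ext e2 e1
  have hconst : ∀ w ∈ Metric.ball (0 : ℂ) 1, f w = f 0 := fun w hw =>
    hopen.is_const_of_deriv_eq_zero (convex_ball _ _).isPreconnected hf.differentiableOn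
      hderiv hw (Metric.mem_ball_self one_pos)
  have hcl := closure_ball (0 : ℂ) one_ne_zero
  have hEq : Set.EqOn f (fun _ => f 0) (closure (Metric.ball 0 1)) :=
    Set.EqOn.of_subset_closure hconst hf.continuousOn continuousOn_const subset_closure subset_rfl
  exact hEq (by rw [hcl]; exact mem_closedBall_zero_iff.2 (Circle.norm_coe l).le)

/-! ### The Borel subgroup -/

/-- These matrices are right multiplications by conjugate quaternions with complex coefficients. The
witness is the quaternion product of `p` and `q`, and the norm form is multiplicative. -/
theorem G0_mul {A B : Mat ℂ} (hA : A ∈ G0 ℂ) (hB : B ∈ G0 ℂ) : A * B ∈ G0 ℂ := by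
  obtain ⟨p, hp, rfl⟩ := hA
  obtain ⟨q, hq, rfl⟩ := hB
  refine ⟨![p 0 * q 0 - p 1 * q 1 - p 2 * q 2 - p 3 * q 3,
    p 0 * q 1 + p 1 * q 0 + p 2 * q 3 - p 3 * q 2,
    p 0 * q 2 - p 1 * q 3 + p 2 * q 0 + p 3 * q 1,
    p 0 * q 3 + p 1 * q 2 - p 2 * q 1 + p 3 * q 0], ?_, ?_⟩
  · rw [Fin.sum_univ_four] at hp hq ⊢
    simp only [Matrix.cons_val]
    linear_combination (q 0 ^ 2 + q 1 ^ 2 + q 2 ^ 2 + q 3 ^ 2) * hp + hq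
  · ext i j
    fin_cases i <;> fin_cases j <;>
    · simp [Ri, Rj, Rk, Matrix.mul_apply, Fin.sum_univ_four]
      ring

theorem G0_transpose {A : Mat ℂ} (hA : A ∈ G0 ℂ) : Aᵀ ∈ G0 ℂ ∧ Aᵀ * A = 1 := by
  obtain ⟨p, hp, rfl⟩ := hA
  rw [Fin.sum_univ_four] at hp
  refine ⟨⟨![p 0, -p 1, -p 2, -p 3], ?_, ?_⟩, ?_⟩
  · rw [Fin.sum_univ_four]
    simp only [Matrix.cons_val]
    linear_combination hp
  · ext i j
    fin_cases i <;> fin_cases j <;> simp [Ri, Rj, Rk]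
  · ext i j
    fin_cases i <;> fin_cases j <;>
    · simp [Ri, Rj, Rk, Matrix.mul_apply, Fin.sum_univ_four]
      first | ring1 | linear_combination hp

/-- The only real element of `B₀` is the identity. -/
theorem eq_one_of_mem_B0_of_real {C : Mat ℂ} (hC : C ∈ B0) (hreal : ∀ i j, (C i j).im = 0) :
    C = 1 := by
  obtain ⟨⟨q, hq, rfl⟩, r, hr, hCe⟩ := hC
  rw [Fin.sum_univ_four] at hq
  have hq0 := hreal 0 0
  have hq1 := hreal 1 0
  have hq2 := hreal 2 0
  have hq3 := hreal 3 0
  have e0 := congrFun hCe 0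
  have e1 := congrFun hCe 1
  have e2 := congrFun hCe 2
  have e3 := congrFun hCe 3
  simp [Ri, Rj, Rk] at hq0 hq1 hq2 hq3
  simp [Ri, Rj, Rk, eps, Matrix.mulVec, dotProduct, Fin.sum_univ_four] at e0 e1 e2 e3
  have f0 := congrArg Complex.re e0
  have f0' := congrArg Complex.im e0
  have f1 := congrArg Complex.re e1
  have f1' := congrArg Complex.im e1
  simp [hq0, hq1, hq2, hq3] at f0 f0' f1 f1'
  have g1 : q 1 = 0 := Complex.ext (by simp; linarith) (by simp [hq1])
  have g2 : q 2 = 0 := Complex.ext (by simp; linarith) (by simp [hq2])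
  have g3 : q 3 = 0 := Complex.ext (by simp; linarith) (by simp [hq3])
  have g0 : q 0 = r := Complex.ext (by simp; linarith) (by simp [hq0])
  rw [g1, g2, g3, g0] at hq
  -- The norm condition leaves `r = ±1`; the half-line in the definition of `B₀`, rather than a full
  -- line, rules out `-1`.
  have hr1 : r = 1 := by
    have : r ^ 2 = 1 := by
      have : ((r ^ 2 : ℝ) : ℂ) = 1 := by push_cast; linear_combination hq
      exact_mod_cast this
    nlinarith
  rw [g0, g1, g2, g3, hr1]
  simp

/-- On this group transposition is inversion, and inverting an element of `B₀` replaces its positive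
factor on `ε` by the reciprocal. -/
theorem B0_mul_transpose {A B : Mat ℂ} (hA : A ∈ B0) (hB : B ∈ B0) : A * Bᵀ ∈ B0 := by
  obtain ⟨hA0, r, hr, hAe⟩ := hA
  obtain ⟨hB0, s, hs, hBe⟩ := hB
  refine ⟨G0_mul hA0 (G0_transpose hB0).1, r / s, by positivity, ?_⟩
  have hs0 : (s : ℂ) ≠ 0 := by exact_mod_cast hs.ne'
  have h1 : Bᵀ *ᵥ eps = (s : ℂ)⁻¹ • eps := by
    have h2 : Bᵀ *ᵥ (B *ᵥ eps) = eps := by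
      rw [Matrix.mulVec_mulVec, (G0_transpose hB0).2, Matrix.one_mulVec]
    rw [hBe, Matrix.mulVec_smul] at h2
    rw [← h2, smul_smul, inv_mul_cancel₀ hs0, one_smul, h2]
  rw [← Matrix.mulVec_mulVec, h1, Matrix.mulVec_smul, hAe, smul_smul]
  congr 1
  push_cast
  field_simp

/-! ### Uniqueness of the factorization -/

theorem Motion.mul_rot (g h : Motion) : (g * h).rot = g.rot * h.rot := rfl

theorem Motion.mul_trans (g h : Motion) : (g * h).trans = g.rot *ᵥ h.trans + g.trans := rfl

theorem im_mul_eq_zero {A B : Mat ℂ} (hA : ∀ i j, (A i j).im = 0) (hB : ∀ i j, (B i j).im = 0)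
    (i j : Fin 4) : ((A * B) i j).im = 0 := by
  rw [Matrix.mul_apply, Complex.im_sum]
  exact Finset.sum_eq_zero fun k _ => by simp [hA, hB]

theorem im_mulVec_eq_zero {A : Mat ℂ} {x : Vec ℂ} (hA : ∀ i j, (A i j).im = 0)
    (hx : ∀ i, (x i).im = 0) (i : Fin 4) : ((A *ᵥ x) i).im = 0 := by
  rw [Matrix.mulVec, dotProduct, Complex.im_sum]
  exact Finset.sum_eq_zero fun k _ => by simp [hA, hx]

/-- The factor in `ΛG_τ` is determined by the product of an element of `ΛG_τ` with a loop that
extends holomorphically to the disk. -/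
theorem left_factor_unique {U U' V V' : Loop} (hU : U ∈ LoopG) (hU' : U' ∈ LoopG)
    (hV : V ∈ LoopPlus) (hV' : V' ∈ LoopPlus) (h : U * V = U' * V') : U' = U := by
  obtain ⟨hVG, e, he, her, het, he0, he0t⟩ := hV
  obtain ⟨hVG', e', he', her', het', he0', he0t'⟩ := hV'
  have hl : ∀ l, U l * V l = U' l * V' l := fun l => congrFun h l
  -- This is `U'⁻¹ U = V' V⁻¹` on rotations: the left side is real, the right side extends to the
  -- disk. Inverses are written as transposes so that the extension stays polynomial in the entries.
  have hrot : ∀ l, (U' l).rotᵀ * (U l).rot = (e' l).rot * (e l).rotᵀ := by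
    intro l
    have h1 := congrArg Motion.rot (hl l)
    rw [Motion.mul_rot, Motion.mul_rot] at h1
    have hVV : (V l).rot * (V l).rotᵀ = 1 := mul_eq_one_comm.1 (hVG.2.2 l).1
    have hUU : (U' l).rotᵀ * (U' l).rot = 1 := (hU'.2.2 l).1.1
    rw [he, he']
    calc (U' l).rotᵀ * (U l).rot
        = (U' l).rotᵀ * ((U l).rot * (V l).rot) * (V l).rotᵀ := by
          rw [Matrix.mul_assoc, Matrix.mul_assoc, hVV, Matrix.mul_one]
      _ = _ := by rw [h1, ← Matrix.mul_assoc, hUU, Matrix.one_mul]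
  have hreal : ∀ (l : Circle) i j, (((e' l).rot * (e l).rotᵀ) i j).im = 0 := fun l i j => by
    rw [← hrot]
    exact im_mul_eq_zero (fun i j => (hU'.2.2 l).2.1 j i) (hU.2.2 l).2.1 i j
  have hconst : ∀ l : Circle, (e' l).rot * (e l).rotᵀ = (e' 0).rot * (e 0).rotᵀ := by
    intro l
    ext i j
    refine eq_of_real_on_circle (f := fun w => ((e' w).rot * (e w).rotᵀ) i j) ?_
      (fun l => hreal l i j) l
    simp only [Matrix.mul_apply, Matrix.transpose_apply, Fin.sum_univ_four]
    exact (((((her' i 0).smul (her j 0)).add ((her' i 1).smul (her j 1))).add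
      ((her' i 2).smul (her j 2))).add ((her' i 3).smul (her j 3)))
  -- The constant is real and lies in `B₀`, hence is the identity.
  have hone : (e' 0).rot * (e 0).rotᵀ = 1 := by
    refine eq_one_of_mem_B0_of_real (B0_mul_transpose he0' he0) fun i j => ?_
    rw [← hconst 1]
    exact hreal 1 i j
  have hUrot : ∀ l, (U' l).rot = (U l).rot := by
    intro l
    have h1 := hrot l
    rw [hconst, hone] at h1
    have h2 := congrArg ((U' l).rot * ·) h1
    simp only [← Matrix.mul_assoc, Matrix.mul_one] at h2
    rw [mul_eq_one_comm.1 (hU'.2.2 l).1.1, Matrix.one_mul] at h2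
    exact h2.symm
  -- Once the rotations agree, the same argument applies to translations; the constant is now `0`
  -- because both extensions vanish at `λ = 0`.
  have htr : ∀ l : Circle, (e' l).trans - (e l).trans =
      (U l).rotᵀ *ᵥ ((U l).trans - (U' l).trans) := by
    intro l
    have h1 := congrArg Motion.trans (hl l)
    rw [Motion.mul_trans, Motion.mul_trans, hUrot] at h1
    have h2 : (U l).trans - (U' l).trans = (U l).rot *ᵥ ((V' l).trans - (V l).trans) := by
      rw [Matrix.mulVec_sub, sub_eq_sub_iff_add_eq_add, add_comm, h1]
    rw [he, he', h2, Matrix.mulVec_mulVec, (hU.2.2 l).1.1, Matrix.one_mulVec]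
  have hzero : ∀ l : Circle, (e' l).trans - (e l).trans = 0 := by
    intro l
    ext i
    have h1 := eq_of_real_on_circle (f := fun w => (e' w).trans i - (e w).trans i)
      ((het' i).sub (het i)) (fun l => by
        have h2 := congrFun (htr l) i
        rw [Pi.sub_apply] at h2
        rw [h2]
        refine im_mulVec_eq_zero (fun i j => (hU.2.2 l).2.1 j i) (fun i => ?_) i
        rw [Pi.sub_apply, Complex.sub_im, (hU.2.2 l).2.2 i, (hU'.2.2 l).2.2 i, sub_zero]) l
    simpa [he0t, he0t'] using h1
  funext l
  refine Motion.ext (hUrot l) ?_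
  have h1 := htr l
  rw [hzero] at h1
  have h2 := congrArg ((U l).rot *ᵥ ·) h1
  simp only [Matrix.mulVec_zero] at h2
  rw [Matrix.mulVec_mulVec, mul_eq_one_comm.1 (hU.2.2 l).1.1, Matrix.one_mulVec] at h2
  exact (sub_eq_zero.1 h2.symm).symm

end

end HamStat


namespace HamStat

noncomputable section

open Filter Topology

/-! ### The loops of the factorization -/

theorem tau_rotE (x : ℂ) : -(Lj ℂ * rotE x * Lj ℂ) = rotE (-x) := by
  have h : Lj ℂ * Li ℂ * Lj ℂ = Li ℂ := by
    rw [Lj_mul_Li, Matrix.neg_mul, Matrix.mul_assoc, Lj_mul_Lj, Matrix.mul_neg, neg_neg,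
      Matrix.mul_one]
  rw [rotE, rotE, rotCS, rotCS, cosR_neg, sinR_neg, Matrix.mul_add, Matrix.add_mul,
    Matrix.mul_smul, Matrix.mul_smul, Matrix.smul_mul, Matrix.smul_mul, Matrix.mul_one, h,
    Lj_mul_Lj]
  module

theorem rotCS_mem_linGroup {R : Type} [CommRing R] {c s : R} (h : c ^ 2 + s ^ 2 = 1) :
    rotCS c s ∈ linGroup R := by
  refine ⟨?_, ?_, ?_⟩
  · have ht : (rotCS c s)ᵀ = rotCS c (-s) := by
      simp only [rotCS, Matrix.transpose_add, Matrix.transpose_smul, Matrix.transpose_one,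
        Li_transpose]
      module
    rw [ht, rotCS_mul]
    have h1 : c * c - -s * s = 1 := by linear_combination h
    have h2 : c * s + -s * c = 0 := by ring
    rw [h1, h2, rotCS, one_smul, zero_smul, add_zero]
  · have hd : (rotCS c s).det = (c ^ 2 + s ^ 2) ^ 2 := by
      have e : rotCS c s = !![c, -s, 0, 0; s, c, 0, 0; 0, 0, c, -s; 0, 0, s, c] := by
        ext i j
        fin_cases i <;> fin_cases j <;> simp [rotCS, Li]
      rw [e]
      simp [Matrix.det_succ_row_zero, Fin.sum_univ_succ, Fin.succAbove]
      ring
    rw [hd, h, one_pow]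
  · simp [rotCS, add_mul, mul_add]

theorem rotE_mem_linGroup (x : ℂ) : rotE x ∈ linGroup ℂ := by
  rw [rotE_eq]
  exact rotCS_mem_linGroup (Complex.cos_sq_add_sin_sq x)

theorem contDiff_rotE {F : Type*} [NormedAddCommGroup F] [NormedSpace ℝ F] {s : Set F} {x : F → ℂ}
    (hx : ContDiffOn ℝ ∞ x s) (i j : Fin 4) : ContDiffOn ℝ ∞ (fun θ => rotE (x θ) i j) s := by
  simp only [rotE_eq, rotCS, Matrix.add_apply, Matrix.smul_apply, smul_eq_mul]
  exact (((Complex.contDiff_cos.restrict_scalars ℝ).comp_contDiffOn hx).mul contDiffOn_const).add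
    (((Complex.contDiff_sin.restrict_scalars ℝ).comp_contDiffOn hx).mul contDiffOn_const)

theorem contDiff_rotE_mulVec {F : Type*} [NormedAddCommGroup F] [NormedSpace ℝ F] {s : Set F}
    {x : F → ℂ} {y : F → Vec ℂ} (hx : ContDiffOn ℝ ∞ x s)
    (hy : ∀ i, ContDiffOn ℝ ∞ (fun θ => y θ i) s) (i : Fin 4) :
    ContDiffOn ℝ ∞ (fun θ => (rotE (x θ) *ᵥ y θ) i) s := by
  simp only [Matrix.mulVec, dotProduct]
  exact ContDiffOn.sum fun j _ => (contDiff_rotE hx i j).mul (hy j)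

/-- The loop `U_λ = (e^{β_λ L_i / 2}, X_λ)`. -/
def frameLoop (φ : ℂ → ℂ) (η : ℂ → Vec LA) (z : ℂ) : Loop := fun l =>
  ⟨rotE (halfBeta φ l z), transPart φ η l z⟩

/-- The loop `H_λ = (e^{λ⁻² φ L_i / 4}, η_λ)`. -/
def holLoop (φ : ℂ → ℂ) (η : ℂ → Vec LA) (z : ℂ) : Loop := fun l =>
  ⟨rotE (φ z / 4 * (l : ℂ) ^ (-2 : ℤ)), fun i => eval l (η z i)⟩

/-- The positive factor `V_λ = U_λ⁻¹ H_λ`. -/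
def plusLoop (φ : ℂ → ℂ) (η : ℂ → Vec LA) (z : ℂ) : Loop := fun l =>
  ⟨rotE (-(starRingEnd ℂ (φ z) / 4 * (l : ℂ) ^ (2 : ℤ))), fun i =>
    eval l (gaugedLA φ η z i) - realProj l (gaugedLA φ η z) i⟩

variable {φ : ℂ → ℂ} {η : ℂ → Vec LA} {z : ℂ}

theorem eval_gaugedLA (l : Circle) (i : Fin 4) :
    eval l (gaugedLA φ η z i) = (rotE (-halfBeta φ l z) *ᵥ fun j => eval l (η z j)) i := by
  rw [gaugedLA, eval_rotE_mulVec, map_neg, eval_halfBetaLA]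

theorem I_mul_zpow_neg_two {l l' : ℂ} (h : l' = Complex.I * l) :
    l' ^ (-2 : ℤ) = -l ^ (-2 : ℤ) := by
  rw [h, mul_zpow, zpow_neg Complex.I]
  norm_num [zpow_ofNat]

theorem I_mul_zpow_two {l l' : ℂ} (h : l' = Complex.I * l) : l' ^ (2 : ℤ) = -l ^ (2 : ℤ) := by
  rw [h, mul_zpow]
  norm_num [zpow_ofNat]

theorem halfBeta_I_mul {l l' : ℂ} (h : l' = Complex.I * l) : halfBeta φ l' z = -halfBeta φ l z := by
  rw [halfBeta, halfBeta, I_mul_zpow_neg_two h, I_mul_zpow_two h]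
  ring

theorem TwistedVec.gaugedLA (h : TwistedVec (η z)) : TwistedVec (gaugedLA φ η z) := by
  intro l l' hl i
  have e : (fun j => eval l (HamStat.gaugedLA φ η z j)) =
      rotE (-halfBeta φ l z) *ᵥ fun j => eval l (η z j) := funext fun j => eval_gaugedLA l j
  have e' : (fun j => eval l' (η z j)) = -(Lj ℂ *ᵥ fun j => eval l (η z j)) := funext (h l l' hl)
  rw [e, eval_gaugedLA, e', halfBeta_I_mul hl, Lj_mulVec_rotE, Matrix.mulVec_neg]
  rfl

/-- For `|λ| = 1` the two summands are conjugate to each other. -/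
theorem halfBeta_im (l : Circle) : (halfBeta φ l z).im = 0 := by
  have e : halfBeta φ l z = φ z / 4 * (l : ℂ) ^ (-2 : ℤ) +
      starRingEnd ℂ (φ z / 4 * (l : ℂ) ^ (-2 : ℤ)) := by
    rw [halfBeta, map_mul, map_zpow₀, map_div₀, map_ofNat, ← Circle.coe_inv_eq_conj,
      Circle.coe_inv, inv_zpow', neg_neg]
  rw [e, Complex.add_conj]
  exact Complex.ofReal_im _

theorem rotE_ofReal (r : ℝ) :
    rotE (r : ℂ) = (rotCS (Real.cos r) (Real.sin r)).map Complex.ofReal := by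
  rw [rotE_eq, ← Complex.ofReal_cos, ← Complex.ofReal_sin]
  ext i j
  fin_cases i <;> fin_cases j <;> simp [rotCS, Li]

theorem rotE_halfBeta_im (l : Circle) (i j : Fin 4) : (rotE (halfBeta φ l z) i j).im = 0 := by
  have : halfBeta φ l z = ((halfBeta φ l z).re : ℝ) :=
    Complex.ext rfl (by rw [halfBeta_im, Complex.ofReal_im])
  rw [this, rotE_ofReal]
  exact Complex.ofReal_im _

theorem realProj_im (l : Circle) (f : Vec LA) (i : Fin 4) : (realProj l f i).im = 0 := by
  rw [realProj, Complex.add_conj]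
  exact Complex.ofReal_im _

theorem transPart_im (l : Circle) (i : Fin 4) : (transPart φ η l z i).im = 0 :=
  im_mulVec_eq_zero (rotE_halfBeta_im l) (realProj_im l _) i

theorem contDiff_halfBeta : ContDiff ℝ ∞ fun θ : ℝ => halfBeta φ (Circle.exp θ) z :=
  (contDiff_const.mul (contDiff_circleExp_zpow _)).add
    (contDiff_const.mul (contDiff_circleExp_zpow _))

theorem frameLoop_mem (h : TwistedVec (η z)) : frameLoop φ η z ∈ LoopG := by
  refine ⟨⟨fun i j => ?_, fun i => ?_⟩, fun l l' hl => ?_, fun l => ⟨rotE_mem_linGroup _,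
    rotE_halfBeta_im l, transPart_im l⟩⟩
  · rw [← contDiffOn_univ]
    exact contDiff_rotE contDiff_halfBeta.contDiffOn i j
  · rw [← contDiffOn_univ]
    exact contDiff_rotE_mulVec contDiff_halfBeta.contDiffOn
      (fun i => (contDiff_realProj _ i).contDiffOn) i
  · refine Motion.ext ?_ ?_
    · change rotE _ = -(Lj ℂ * rotE _ * Lj ℂ)
      rw [tau_rotE, halfBeta_I_mul hl]
    · change rotE _ *ᵥ _ = -(Lj ℂ *ᵥ (rotE _ *ᵥ _))
      rw [Lj_mulVec_rotE, halfBeta_I_mul hl, h.gaugedLA.realProj_eq hl, Matrix.mulVec_neg]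

theorem holLoop_mem (h : TwistedVec (η z)) : holLoop φ η z ∈ LoopGC := by
  refine ⟨⟨fun i j => ?_, fun i => h.contDiff_eval i⟩, fun l l' hl => ?_,
    fun l => rotE_mem_linGroup _⟩
  · rw [← contDiffOn_univ]
    exact contDiff_rotE (contDiff_const.mul (contDiff_circleExp_zpow _)).contDiffOn i j
  · refine Motion.ext ?_ (funext (h l l' hl))
    change rotE _ = -(Lj ℂ * rotE _ * Lj ℂ)
    rw [tau_rotE, I_mul_zpow_neg_two hl, mul_neg]

theorem one_mem_B0 : (1 : Mat ℂ) ∈ B0 := by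
  refine ⟨⟨![1, 0, 0, 0], ?_, ?_⟩, 1, one_pos, ?_⟩
  · simp [Fin.sum_univ_four]
  · simp
  · simp

/-- Subtracting the real projection removes every negative power and leaves an odd power series,
which vanishes at `0`. The rotation involves `λ²` alone and is `1` at `0`. -/
theorem plusLoop_mem (h : TwistedVec (η z)) : plusLoop φ η z ∈ LoopPlus := by
  have hg : TwistedVec (gaugedLA φ η z) := h.gaugedLA
  refine ⟨⟨⟨fun i j => ?_, fun i => ?_⟩, fun l l' hl => ?_, fun l => rotE_mem_linGroup _⟩, ?_⟩
  · rw [← contDiffOn_univ]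
    exact contDiff_rotE (contDiff_const.mul (contDiff_circleExp_zpow _)).neg.contDiffOn i j
  · exact (hg.contDiff_eval i).sub (contDiff_realProj _ i)
  · refine Motion.ext ?_ (funext fun i => ?_)
    · change rotE _ = -(Lj ℂ * rotE _ * Lj ℂ)
      rw [tau_rotE, I_mul_zpow_two hl, mul_neg]
    · change eval l' _ - realProj l' _ i = -(Lj ℂ *ᵥ ((fun j => eval l _) - realProj l _)) i
      rw [hg l l' hl, hg.realProj_eq hl, Matrix.mulVec_sub, Pi.sub_apply, Pi.neg_apply]
      ring
  -- The positive coefficient minus the conjugate of the opposite negative one: the Taylor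
  -- coefficients of the extension.
  · let c : Fin 4 → ℕ → ℂ := fun i m => coef ((2 * m + 1 : ℕ) : ℤ) (gaugedLA φ η z i) -
      starRingEnd ℂ (coef (-((2 * m + 1 : ℕ) : ℤ)) (gaugedLA φ η z i))
    have hc : ∀ i m, ‖c i m‖ ≤ (1 / 2) ^ (2 * m + 1) * (2 * ‖gaugedLA φ η z i‖) := by
      intro i m
      refine (norm_sub_le _ _).trans ?_
      rw [Complex.norm_conj]
      have h1 := norm_coef_nat_le (2 * m + 1) (gaugedLA φ η z i)
      have h2 := norm_coef_neg_le (2 * m + 1) (gaugedLA φ η z i)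
      linarith
    have hball : closure (Metric.ball (0 : ℂ) 1) ⊆ Metric.ball 0 (3 / 2) := by
      rw [closure_ball _ one_ne_zero]
      exact Metric.closedBall_subset_ball (by norm_num)
    refine ⟨fun w => ⟨rotE (-(starRingEnd ℂ (φ z) / 4 * w ^ 2)), fun i =>
      ∑' m : ℕ, c i m * w ^ (2 * m + 1)⟩, fun l => ?_, fun i j => ?_, fun i => ?_, ?_, ?_⟩
    · refine Motion.ext rfl (funext fun i => ?_)
      change _ = eval l _ - realProj l _ i
      rw [hg.eval_eq, realProj]
      have h1 := hasSum_posPart l (gaugedLA φ η z i)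
      have h2 := Complex.hasSum_conj'.2 ((hasSum_negPart l (gaugedLA φ η z i)))
      have h3 := h1.sub h2
      rw [add_sub_add_left_eq_sub]
      refine (h3.congr_fun fun m => ?_).tsum_eq
      simp only [c]
      rw [map_mul, map_zpow₀, ← Circle.coe_inv_eq_conj, Circle.coe_inv, inv_zpow', neg_neg,
        ← zpow_natCast]
      push_cast
      ring
    · refine Differentiable.diffContOnCl ?_
      simp only [rotE_eq, rotCS, Matrix.add_apply, Matrix.smul_apply, smul_eq_mul]
      fun_prop
    · exact ((differentiableOn_odd_series (hc i)).mono hball).diffContOnCl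
    · change rotE (-(starRingEnd ℂ (φ z) / 4 * 0 ^ 2)) ∈ B0
      rw [zero_pow two_ne_zero, mul_zero, neg_zero, rotE_zero]
      exact one_mem_B0
    · funext i
      simp

/-- All rotations are generated by `L_i` and commute, so their exponents add; in the translation the
real projection cancels and the gauge factor is undone. -/
theorem holLoop_eq : holLoop φ η z = frameLoop φ η z * plusLoop φ η z := by
  funext l
  refine Motion.ext ?_ ?_
  · change rotE _ = rotE _ * rotE _
    rw [← rotE_add, halfBeta]
    congr 1
    ring
  · change _ = rotE _ *ᵥ ((fun i => eval l _) - realProj l _) + rotE _ *ᵥ realProj l _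
    rw [← Matrix.mulVec_add, sub_add_cancel]
    have e : (fun j => eval l (gaugedLA φ η z j)) =
      rotE (-halfBeta φ l z) *ᵥ fun j => eval l (η z j) := funext fun j => eval_gaugedLA l j
    rw [e, Matrix.mulVec_mulVec, rotE_mul_rotE_neg, Matrix.one_mulVec]
    rfl

end

end HamStat


namespace HamStat

noncomputable section

open Filter Topology

/-! ### Harmonic functions as real parts of holomorphic functions -/

theorem HasDerivAt.hasFDerivAt_re {φ : ℂ → ℂ} {φ' z : ℂ} (h : HasDerivAt φ φ' z) :
    HasFDerivAt (fun w => (φ w).re)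
      (Complex.reCLM ∘L (ContinuousLinearMap.toSpanSingleton ℂ φ').restrictScalars ℝ) z :=
  (Complex.reCLM.hasFDerivAt).comp z (h.hasFDerivAt.restrictScalars ℝ)

theorem fderiv_re_apply {φ : ℂ → ℂ} {φ' z : ℂ} (h : HasDerivAt φ φ' z) (e : ℂ) :
    fderiv ℝ (fun w => (φ w).re) z e = (φ' * e).re := by
  rw [(HasDerivAt.hasFDerivAt_re h).fderiv]
  simp [mul_comm]

theorem dz_re {φ : ℂ → ℂ} {φ' z : ℂ} (h : HasDerivAt φ φ' z) :
    dz (fun w => (φ w).re) z = φ' / 2 := by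
  rw [dz, fderiv_re_apply h, fderiv_re_apply h]
  apply Complex.ext <;> simp <;> ring

theorem laplacian_re_eq_zero {Ω : Set ℂ} (hΩ : IsOpen Ω) {φ : ℂ → ℂ} (hφ : DifferentiableOn ℂ φ Ω)
    {z : ℂ} (hz : z ∈ Ω) :
    fderiv ℝ (fun w => fderiv ℝ (fun v => (φ v).re) w 1) z 1 +
      fderiv ℝ (fun w => fderiv ℝ (fun v => (φ v).re) w Complex.I) z Complex.I = 0 := by
  have key : ∀ e : ℂ, fderiv ℝ (fun w => fderiv ℝ (fun v => (φ v).re) w e) z e =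
      (deriv (deriv φ) z * e * e).re := by
    intro e
    have h1 : (fun w => fderiv ℝ (fun v => (φ v).re) w e) =ᶠ[𝓝 z] fun w => (deriv φ w * e).re := by
      filter_upwards [hΩ.mem_nhds hz] with w hw
      exact fderiv_re_apply (hφ.differentiableAt (hΩ.mem_nhds hw)).hasDerivAt e
    rw [h1.fderiv_eq]
    exact fderiv_re_apply
      (((hφ.deriv hΩ).differentiableAt (hΩ.mem_nhds hz)).hasDerivAt.mul_const e) e
  rw [key, key, mul_assoc, mul_assoc, Complex.I_mul_I]
  simp

/-- Harmonicity makes `β_x - i β_y` holomorphic. The real part of its primitive has the differential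
and base value of `β`, and the imaginary part is the conjugate. -/
theorem exists_isHarmonicConjugate {Ω : Set ℂ} (hΩo : IsOpen Ω) (hΩ : IsSimplyConnected Ω)
    {z₀ : ℂ} (hz₀ : z₀ ∈ Ω) {β : ℂ → ℝ} (hβ : InnerProductSpace.HarmonicOnNhd β Ω)
    (hβ₀ : β z₀ = 0) : ∃ γ : ℂ → ℝ, IsHarmonicConjugate Ω z₀ β γ := by
  obtain ⟨Φ, h0, hΦ⟩ := exists_primitive hΩo hΩ
    (g := fun z => (fderiv ℝ β z 1 : ℂ) - Complex.I * (fderiv ℝ β z Complex.I : ℂ))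
    (fun z hz => (HarmonicAt.differentiableAt_complex_partial (hβ z hz)).differentiableWithinAt) z₀
  have hd : ∀ z ∈ Ω, DifferentiableAt ℝ β z := fun z hz =>
    (hβ z hz).1.differentiableAt two_ne_zero
  have heq : Set.EqOn (fun w => (Φ w).re) β Ω := by
    refine hΩo.eqOn_of_fderiv_eq (𝕜 := ℝ) hΩ.isPathConnected.isConnected.isPreconnected
      (fun z hz => (HasDerivAt.hasFDerivAt_re (hΦ z hz)).differentiableAt.differentiableWithinAt)
      (fun z hz => (hd z hz).differentiableWithinAt) (fun z hz => ?_) hz₀ ?_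
    · ext e
      rw [fderiv_re_apply (hΦ z hz)]
      have : e = e.re • (1 : ℂ) + e.im • Complex.I := by
        apply Complex.ext <;> simp
      conv_rhs => rw [this, map_add, map_smul, map_smul]
      simp
      ring
    · simp [h0, hβ₀]
  refine ⟨fun z => (Φ z).im, ?_, by simp [h0]⟩
  refine DifferentiableOn.congr (f := Φ)
    (fun z hz => (hΦ z hz).differentiableAt.differentiableWithinAt) fun z hz => ?_
  rw [← heq hz, mul_comm]
  exact Complex.re_add_im _

/-! ### The holomorphic data of the Weierstrass representation -/

/-- `φ` is the holomorphic function `β + iγ`, and `η` the primitive that vanishes at `z₀` of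
`e^{λ⁻² φ L_i / 4} λ⁻¹ (a ε + b L_i ε̄)`. -/
structure WeierstrassData (Ω : Set ℂ) (z₀ : ℂ) (φ a b : ℂ → ℂ) (η : ℂ → Vec LA) : Prop where
  isOpen : IsOpen Ω
  isPreconnected : IsPreconnected Ω
  mem : z₀ ∈ Ω
  phi_differentiableOn : DifferentiableOn ℂ φ Ω
  phi_zero : φ z₀ = 0
  a_differentiableOn : DifferentiableOn ℂ a Ω
  b_differentiableOn : DifferentiableOn ℂ b Ω
  eta_hasDerivAt : ∀ z ∈ Ω, HasDerivAt η (integrandLA φ a b z) z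
  eta_zero : η z₀ = 0

/-- `ε` and `L_i ε̄` both have `L_j`-eigenvalue `i`, that is, degree `-1` for `τ`. This makes the
coefficient `λ⁻¹` in the potential compatible with the twist. -/
theorem Lj_mulVec_wvec (a b : ℂ → ℂ) (z : ℂ) : Lj ℂ *ᵥ wvec a b z = Complex.I • wvec a b z := by
  rw [Lj_mulVec, wvec, Li_mulVec]
  funext i
  fin_cases i <;> simp [eps, epsBar] <;> ring_nf <;> simp [Complex.I_sq] <;> ring

theorem hasDerivAt_wvec {a b : ℂ → ℂ} {z : ℂ} (ha : DifferentiableAt ℂ a z)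
    (hb : DifferentiableAt ℂ b z) :
    HasDerivAt (wvec a b) (deriv a z • eps + deriv b z • (Li ℂ *ᵥ epsBar)) z :=
  (ha.hasDerivAt.smul_const eps).add (hb.hasDerivAt.smul_const _)

theorem differentiableAt_integrandLA {φ a b : ℂ → ℂ} {z : ℂ} (hφ : DifferentiableAt ℂ φ z)
    (ha : DifferentiableAt ℂ a z) (hb : DifferentiableAt ℂ b z) :
    DifferentiableAt ℂ (integrandLA φ a b) z := by
  have h1 := hasWirt_of_hasDerivAt ((hφ.hasDerivAt.div_const 4).smul_const (mono (-2)))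
  have hw := hasDerivAt_pi.1 (hasDerivAt_wvec ha hb)
  have h2 := hasWirt_of_hasDerivAt
    (hasDerivAt_pi.2 fun i => (hw i).smul_const (mono (-1)))
  exact (hasDerivAt_of_hasWirt ((h1.rotE_mulVec h2).congr_values rfl (by simp))).differentiableAt

theorem exists_weierstrassData {Ω : Set ℂ} (hΩo : IsOpen Ω) (hΩ : IsSimplyConnected Ω)
    {z₀ : ℂ} (hz₀ : z₀ ∈ Ω) {φ a b : ℂ → ℂ} (hφ : DifferentiableOn ℂ φ Ω) (hφ₀ : φ z₀ = 0)
    (ha : DifferentiableOn ℂ a Ω) (hb : DifferentiableOn ℂ b Ω) :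
    ∃ η, WeierstrassData Ω z₀ φ a b η := by
  obtain ⟨η, h0, hη⟩ := exists_primitive hΩo hΩ (g := integrandLA φ a b)
    (fun z hz => (differentiableAt_integrandLA (hφ.differentiableAt (hΩo.mem_nhds hz))
      (ha.differentiableAt (hΩo.mem_nhds hz))
      (hb.differentiableAt (hΩo.mem_nhds hz))).differentiableWithinAt) z₀
  exact ⟨η, hΩo, hΩ.isPathConnected.isConnected.isPreconnected, hz₀, hφ, hφ₀, ha, hb, hη, h0⟩

/-- The vector `L_j y` depends continuously and linearly on `y`. -/
def LjL : Vec ℂ →L[ℂ] Vec ℂ := LinearMap.toContinuousLinearMap (Matrix.mulVecLin (Lj ℂ))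

theorem HasWirt.rotE_apply {x : ℂ → ℂ} {xp xq z : ℂ} (hx : HasWirt x xp xq z) (i j : Fin 4) :
    HasWirt (fun w => rotE (x w) i j) ((rotE (x z) * xp • Li ℂ) i j)
      ((rotE (x z) * xq • Li ℂ) i j) z := by
  have hc : HasWirt (fun _ : ℂ => (Pi.single j 1 : Vec ℂ)) 0 0 z :=
    hasWirt_of_hasDerivAt (hasDerivAt_const _ _)
  have h := hasWirt_pi.1 (hx.rotE_mulVec hc) i
  have e : ∀ (A : Mat ℂ), (A *ᵥ Pi.single j 1) i = A i j := fun A => by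
    rw [Matrix.mulVec_single_one]
    rfl
  simp only [e] at h
  refine h.congr_values ?_ ?_ <;>
  · rw [add_zero, ← Matrix.smul_mulVec, Matrix.mulVec_mulVec, e]

/-- Solutions of `dU = U α` with `α = (c L_i, t) dz` are determined by their initial value. -/
theorem solvesOn_unique {Ω : Set ℂ} (hΩo : IsOpen Ω) (hΩ : IsPreconnected Ω) {z₀ : ℂ}
    (hz₀ : z₀ ∈ Ω) {x : ℂ → ℂ} (hx : DifferentiableOn ℂ x Ω) {α : ℂ → LieElt}
    (hα : ∀ z ∈ Ω, (α z).1 = deriv x z • Li ℂ) {U U' : ℂ → Motion}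
    (hU : SolvesOn Ω U α fun _ => 0) (hU' : SolvesOn Ω U' α fun _ => 0) (h₀ : U z₀ = U' z₀) :
    ∀ z ∈ Ω, U z = U' z := by
  -- The rows of the rotation, read as column vectors, solve `y' = -x' L_i y` because `L_i` is skew;
  -- `e^{x L_i}` is an integrating factor.
  have hconst : ∀ V : ℂ → Motion, SolvesOn Ω V α (fun _ => 0) → ∀ i, ∀ z ∈ Ω,
      HasDerivAt (fun w => rotE (x w) *ᵥ (V w).rot i) 0 z := by
    intro V hV i z hz
    have h1 : HasWirt (fun w => (V w).rot i) (-(deriv x z • (Li ℂ *ᵥ (V z).rot i))) 0 z := by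
      rw [hasWirt_pi]
      intro j
      refine (hasWirt_iff.2 ((hV z hz).1 i j)).congr_values ?_ ?_
      · rw [hα z hz, Matrix.mul_smul, Matrix.smul_apply, Pi.neg_apply, Pi.smul_apply, ← smul_neg]
        congr 1
        rw [← Pi.neg_apply (f := Li ℂ *ᵥ _), ← Matrix.neg_mulVec, ← Li_transpose,
          Matrix.mulVec_transpose]
        rfl
      · change ((V z).rot * (0 : Mat ℂ)) i j = 0
        rw [Matrix.mul_zero]
        rfl
    have h2 := hasWirt_of_hasDerivAt (hx.differentiableAt (hΩo.mem_nhds hz)).hasDerivAt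
    refine hasDerivAt_of_hasWirt ((h2.rotE_mulVec h1).congr_values ?_ ?_)
    · rw [add_neg_cancel, Matrix.mulVec_zero]
    · rw [zero_smul, add_zero, Matrix.mulVec_zero]
  have hrot : ∀ z ∈ Ω, (U z).rot = (U' z).rot := by
    intro z hz
    funext i
    have h := eqOn_of_hasDerivAt_eq hΩo hΩ (hconst U hU i) (hconst U' hU' i) hz₀
      (by rw [h₀]) hz
    have h' := congrArg (fun y => rotE (-x z) *ᵥ y) h
    simpa only [Matrix.mulVec_mulVec, rotE_neg_mul_rotE, Matrix.one_mulVec] using h'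
  have htr : ∀ V : ℂ → Motion, SolvesOn Ω V α (fun _ => 0) → ∀ z ∈ Ω,
      HasDerivAt (fun w => (V w).trans) ((V z).rot *ᵥ (α z).2) z := by
    intro V hV z hz
    rw [hasDerivAt_pi]
    intro i
    refine hasDerivAt_of_hasWirt ((hasWirt_iff.2 ((hV z hz).2 i)).congr_values rfl ?_)
    change ((V z).rot *ᵥ (0 : Vec ℂ)) i = 0
    rw [Matrix.mulVec_zero]
    rfl
  intro z hz
  refine Motion.ext (hrot z hz) ?_
  refine eqOn_of_hasDerivAt_eq hΩo hΩ (htr U hU) (fun z hz => ?_) hz₀ (by rw [h₀]) hz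
  rw [hrot z hz]
  exact htr U' hU' z hz

/-! ### Identification of the explicit loops with the potential and the Weierstrass map -/

namespace WeierstrassData

variable {Ω : Set ℂ} {z₀ : ℂ} {φ a b : ℂ → ℂ} {η : ℂ → Vec LA}

theorem phi_differentiableAt (h : WeierstrassData Ω z₀ φ a b η) {z : ℂ} (hz : z ∈ Ω) :
    DifferentiableAt ℂ φ z := h.phi_differentiableOn.differentiableAt (h.isOpen.mem_nhds hz)

theorem eval_eta_hasDerivAt (h : WeierstrassData Ω z₀ φ a b η) (l : Circle) {z : ℂ} (hz : z ∈ Ω) :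
    HasDerivAt (fun w i => eval l (η w i))
      (rotE (φ z / 4 * (l : ℂ) ^ (-2 : ℤ)) *ᵥ ((l : ℂ)⁻¹ • wvec a b z)) z := by
  rw [hasDerivAt_pi]
  intro i
  have h1 := (eval l).hasFDerivAt.comp_hasDerivAt z (hasDerivAt_pi.1 (h.eta_hasDerivAt z hz) i)
  have e : eval l (integrandLA φ a b z i) =
      (rotE (φ z / 4 * (l : ℂ) ^ (-2 : ℤ)) *ᵥ ((l : ℂ)⁻¹ • wvec a b z)) i := by
    rw [integrandLA, eval_rotE_mulVec, map_smul, eval_mono, smul_eq_mul]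
    congr 2
    funext j
    simp [eval_mono, mul_comm]
  rw [← e]
  exact h1

/-- `η_{iλ}` and `-L_j η_λ` are primitives of the same function with the same value at `z₀`. -/
theorem twistedVec_eta (h : WeierstrassData Ω z₀ φ a b η) {z : ℂ} (hz : z ∈ Ω) :
    TwistedVec (η z) := by
  intro l l' hl i
  have h2 : ∀ w ∈ Ω, HasDerivAt (fun w => -(Lj ℂ *ᵥ fun j => eval l (η w j)))
      (rotE (φ w / 4 * (l' : ℂ) ^ (-2 : ℤ)) *ᵥ ((l' : ℂ)⁻¹ • wvec a b w)) w := by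
    intro w hw
    refine ((LjL.hasFDerivAt.comp_hasDerivAt w (h.eval_eta_hasDerivAt l hw)).neg).congr_deriv ?_
    change -(Lj ℂ *ᵥ (rotE _ *ᵥ _)) = _
    rw [Lj_mulVec_rotE, Matrix.mulVec_smul, Lj_mulVec_wvec, ← Matrix.mulVec_neg,
      I_mul_zpow_neg_two hl, mul_neg, hl, mul_inv, Complex.inv_I, smul_smul, ← neg_smul]
    congr 2
    ring
  exact congrFun (eqOn_of_hasDerivAt_eq h.isOpen h.isPreconnected
    (fun w hw => h.eval_eta_hasDerivAt l' hw) h2 h.mem (by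
      rw [h.eta_zero]
      funext i
      simp [Matrix.mulVec, dotProduct]) hz) i

/-- `L_i` interchanges the eigenspaces of `L_j`, so it moves `residue` from eigenvalue `-i` to `i`,
where `wvec` already lies. -/
theorem Lj_mulVec_frameVec (h : WeierstrassData Ω z₀ φ a b η) {z : ℂ} (hz : z ∈ Ω) :
    Lj ℂ *ᵥ frameVec φ a b η z = Complex.I • frameVec φ a b η z := by
  have hr := (h.twistedVec_eta hz).gaugedLA (φ := φ).residue_eq
  rw [frameVec, Matrix.mulVec_sub, Matrix.mulVec_smul, Lj_mulVec_wvec, Lj_mulVec_Li_mulVec, hr,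
    Matrix.mulVec_smul]
  module

theorem etaLoop_eq (h : WeierstrassData Ω z₀ φ a b η) {β γ : ℂ → ℝ}
    (hφ : ∀ z, φ z = (β z : ℂ) + Complex.I * (γ z : ℂ)) (l : Circle) {z : ℂ} (hz : z ∈ Ω) :
    etaLoop Ω z₀ β γ a b l z = fun i => eval l (η z i) := by
  have hd : ∀ w ∈ Ω, HasDerivAt (fun w i => eval l (η w i))
      (expLi ((l : ℂ) ^ (-2 : ℤ) / 4 * ((β w : ℂ) + Complex.I * (γ w : ℂ))) *ᵥ
        ((l : ℂ)⁻¹ • wvec a b w)) w := by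
    intro w hw
    refine (h.eval_eta_hasDerivAt l hw).congr_deriv ?_
    rw [expLi_eq_rotE, ← hφ]
    congr 2
    ring
  have hex : ∃ Φ : ℂ → Vec ℂ, Φ z₀ = 0 ∧ ∀ w ∈ Ω, HasDerivAt Φ
      (expLi ((l : ℂ) ^ (-2 : ℤ) / 4 * ((β w : ℂ) + Complex.I * (γ w : ℂ))) *ᵥ
        ((l : ℂ)⁻¹ • wvec a b w)) w := by
    refine ⟨_, ?_, hd⟩
    funext i
    simp [h.eta_zero]
  rw [etaLoop, integralFrom, dif_pos hex]
  refine eqOn_of_hasDerivAt_eq h.isOpen h.isPreconnected hex.choose_spec.2 hd h.mem ?_ hz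
  rw [hex.choose_spec.1]
  funext i
  simp [h.eta_zero]

theorem weierstrassMap_eq (h : WeierstrassData Ω z₀ φ a b η) {β γ : ℂ → ℝ}
    (hφ : ∀ z, φ z = (β z : ℂ) + Complex.I * (γ z : ℂ)) {z : ℂ} (hz : z ∈ Ω) :
    weierstrassMap Ω z₀ β γ a b z = frameLoop φ η z := by
  have hb : ∀ l : ℂ, betaLoop β γ l z / 2 = halfBeta φ l z := by
    intro l
    rw [betaLoop, halfBeta, hφ, map_add, map_mul, Complex.conj_ofReal, Complex.conj_ofReal,
      Complex.conj_I, zpow_ofNat l 2]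
    ring
  funext l
  rw [weierstrassMap, P_eq_realProj (f := gaugedLA φ η z)]
  · rw [hb, expLi_eq_rotE]
    rfl
  · intro l i
    rw [hb, expLi_eq_rotE, h.etaLoop_eq hφ l hz, eval_gaugedLA]

theorem holLoop_integratesPotential (h : WeierstrassData Ω z₀ φ a b η) {β : ℂ → ℝ}
    (hβ : ∀ z, (φ z).re = β z) : IntegratesPotential Ω z₀ β a b (holLoop φ η) := by
  refine ⟨fun z hz => holLoop_mem (h.twistedVec_eta hz), fun l => ⟨?_, fun z hz => ⟨fun i j => ?_,
    fun i => ?_⟩⟩⟩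
  · refine Motion.ext ?_ ?_
    · change rotE (φ z₀ / 4 * _) = 1
      rw [h.phi_zero, zero_div, zero_mul, rotE_zero]
    · funext i
      change eval l (η z₀ i) = 0
      rw [h.eta_zero]
      exact map_zero _
  · have hφ := (h.phi_differentiableAt hz).hasDerivAt
    have h1 := hasWirt_of_hasDerivAt ((hφ.div_const 4).mul_const ((l : ℂ) ^ (-2 : ℤ)))
    have hdz : dz β z = deriv φ z / 2 := by
      rw [← dz_re hφ]
      simp only [hβ]
    rw [← hasWirt_iff]
    refine (h1.rotE_apply i j).congr_values ?_ ?_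
    · simp only [potential, hdz]
      change (rotE _ * (_ : ℂ) • Li ℂ : Mat ℂ) i j = (rotE _ * (_ : ℂ) • Li ℂ : Mat ℂ) i j
      ring_nf
    · rw [zero_smul]
      rfl
  · rw [← hasWirt_iff]
    refine hasWirt_pi.1 ((hasWirt_of_hasDerivAt
      (h.eval_eta_hasDerivAt l hz)).congr_values rfl ?_) i
    exact (Matrix.mulVec_zero _).symm

theorem eq_holLoop (h : WeierstrassData Ω z₀ φ a b η) {β : ℂ → ℝ}
    (hβ : ∀ z, (φ z).re = β z) {H : ℂ → Loop} (hH : IntegratesPotential Ω z₀ β a b H) {z : ℂ}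
    (hz : z ∈ Ω) : H z = holLoop φ η z := by
  have hH' := h.holLoop_integratesPotential hβ
  funext l
  refine solvesOn_unique h.isOpen h.isPreconnected h.mem
    (x := fun z => φ z / 4 * (l : ℂ) ^ (-2 : ℤ)) (fun z hz =>
      (((h.phi_differentiableAt hz).div_const 4).mul_const _).differentiableWithinAt)
    (fun z hz => ?_) (hH.2 l).2 (hH'.2 l).2 ((hH.2 l).1.trans (hH'.2 l).1.symm) z hz
  have hφ := (h.phi_differentiableAt hz).hasDerivAt
  rw [((hφ.div_const 4).mul_const _).deriv, potential]
  have hdz : dz β z = deriv φ z / 2 := by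
    rw [← dz_re hφ]
    simp only [hβ]
  rw [hdz]
  change (_ : ℂ) • Li ℂ = (_ : ℂ) • Li ℂ
  congr 1
  ring

end WeierstrassData

end

end HamStat


namespace HamStat

noncomputable section

open Filter Topology

/-! ### Smoothness of the representation -/

section Smooth

variable {E : Type*} [NormedAddCommGroup E] [NormedSpace ℝ E] {s : Set E}

theorem contDiff_exp_LA : ContDiff ℝ ∞ (NormedSpace.exp : LA → LA) :=
  (contDiff_iff_contDiffAt.2 fun x =>
    (NormedSpace.exp_analytic (𝕂 := ℂ) x).contDiffAt).restrict_scalars ℝ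

theorem contDiffOn_cosR {x : E → LA} (hx : ContDiffOn ℝ ∞ x s) :
    ContDiffOn ℝ ∞ (fun z => cosR (x z)) s := by
  have h1 : ContDiffOn ℝ ∞ (fun z => Complex.I • x z) s := hx.const_smul Complex.I
  exact ContDiffOn.const_smul _ ((contDiff_exp_LA.comp_contDiffOn h1).add (contDiff_exp_LA.comp_contDiffOn h1.neg))

theorem contDiffOn_sinR {x : E → LA} (hx : ContDiffOn ℝ ∞ x s) :
    ContDiffOn ℝ ∞ (fun z => sinR (x z)) s := by
  have h1 : ContDiffOn ℝ ∞ (fun z => Complex.I • x z) s := hx.const_smul Complex.I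
  exact ContDiffOn.const_smul _ ((contDiff_exp_LA.comp_contDiffOn h1).sub (contDiff_exp_LA.comp_contDiffOn h1.neg))

end Smooth

namespace WeierstrassData

variable {Ω : Set ℂ} {z₀ : ℂ} {φ a b : ℂ → ℂ} {η : ℂ → Vec LA}

theorem contDiffOn_phi (h : WeierstrassData Ω z₀ φ a b η) : ContDiffOn ℝ ∞ φ Ω :=
  (h.phi_differentiableOn.contDiffOn h.isOpen).restrict_scalars ℝ

theorem contDiffOn_gaugedLA (h : WeierstrassData Ω z₀ φ a b η) (i : Fin 4) :
    ContDiffOn ℝ ∞ (fun z => gaugedLA φ η z i) Ω := by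
  have hη : ∀ i, ContDiffOn ℝ ∞ (fun z => η z i) Ω := fun i =>
    (DifferentiableOn.contDiffOn (fun z hz => (hasDerivAt_pi.1 (h.eta_hasDerivAt z hz)
      i).differentiableAt.differentiableWithinAt) h.isOpen).restrict_scalars ℝ
  have hL : ContDiffOn ℝ ∞ (fun z => (Li LA *ᵥ η z) i) Ω := by
    simp only [Matrix.mulVec, dotProduct]
    exact ContDiffOn.sum fun j _ => contDiffOn_const.mul (hη j)
  have hb : ContDiffOn ℝ ∞ (fun z => -halfBetaLA φ z) Ω := by
    refine ContDiffOn.neg (ContDiffOn.add ?_ ?_)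
    · exact (h.contDiffOn_phi.div_const 4).smul contDiffOn_const
    · exact ((Complex.conjCLE.contDiff.comp_contDiffOn h.contDiffOn_phi).div_const 4).smul
        contDiffOn_const
  simp only [gaugedLA, rotE_mulVec, Pi.add_apply, Pi.smul_apply, smul_eq_mul]
  exact ((contDiffOn_cosR hb).mul (hη i)).add ((contDiffOn_sinR hb).mul hL)

theorem contDiffOn_frameVec (h : WeierstrassData Ω z₀ φ a b η) (i : Fin 4) :
    ContDiffOn ℝ ∞ (fun z => frameVec φ a b η z i) Ω := by
  have hr : ∀ j, ContDiffOn ℝ ∞ (fun z => residue (gaugedLA φ η z) j) Ω := fun j =>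
    (((coef 1).restrictScalars ℝ).contDiff.comp_contDiffOn (h.contDiffOn_gaugedLA j)).sub
      (Complex.conjCLE.contDiff.comp_contDiffOn
        (((coef (-1)).restrictScalars ℝ).contDiff.comp_contDiffOn (h.contDiffOn_gaugedLA j)))
  have hL : ContDiffOn ℝ ∞ (fun z => (Li ℂ *ᵥ residue (gaugedLA φ η z)) i) Ω := by
    simp only [Matrix.mulVec, dotProduct]
    exact ContDiffOn.sum fun j _ => contDiffOn_const.mul (hr j)
  have hw : ContDiffOn ℝ ∞ (fun z => wvec a b z i) Ω := by
    simp only [wvec, Pi.add_apply, Pi.smul_apply, smul_eq_mul]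
    exact (((h.a_differentiableOn.contDiffOn h.isOpen).restrict_scalars ℝ).mul
      contDiffOn_const).add
      (((h.b_differentiableOn.contDiffOn h.isOpen).restrict_scalars ℝ).mul contDiffOn_const)
  have hd : ContDiffOn ℝ ∞ (deriv φ) Ω :=
    ((h.phi_differentiableOn.deriv h.isOpen).contDiffOn h.isOpen).restrict_scalars ℝ
  simp only [frameVec, Pi.sub_apply, Pi.smul_apply, smul_eq_mul]
  exact hw.sub ((hd.div_const 4).mul hL)

theorem contDiffOn_halfBeta (h : WeierstrassData Ω z₀ φ a b η) (l : ℂ) :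
    ContDiffOn ℝ ∞ (halfBeta φ l) Ω :=
  ((h.contDiffOn_phi.div_const 4).mul contDiffOn_const).add
    (((Complex.conjCLE.contDiff.comp_contDiffOn h.contDiffOn_phi).div_const 4).mul
      contDiffOn_const)

theorem contDiffOn_transPart (h : WeierstrassData Ω z₀ φ a b η) (l : Circle) (i : Fin 4) :
    ContDiffOn ℝ ∞ (fun z => transPart φ η l z i) Ω := by
  refine contDiff_rotE_mulVec (h.contDiffOn_halfBeta l) (fun j => ?_) i
  have h1 : ContDiffOn ℝ ∞ (fun z => negPart l (gaugedLA φ η z j)) Ω :=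
    ((negPart l).restrictScalars ℝ).contDiff.comp_contDiffOn (h.contDiffOn_gaugedLA j)
  exact h1.add (Complex.conjCLE.contDiff.comp_contDiffOn h1)

theorem contDiffOn_translationPart (h : WeierstrassData Ω z₀ φ a b η) (l : Circle) :
    ContDiffOn ℝ ∞ (translationPart (frameLoop φ η) l) Ω :=
  contDiffOn_pi.2 fun i => Complex.reCLM.contDiff.comp_contDiffOn (h.contDiffOn_transPart l i)

end WeierstrassData

/-! ### Real parts of maps with given Wirtinger derivatives -/

theorem fderiv_re_of_hasWirt {f : ℂ → Vec ℂ} {p q : Vec ℂ} {z : ℂ} (h : HasWirt f p q z) (e : ℂ) :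
    fderiv ℝ (fun w i => (f w i).re) z e =
      fun i => (e * p i + starRingEnd ℂ e * q i).re := by
  have h1 : HasFDerivAt (fun w i => (f w i).re)
      (ContinuousLinearMap.pi fun i => Complex.reCLM ∘L wirt (p i) (q i)) z := by
    rw [hasFDerivAt_pi]
    exact fun i => Complex.reCLM.hasFDerivAt.comp z (hasWirt_pi.1 h i)
  rw [h1.fderiv]
  rfl

theorem dz_of_hasWirt {g : ℂ → ℝ} {p q z : ℂ} (h : HasWirt (fun w => (g w : ℂ)) p q z) :
    dz g z = p ∧ dzbar g z = q := by
  have h1 : HasFDerivAt g (Complex.reCLM ∘L wirt p q) z :=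
    Complex.reCLM.hasFDerivAt.comp z h
  have h2 : HasFDerivAt (fun w => (g w : ℂ)) (Complex.ofRealCLM ∘L fderiv ℝ g z) z :=
    Complex.ofRealCLM.hasFDerivAt.comp z h1.differentiableAt.hasFDerivAt
  have h3 := HasFDerivAt.unique h2 h
  have hx : (fderiv ℝ g z 1 : ℂ) = p + q := by
    have := DFunLike.congr_fun h3 1
    simpa [wirt_apply] using this
  have hy : (fderiv ℝ g z Complex.I : ℂ) = Complex.I * p - Complex.I * q := by
    have := DFunLike.congr_fun h3 Complex.I
    simpa [wirt_apply, sub_eq_add_neg] using this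
  rw [dz, dzbar, hx, hy]
  constructor
  · linear_combination (-1 / 2) * (p - q) * Complex.I_sq
  · linear_combination (1 / 2) * (p - q) * Complex.I_sq

/-- When the complex frame comes from a real pair `(F, X)`, cancelling its rotation on the left
reads off the Maurer-Cartan form. -/
theorem mcDz_eq {F : ℂ → Mat ℝ} {X : ℂ → Vec ℝ} {U : ℂ → Motion}
    (hF : ∀ z, (U z).rot = (F z).map Complex.ofReal)
    (hX : ∀ z i, (U z).trans i = X z i) {Ω : Set ℂ} {α' α'' : ℂ → LieElt}
    (hU : SolvesOn Ω U α' α'') {z : ℂ} (hz : z ∈ Ω) {B : Mat ℂ} (hB : B * (U z).rot = 1) :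
    mcDz F X z = α' z ∧ mcDzbar F X z = α'' z := by
  have h1 : ∀ i j, dz (fun w => F w i j) z = ((U z).rot * (α' z).1) i j ∧
      dzbar (fun w => F w i j) z = ((U z).rot * (α'' z).1) i j := by
    intro i j
    have h := hasWirt_iff.2 ((hU z hz).1 i j)
    simp only [hF, Matrix.map_apply] at h
    simpa only [hF] using dz_of_hasWirt h
  have h2 : ∀ i, dz (fun w => X w i) z = ((U z).rot *ᵥ (α' z).2) i ∧
      dzbar (fun w => X w i) z = ((U z).rot *ᵥ (α'' z).2) i := by
    intro i
    have h := hasWirt_iff.2 ((hU z hz).2 i)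
    simp only [hX] at h
    exact dz_of_hasWirt h
  have hinv : ((F z).map Complex.ofReal)⁻¹ = B := by
    rw [← hF]
    exact Matrix.inv_eq_left_inv hB
  have e : ∀ A : Mat ℂ, (Matrix.of fun i j => A i j) = A := fun A => rfl
  have e' : ∀ A : Vec ℂ, (fun i => A i) = A := fun A => rfl
  constructor
  · simp only [mcDz, h1, h2, hinv, e, e']
    rw [← mul_assoc, hB, one_mul, Matrix.mulVec_mulVec, hB, Matrix.one_mulVec]
  · simp only [mcDzbar, h1, h2, hinv, e, e']
    rw [← mul_assoc, hB, one_mul, Matrix.mulVec_mulVec, hB, Matrix.one_mulVec]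

/-! ### The grading on the forms that occur -/

theorem tauLie_iterate_fst {ξ : LieElt} {c : ℂ} (hξ : ξ.1 = c • Li ℂ) (m : ℕ) :
    (tauLie^[m] ξ).1 = ((-1) ^ m * c) • Li ℂ := by
  induction m with
  | zero => simp [hξ]
  | succ m ih =>
    have h : Lj ℂ * Li ℂ * Lj ℂ = Li ℂ := by
      rw [Lj_mul_Li, Matrix.neg_mul, Matrix.mul_assoc, Lj_mul_Lj, Matrix.mul_neg, neg_neg,
        Matrix.mul_one]
    rw [Function.iterate_succ_apply', tauLie, ih]
    simp only [Matrix.mul_smul, Matrix.smul_mul, h]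
    rw [pow_succ]
    module

theorem tauLie_iterate_snd {ξ : LieElt} {t : ℂ} (hξ : Lj ℂ *ᵥ ξ.2 = t • ξ.2) (m : ℕ) :
    (tauLie^[m] ξ).2 = (-t) ^ m • ξ.2 := by
  induction m with
  | zero => simp
  | succ m ih =>
    rw [Function.iterate_succ_apply', tauLie, ih]
    simp only [Matrix.mulVec_smul, hξ]
    rw [pow_succ]
    module

/-- On an eigenvector of `tauLie` the averaging projection is a geometric sum over fourth roots of
unity, equal to one when the eigenvalue is `i ^ k` and zero otherwise. Here the eigenvalue is `-1`,
so `L_i` has degree `2`. -/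
theorem proj_fst {ξ : LieElt} {c w : ℂ} (hξ : ξ.1 = c • Li ℂ) {k : ℤ} (hk : Complex.I ^ (-k) = w) :
    (proj k ξ).1 = ((1 / 4) * (1 - w + w ^ 2 - w ^ 3) * c) • Li ℂ := by
  simp only [proj, Finset.sum_range_succ, Finset.sum_range_zero, Prod.smul_fst, Prod.fst_add, Prod.fst_zero,
    tauLie_iterate_fst hξ, ← neg_mul, zpow_mul, hk, zpow_natCast]
  module

theorem proj_snd {ξ : LieElt} {t w : ℂ} (hξ : Lj ℂ *ᵥ ξ.2 = t • ξ.2) {k : ℤ}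
    (hk : Complex.I ^ (-k) = w) :
    (proj k ξ).2 = ((1 / 4) * (1 - t * w + (t * w) ^ 2 - (t * w) ^ 3)) • ξ.2 := by
  simp only [proj, Finset.sum_range_succ, Finset.sum_range_zero, Prod.smul_snd, Prod.snd_add, Prod.snd_zero,
    tauLie_iterate_snd hξ, ← neg_mul, zpow_mul, hk, zpow_natCast]
  module

theorem I_zpow_neg_two : Complex.I ^ (-2 : ℤ) = -1 := by
  rw [zpow_neg, zpow_ofNat, Complex.I_sq]
  norm_num

theorem I_zpow_neg_one : Complex.I ^ (-1 : ℤ) = -Complex.I := by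
  rw [zpow_neg_one, Complex.inv_I]

theorem I_zpow_neg_neg_one : Complex.I ^ (-(-1) : ℤ) = Complex.I := by
  rw [neg_neg, zpow_one]

theorem I_zpow_neg_zero : Complex.I ^ (-0 : ℤ) = 1 := by
  rw [neg_zero, zpow_zero]

theorem proj_fst_of_Li {ξ : LieElt} {c : ℂ} (hξ : ξ.1 = c • Li ℂ) :
    (proj 2 ξ).1 = ξ.1 ∧ (proj (-1) ξ).1 = 0 ∧ (proj 0 ξ).1 = 0 ∧ (proj 1 ξ).1 = 0 := by
  refine ⟨?_, ?_, ?_, ?_⟩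
  · rw [proj_fst hξ I_zpow_neg_two, hξ]
    congr 1
    ring
  · rw [proj_fst hξ I_zpow_neg_neg_one, ← zero_smul ℂ (Li ℂ)]
    congr 1
    linear_combination (1 / 4) * (1 - Complex.I) * c * Complex.I_sq
  · rw [proj_fst hξ I_zpow_neg_zero, ← zero_smul ℂ (Li ℂ)]
    congr 1
    ring
  · rw [proj_fst hξ I_zpow_neg_one, ← zero_smul ℂ (Li ℂ)]
    congr 1
    linear_combination (1 / 4) * (1 + Complex.I) * c * Complex.I_sq

theorem proj_snd_of_I {ξ : LieElt} (hξ : Lj ℂ *ᵥ ξ.2 = Complex.I • ξ.2) :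
    (proj 2 ξ).2 = 0 ∧ (proj (-1) ξ).2 = ξ.2 ∧ (proj 0 ξ).2 = 0 := by
  refine ⟨?_, ?_, ?_⟩
  · rw [proj_snd hξ I_zpow_neg_two, ← zero_smul ℂ ξ.2]
    congr 1
    linear_combination (1 / 4) * (1 + Complex.I) * Complex.I_sq
  · rw [proj_snd hξ I_zpow_neg_neg_one, Complex.I_mul_I]
    norm_num
  · rw [proj_snd hξ I_zpow_neg_zero, ← zero_smul ℂ ξ.2]
    congr 1
    linear_combination (1 / 4) * (1 - Complex.I) * Complex.I_sq

theorem proj_snd_of_neg_I {ξ : LieElt} (hξ : Lj ℂ *ᵥ ξ.2 = -Complex.I • ξ.2) :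
    (proj 2 ξ).2 = 0 ∧ (proj 1 ξ).2 = ξ.2 ∧ (proj 0 ξ).2 = 0 := by
  refine ⟨?_, ?_, ?_⟩
  · rw [proj_snd hξ I_zpow_neg_two, ← zero_smul ℂ ξ.2]
    congr 1
    linear_combination (1 / 4) * (1 - Complex.I) * Complex.I_sq
  · rw [proj_snd hξ I_zpow_neg_one, neg_mul_neg, Complex.I_mul_I]
    norm_num
  · rw [proj_snd hξ I_zpow_neg_zero, ← zero_smul ℂ ξ.2]
    congr 1
    linear_combination (1 / 4) * (1 + Complex.I) * Complex.I_sq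

end

end HamStat


namespace HamStat

noncomputable section

open Filter Topology

/-! ### Real frames -/

theorem re_map_mulVec (M : Mat ℝ) (y : Vec ℂ) (i : Fin 4) :
    ((M.map Complex.ofReal *ᵥ y) i).re = (M *ᵥ fun j => (y j).re) i := by
  simp [Matrix.mulVec, dotProduct, Fin.sum_univ_four]

theorem map_mulVec_ofReal (M : Mat ℝ) (y : Vec ℝ) (i : Fin 4) :
    (M.map Complex.ofReal *ᵥ fun j => (y j : ℂ)) i = ((M *ᵥ y) i : ℝ) := by
  simp [Matrix.mulVec, dotProduct, Fin.sum_univ_four]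

theorem conj_map_mulVec (M : Mat ℝ) (y : Vec ℂ) (i : Fin 4) :
    starRingEnd ℂ ((M.map Complex.ofReal *ᵥ y) i) =
      (M.map Complex.ofReal *ᵥ fun j => starRingEnd ℂ (y j)) i := by
  simp [Matrix.mulVec, dotProduct, Fin.sum_univ_four]

theorem Lj_mulVec_re (y : Vec ℂ) (i : Fin 4) :
    ((Lj ℂ *ᵥ y) i).re = (Lj ℝ *ᵥ fun j => (y j).re) i := by
  rw [Lj_mulVec, Lj_mulVec]
  fin_cases i <;> simp

theorem Li_mulVec_re (y : Vec ℂ) (i : Fin 4) :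
    ((Li ℂ *ᵥ y) i).re = (Li ℝ *ᵥ fun j => (y j).re) i := by
  rw [Li_mulVec, Li_mulVec]
  fin_cases i <;> simp

/-- The equation `L_j v = i v` expresses the imaginary part of `v` through its real part. -/
theorem eq_zero_of_re_eq_zero {v : Vec ℂ} (hv : Lj ℂ *ᵥ v = Complex.I • v)
    (h : ∀ i, (v i).re = 0) : v = 0 := by
  have him : ∀ i, (v i).im = 0 := by
    intro i
    have h1 : (Complex.I * v i).re = 0 := by
      have := congrFun hv i
      rw [Pi.smul_apply, smul_eq_mul] at this
      rw [← this, Lj_mulVec_re]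
      simp [h, Matrix.mulVec, dotProduct]
    simpa using h1
  funext i
  exact Complex.ext (h i) (him i)

theorem linGroup_dotProduct {F : Mat ℝ} (hF : F ∈ linGroup ℝ) (x y : Vec ℝ) :
    (F *ᵥ x) ⬝ᵥ (F *ᵥ y) = x ⬝ᵥ y := by
  rw [Matrix.dotProduct_mulVec, ← Matrix.mulVec_transpose, Matrix.mulVec_mulVec, hF.1,
    Matrix.one_mulVec]

theorem linGroup_omega {F : Mat ℝ} (hF : F ∈ linGroup ℝ) (x y : Vec ℝ) :
    omega (F *ᵥ x) (F *ᵥ y) = omega x y := by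
  rw [omega, Matrix.mulVec_mulVec, ← hF.2.2, ← Matrix.mulVec_mulVec, linGroup_dotProduct hF]
  rfl

/-- The rotation `e^{r L_i}`. -/
def rotR (r : ℝ) : Mat ℝ := rotCS (Real.cos r) (Real.sin r)

theorem rotR_mem_linGroup (r : ℝ) : rotR r ∈ linGroup ℝ :=
  rotCS_mem_linGroup (Real.cos_sq_add_sin_sq r)

theorem rotR_zero : rotR 0 = 1 := by simp [rotR, rotCS]

theorem rotE_eq_map {x : ℂ} (hx : x.im = 0) : rotE x = (rotR x.re).map Complex.ofReal := by
  rw [rotR, ← rotE_ofReal]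
  congr 1
  exact Complex.ext rfl hx

/-- The matrix `k⁰ - k¹ R_i - k² R_j - k³ R_k`. -/
def spinMat (k : Vec ℝ) : Mat ℝ := k 0 • (1 : Mat ℝ) - k 1 • Ri ℝ - k 2 • Rj ℝ - k 3 • Rk ℝ

theorem spinMat_mulVec_single_zero (k : Vec ℝ) :
    spinMat k *ᵥ Pi.single 0 1 = ![k 0, -k 1, -k 2, -k 3] := by
  rw [Matrix.mulVec_single_one]
  funext i
  fin_cases i <;> simp [spinMat, Ri, Rj, Rk]

/-- Right multiplications commute with `L_j`, and `ε₃ = L_j ε₁`. -/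
theorem spinMat_mulVec_single_two (k : Vec ℝ) :
    spinMat k *ᵥ Pi.single 2 1 = Lj ℝ *ᵥ (spinMat k *ᵥ Pi.single 0 1) := by
  rw [spinMat_mulVec_single_zero, Lj_mulVec, Matrix.mulVec_single_one]
  funext i
  fin_cases i <;> simp [spinMat, Ri, Rj, Rk]

/-- The Wirtinger coefficient of a map with `∂x = F v`, `∂y = F L_j v`. -/
theorem mcDz_snd {F : ℂ → Mat ℝ} {X : ℂ → Vec ℝ} {z : ℂ} (hX : DifferentiableAt ℝ X z)
    (hF : F z ∈ linGroup ℝ) {v : Vec ℝ} (hx : dx X z = F z *ᵥ v)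
    (hy : dy X z = F z *ᵥ (Lj ℝ *ᵥ v)) :
    (mcDz F X z).2 = (1 / 2 : ℂ) • ((fun i => (v i : ℂ)) -
      Complex.I • (Lj ℂ *ᵥ fun i => (v i : ℂ))) := by
  have h1 : (F z)ᵀ.map Complex.ofReal * (F z).map Complex.ofReal = 1 := by
    have := congrArg (fun M : Mat ℝ => M.map Complex.ofRealHom) hF.1
    simp only [Matrix.map_mul, Matrix.map_one _ (map_zero _) (map_one _)] at this
    exact this
  have hd : ∀ i e, fderiv ℝ (fun w => X w i) z e = fderiv ℝ X z e i := fun i e => by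
    rw [(hasFDerivAt_pi'.1 hX.hasFDerivAt i).fderiv]
    rfl
  have hL : (Lj ℂ *ᵥ fun i => (v i : ℂ)) = fun i => (((Lj ℝ *ᵥ v) i : ℝ) : ℂ) := by
    funext i
    rw [Lj_mulVec, Lj_mulVec]
    fin_cases i <;> simp
  have e : (fun i => dz (fun w => X w i) z) = (F z).map Complex.ofReal *ᵥ
      ((1 / 2 : ℂ) • ((fun i => (v i : ℂ)) - Complex.I • (Lj ℂ *ᵥ fun i => (v i : ℂ)))) := by
    rw [hL, Matrix.mulVec_smul, Matrix.mulVec_sub, Matrix.mulVec_smul]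
    funext i
    rw [Pi.smul_apply, Pi.sub_apply, Pi.smul_apply, map_mulVec_ofReal, map_mulVec_ofReal, ← hx,
      ← hy, dz, hd, hd]
    rfl
  rw [mcDz]
  dsimp only
  rw [e, Matrix.inv_eq_left_inv h1, Matrix.mulVec_mulVec, h1, Matrix.one_mulVec]

/-! ### Geometry of the translation component -/

namespace WeierstrassData

variable {Ω : Set ℂ} {z₀ : ℂ} {φ a b : ℂ → ℂ} {η : ℂ → Vec LA}

theorem frameLoop_solvesOn (h : WeierstrassData Ω z₀ φ a b η) (l : Circle) :
    SolvesOn Ω (fun z => frameLoop φ η z l)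
      (fun z => ((deriv φ z / 4 * (l : ℂ) ^ (-2 : ℤ)) • Li ℂ, (l : ℂ)⁻¹ • frameVec φ a b η z))
      (fun z => ((starRingEnd ℂ (deriv φ z) / 4 * (l : ℂ) ^ (2 : ℤ)) • Li ℂ,
        (l : ℂ) • fun i => starRingEnd ℂ (frameVec φ a b η z i))) := by
  intro z hz
  have hφ := h.phi_differentiableAt hz
  refine ⟨fun i j => hasWirt_iff.1 ((hasWirt_halfBeta hφ l).rotE_apply i j), fun i => ?_⟩
  exact hasWirt_iff.1 (hasWirt_pi.1 (hasWirt_transPart l hφ (h.eta_hasDerivAt z hz)) i)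

theorem frameLoop_zero (h : WeierstrassData Ω z₀ φ a b η) (l : Circle) :
    frameLoop φ η z₀ l = 1 := by
  have hb : halfBeta φ l z₀ = 0 := by simp [halfBeta, h.phi_zero]
  have hg : gaugedLA φ η z₀ = 0 := by
    rw [gaugedLA, h.eta_zero]
    exact Matrix.mulVec_zero _
  refine Motion.ext ?_ ?_
  · change rotE (halfBeta φ l z₀) = 1
    rw [hb, rotE_zero]
  · change rotE _ *ᵥ realProj l (gaugedLA φ η z₀) = 0
    have : realProj l (0 : Vec LA) = 0 := by
      funext i
      simp [realProj]
    rw [hg, this, Matrix.mulVec_zero]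

/-- The rotation is real, so the `dz̄` coefficient is the conjugate of the `dz` one and the
differential is twice a real part. -/
theorem fderiv_translationPart (h : WeierstrassData Ω z₀ φ a b η) (l : Circle) {z : ℂ}
    (hz : z ∈ Ω) (e : ℂ) :
    fderiv ℝ (translationPart (frameLoop φ η) l) z e =
      rotR (halfBeta φ l z).re *ᵥ
        (2 : ℝ) • fun i => (e * ((l : ℂ)⁻¹ * frameVec φ a b η z i)).re := by
  have hw := hasWirt_transPart l (h.phi_differentiableAt hz) (h.eta_hasDerivAt z hz)
  have hl : starRingEnd ℂ (l : ℂ)⁻¹ = l := by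
    rw [map_inv₀, ← Circle.coe_inv_eq_conj, Circle.coe_inv, inv_inv]
  refine (fderiv_re_of_hasWirt hw e).trans (funext fun i => ?_)
  have hq : (rotE (halfBeta φ l z) *ᵥ ((l : ℂ) • fun i => starRingEnd ℂ (frameVec φ a b η z i))) i =
      starRingEnd ℂ ((rotE (halfBeta φ l z) *ᵥ ((l : ℂ)⁻¹ • frameVec φ a b η z)) i) := by
    rw [rotE_eq_map (halfBeta_im l), conj_map_mulVec]
    congr 2
    funext j
    simp only [Pi.smul_apply, smul_eq_mul, map_mul, hl]
  rw [hq, ← map_mul, Complex.add_conj, Complex.ofReal_re, ← smul_eq_mul e, ← Pi.smul_apply,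
    ← Matrix.mulVec_smul, rotE_eq_map (halfBeta_im l), re_map_mulVec, Matrix.mulVec_smul]
  rfl

/-- A tangent vector `e` in the kernel makes the real part of `e λ⁻¹ Y` vanish; that vector is in
the `i`-eigenspace of `L_j`, hence is zero. The resulting criterion does not involve `λ`. -/
theorem injective_fderiv_translationPart (h : WeierstrassData Ω z₀ φ a b η) (l : Circle) {z : ℂ}
    (hz : z ∈ Ω) : Function.Injective (fderiv ℝ (translationPart (frameLoop φ η) l) z) ↔
      frameVec φ a b η z ≠ 0 := by
  constructor
  · intro hinj h0
    refine one_ne_zero (α := ℂ) (hinj ?_)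
    rw [h.fderiv_translationPart l hz, h.fderiv_translationPart l hz, h0]
    simp
  · intro h0
    rw [injective_iff_map_eq_zero]
    intro e he
    rw [h.fderiv_translationPart l hz] at he
    have h1 := congrArg (fun y => (rotR (halfBeta φ l z).re)ᵀ *ᵥ y) he
    simp only [Matrix.mulVec_mulVec, (rotR_mem_linGroup _).1, Matrix.one_mulVec,
      Matrix.mulVec_zero] at h1
    have h2 : (e * (l : ℂ)⁻¹) • frameVec φ a b η z = 0 := by
      refine eq_zero_of_re_eq_zero ?_ fun i => ?_
      · rw [Matrix.mulVec_smul, h.Lj_mulVec_frameVec hz, smul_comm]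
      · have h3 := congrFun h1 i
        rw [Pi.smul_apply, smul_eq_mul] at h3
        rw [Pi.smul_apply, smul_eq_mul, mul_assoc]
        simpa using h3
    have h3 := (smul_eq_zero.1 h2).resolve_right h0
    exact (mul_eq_zero.1 h3).resolve_right (inv_ne_zero (Circle.coe_ne_zero l))

theorem isImmersion_translationPart (h : WeierstrassData Ω z₀ φ a b η) (l : Circle) :
    IsImmersion Ω (translationPart (frameLoop φ η) l) ↔ ∀ z ∈ Ω, frameVec φ a b η z ≠ 0 :=
  ⟨fun hX z hz => (h.injective_fderiv_translationPart l hz).1 (hX.2 z hz), fun hY =>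
    ⟨h.contDiffOn_translationPart l, fun z hz =>
      (h.injective_fderiv_translationPart l hz).2 (hY z hz)⟩⟩

/-- The immersion `X` is not assumed to be a component of the loop, so it is tied to `frameVec`
through the equation at `λ = 1` alone. The lift condition puts the translation part of its
Maurer-Cartan form in degree `-1`, so the extended form at `λ = 1` does not alter it. -/
theorem frameVec_ne_zero (h : WeierstrassData Ω z₀ φ a b η) {X : ℂ → Vec ℝ}
    (hU : IsExtendedLiftOf Ω z₀ (frameLoop φ η) X) {z : ℂ} (hz : z ∈ Ω) :
    frameVec φ a b η z ≠ 0 := by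
  obtain ⟨hX, -, -, F, ⟨-, hXs, hF, -, -, K, f, -, -, hK⟩, hU⟩ := hU
  obtain ⟨⟨k, -, hk⟩, hx, hy⟩ := hK z hz
  replace hk : K z = spinMat k := hk
  set v : Vec ℝ := Real.exp (f z) • (spinMat k *ᵥ Pi.single 0 1) with hv
  have hx' : dx X z = F z *ᵥ v := by
    rw [hx, hk, hv, Matrix.mulVec_smul, Matrix.mulVec_mulVec]
  have hy' : dy X z = F z *ᵥ (Lj ℝ *ᵥ v) := by
    rw [hy, hk, hv, Matrix.mulVec_smul, Matrix.mulVec_smul, ← spinMat_mulVec_single_two,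
      Matrix.mulVec_mulVec]
  have hXd : DifferentiableAt ℝ X z :=
    (hXs.contDiffAt (h.isOpen.mem_nhds hz)).differentiableAt (by simp)
  have hN := mcDz_snd hXd (hF z hz) hx' hy'
  have hLN : Lj ℂ *ᵥ (mcDz F X z).2 = Complex.I • (mcDz F X z).2 := by
    rw [hN, Matrix.mulVec_smul, Matrix.mulVec_sub, Matrix.mulVec_smul, Lj_mulVec_Lj_mulVec,
      smul_neg, sub_neg_eq_add, smul_comm Complex.I, smul_sub Complex.I, smul_smul Complex.I,
      Complex.I_mul_I]
    module
  obtain ⟨h2, h1, h0⟩ := proj_snd_of_I hLN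
  -- The same translation component satisfies two equations, from the lift and from the explicit
  -- frame; `dz` coefficients are unique.
  have hsol := hasWirt_pi.2 fun i => hasWirt_iff.2 (((hU 1).2 z hz).2 i)
  have hA := (hsol.unique (hasWirt_pi.2 fun i => hasWirt_iff.2
    (((h.frameLoop_solvesOn 1) z hz).2 i))).1
  have hext : (extDz F X (1 : Circle) z).2 = (mcDz F X z).2 := by
    simp only [extDz, Prod.snd_add, Prod.smul_snd, h2, h1, h0, Circle.coe_one, inv_one, one_smul,
      smul_zero, zero_add, add_zero]
  have hY : (mcDz F X z).2 = frameVec φ a b η z := by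
    have hA' := congrArg (fun y => rotE (-halfBeta φ (1 : Circle) z) *ᵥ y) hA
    have hr : rotE (-halfBeta φ (1 : Circle) z) * (frameLoop φ η z 1).rot = 1 :=
      rotE_neg_mul_rotE _
    simp only [Matrix.mulVec_mulVec, hr, Matrix.one_mulVec] at hA'
    rw [← hext]
    refine hA'.trans ?_
    simp
  rw [← hY, hN]
  intro hzero
  have hv0 : v = 0 := by
    funext i
    have h3 := (smul_eq_zero.1 hzero).resolve_left (by norm_num)
    have h4 : (fun i => (v i : ℂ)) = Complex.I • (Lj ℂ *ᵥ fun i => (v i : ℂ)) := sub_eq_zero.1 h3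
    have h5 := congrArg Complex.re (congrFun h4 i)
    rw [Complex.ofReal_re, Lj_mulVec] at h5
    rw [h5]
    fin_cases i <;> simp
  refine one_ne_zero (α := ℂ) (hX.immersion.2 z hz ?_)
  rw [map_zero]
  change dx X z = 0
  rw [hx', hv0, Matrix.mulVec_zero]

/-- The vector `F⁻¹ ∂X/∂x` of the representation at `λ = 1`. -/
def realFrame (φ a b : ℂ → ℂ) (η : ℂ → Vec LA) (z : ℂ) : Vec ℝ :=
  (2 : ℝ) • fun i => (frameVec φ a b η z i).re

theorem halfBeta_one_re (φ : ℂ → ℂ) (z : ℂ) : (halfBeta φ (1 : Circle) z).re = (φ z).re / 2 := by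
  simp [halfBeta]
  ring

theorem dx_translationPart (h : WeierstrassData Ω z₀ φ a b η) {z : ℂ} (hz : z ∈ Ω) :
    dx (translationPart (frameLoop φ η) 1) z = rotR ((φ z).re / 2) *ᵥ realFrame φ a b η z := by
  rw [dx, h.fderiv_translationPart 1 hz, halfBeta_one_re]
  simp [realFrame]

theorem dy_translationPart (h : WeierstrassData Ω z₀ φ a b η) {z : ℂ} (hz : z ∈ Ω) :
    dy (translationPart (frameLoop φ η) 1) z =
      rotR ((φ z).re / 2) *ᵥ (Lj ℝ *ᵥ realFrame φ a b η z) := by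
  rw [dy, h.fderiv_translationPart 1 hz, halfBeta_one_re, realFrame, Matrix.mulVec_smul,
    Matrix.mulVec_smul]
  have e : (fun i => (Complex.I * (((1 : Circle) : ℂ)⁻¹ * frameVec φ a b η z i)).re) =
      Lj ℝ *ᵥ fun i => (frameVec φ a b η z i).re := by
    funext i
    rw [← Lj_mulVec_re, h.Lj_mulVec_frameVec hz]
    simp
  rw [e, Matrix.mulVec_smul]

theorem isConformalLagrangianImmersion_translationPart (h : WeierstrassData Ω z₀ φ a b η)
    (hY : ∀ z ∈ Ω, frameVec φ a b η z ≠ 0) :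
    IsConformalLagrangianImmersion Ω (translationPart (frameLoop φ η) 1) where
  immersion := (h.isImmersion_translationPart 1).2 hY
  conformal z hz := by
    rw [h.dx_translationPart hz, h.dy_translationPart hz,
      linGroup_dotProduct (rotR_mem_linGroup _), linGroup_dotProduct (rotR_mem_linGroup _),
      linGroup_dotProduct (rotR_mem_linGroup _), Lj_mulVec]
    constructor <;>
    · simp [dotProduct, Fin.sum_univ_four]
      ring
  lagrangian z hz := by
    rw [h.dx_translationPart hz, h.dy_translationPart hz, linGroup_omega (rotR_mem_linGroup _),
      omega, Lj_mulVec, Li_mulVec]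
    simp [dotProduct, Fin.sum_univ_four]
    ring

/-- With `A = F Y` the `dz` coefficient of `X`, `∂A/∂z̄ = L_i (φ̄' A + φ' Ā) / 4`. Since `X_x = 2 Re
A`, `X_y = 2 Re (i A)` and `φ' = β_x - i β_y`, four times its real part is `L_i (β_x X_x + β_y
X_y)`. -/
theorem isHamiltonianStationary_translationPart (h : WeierstrassData Ω z₀ φ a b η)
    (hY : ∀ z ∈ Ω, frameVec φ a b η z ≠ 0) :
    IsHamiltonianStationary Ω (translationPart (frameLoop φ η) 1) := by
  refine isHamiltonianStationary_of_laplacian h.isOpen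
    (h.isConformalLagrangianImmersion_translationPart hY) (β := fun z => (φ z).re)
    (Complex.reCLM.contDiff.comp_contDiffOn h.contDiffOn_phi)
    (fun z hz => laplacian_re_eq_zero h.isOpen h.phi_differentiableOn hz) fun z hz => ?_
  have hφ := h.phi_differentiableAt hz
  have hmem := h.isOpen.mem_nhds hz
  let A : ℂ → Vec ℂ := fun w => rotE (halfBeta φ (1 : Circle) w) *ᵥ frameVec φ a b η w
  have hfd : ∀ e, ∀ w ∈ Ω, fderiv ℝ (translationPart (frameLoop φ η) 1) w e =
      fun i => (((2 * e) • A w) i).re := by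
    intro e w hw
    rw [h.fderiv_translationPart 1 hw]
    funext i
    simp only [A]
    rw [← Matrix.mulVec_smul, rotE_eq_map (halfBeta_im 1), re_map_mulVec]
    congr 2
    funext j
    simp [mul_assoc]
  obtain ⟨p, hp⟩ := hasWirt_frameVec hφ
    ((h.phi_differentiableOn.deriv h.isOpen).differentiableAt hmem)
    (h.a_differentiableOn.differentiableAt hmem) (h.b_differentiableOn.differentiableAt hmem)
    (h.eta_hasDerivAt z hz)
  have hA := (hasWirt_halfBeta hφ 1).rotE_mulVec hp
  have hfd2 : ∀ e e' : ℂ, fderiv ℝ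
      (fun w => fderiv ℝ (translationPart (frameLoop φ η) 1) w e) z e' = fun i =>
      (2 * e * (e' * (rotE (halfBeta φ (1 : Circle) z) *ᵥ
        ((deriv φ z / 4 * ((1 : Circle) : ℂ) ^ (-2 : ℤ)) •
          (Li ℂ *ᵥ frameVec φ a b η z) + p)) i +
        starRingEnd ℂ e' * (rotE (halfBeta φ (1 : Circle) z) *ᵥ
        ((starRingEnd ℂ (deriv φ z) / 4 * ((1 : Circle) : ℂ) ^ (2 : ℤ)) •
          (Li ℂ *ᵥ frameVec φ a b η z) + (deriv φ z / 4) •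
            (Li ℂ *ᵥ fun i => starRingEnd ℂ (frameVec φ a b η z i)))) i)).re := by
    intro e e'
    have he : (fun w => fderiv ℝ (translationPart (frameLoop φ η) 1) w e) =ᶠ[𝓝 z]
        fun w i => (((2 * e) • A w) i).re := by
      filter_upwards [hmem] with w hw
      exact hfd e w hw
    rw [he.fderiv_eq]
    refine (fderiv_re_of_hasWirt (hA.clm ((2 * e) • ContinuousLinearMap.id ℂ (Vec ℂ))) e').trans ?_
    funext i
    simp only [smul_apply, ContinuousLinearMap.id_apply, Pi.smul_apply, smul_eq_mul]
    congr 1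
    ring
  have h1 := hfd2 1 1
  have h2 := hfd2 Complex.I Complex.I
  change fderiv ℝ (dx _) z 1 = _ at h1
  change fderiv ℝ (dy _) z Complex.I = _ at h2
  have hx : dx (translationPart (frameLoop φ η) 1) z = _ := hfd 1 z hz
  have hy : dy (translationPart (frameLoop φ η) 1) z = _ := hfd Complex.I z hz
  have hq : rotE (halfBeta φ (1 : Circle) z) *ᵥ
        ((starRingEnd ℂ (deriv φ z) / 4 * ((1 : Circle) : ℂ) ^ (2 : ℤ)) •
          (Li ℂ *ᵥ frameVec φ a b η z) + (deriv φ z / 4) •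
            (Li ℂ *ᵥ fun i => starRingEnd ℂ (frameVec φ a b η z i))) =
      Li ℂ *ᵥ fun i => starRingEnd ℂ (deriv φ z) / 4 * A z i +
        deriv φ z / 4 * starRingEnd ℂ (A z i) := by
    have hc : (fun i => starRingEnd ℂ (A z i)) = rotE (halfBeta φ (1 : Circle) z) *ᵥ
        fun i => starRingEnd ℂ (frameVec φ a b η z i) := by
      funext i
      simp only [A]
      rw [rotE_eq_map (halfBeta_im 1), conj_map_mulVec]
    rw [← Matrix.mulVec_smul, ← Matrix.mulVec_smul, ← Matrix.mulVec_add, rotE_mulVec_Li,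
      Matrix.mulVec_add, Matrix.mulVec_smul, Matrix.mulVec_smul, ← hc]
    simp only [Circle.coe_one, one_zpow, mul_one]
    rfl
  rw [h1, h2, hx, hy, hq, fderiv_re_apply hφ.hasDerivAt, fderiv_re_apply hφ.hasDerivAt]
  funext i
  have hR : ∀ y : Vec ℝ, (Li ℝ *ᵥ y) i = ((Li ℂ *ᵥ fun j => (y j : ℂ)) i).re := by
    intro y
    rw [Li_mulVec_re]
    rfl
  generalize rotE (halfBeta φ (1 : Circle) z) *ᵥ _ = P
  -- Adding the second derivatives along `1` and `i` cancels the unspecified `dz` coefficient and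
  -- keeps only the `dz̄` one.
  have e1 : ∀ x y : ℂ, (2 * 1 * (1 * x + starRingEnd ℂ 1 * y)).re +
      (2 * Complex.I * (Complex.I * x + starRingEnd ℂ Complex.I * y)).re = 4 * y.re := by
    intro x y
    simp
    ring
  rw [Pi.add_apply, e1, Li_mulVec_re, ← smul_eq_mul, ← Pi.smul_apply, ← Matrix.mulVec_smul]
  congr 2
  funext j
  simp
  ring

/-- The vector `u = F⁻¹ X_x` is a nonzero quaternion, and its polar decomposition supplies `e^f =
|u|` and `K`. -/
theorem isLCLI_translationPart (h : WeierstrassData Ω z₀ φ a b η)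
    (hY : ∀ z ∈ Ω, frameVec φ a b η z ≠ 0) :
    IsLCLI Ω z₀ (fun z => rotR ((φ z).re / 2)) (translationPart (frameLoop φ η) 1) := by
  have hre : ContDiffOn ℝ ∞ (fun z => (φ z).re / 2) Ω :=
    (Complex.reCLM.contDiff.comp_contDiffOn h.contDiffOn_phi).div_const 2
  have hu : ∀ i, ContDiffOn ℝ ∞ (fun z => realFrame φ a b η z i) Ω := fun i =>
    (Complex.reCLM.contDiff.comp_contDiffOn (h.contDiffOn_frameVec i)).const_smul (2 : ℝ)
  let n : ℂ → ℝ := fun z => ∑ i, realFrame φ a b η z i ^ 2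
  have hn : ContDiffOn ℝ ∞ n Ω := ContDiffOn.sum fun i _ => (hu i).pow 2
  have hpos : ∀ z ∈ Ω, 0 < n z := by
    intro z hz
    refine (Finset.sum_nonneg fun i _ => sq_nonneg _).lt_of_ne' fun h0 => hY z hz ?_
    rw [Finset.sum_eq_zero_iff_of_nonneg fun i _ => sq_nonneg _] at h0
    refine eq_zero_of_re_eq_zero (h.Lj_mulVec_frameVec hz) fun i => ?_
    simpa [realFrame] using h0 i (Finset.mem_univ i)
  let f : ℂ → ℝ := fun z => Real.log (n z) / 2
  have hf : ContDiffOn ℝ ∞ f Ω := (hn.log fun z hz => (hpos z hz).ne').div_const 2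
  -- The minus signs reflect that `K ε₁` is the conjugate of the quaternion `k`.
  let k : ℂ → Vec ℝ := fun z => Real.exp (-f z) •
    ![realFrame φ a b η z 0, -realFrame φ a b η z 1, -realFrame φ a b η z 2,
      -realFrame φ a b η z 3]
  have hk : ∀ i, ContDiffOn ℝ ∞ (fun z => k z i) Ω := by
    intro i
    have he : ContDiffOn ℝ ∞ (fun z => Real.exp (-f z)) Ω := hf.neg.exp
    fin_cases i
    · exact he.mul (hu 0)
    · exact he.mul (hu 1).neg
    · exact he.mul (hu 2).neg
    · exact he.mul (hu 3).neg
  have hcol : ∀ z, Real.exp (f z) • (spinMat (k z) *ᵥ Pi.single 0 1) = realFrame φ a b η z := by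
    intro z
    have he : ∀ x : ℝ, Real.exp (f z) * (Real.exp (-f z) * x) = x := fun x => by
      rw [← mul_assoc, ← Real.exp_add, add_neg_cancel, Real.exp_zero, one_mul]
    rw [spinMat_mulVec_single_zero]
    funext i
    fin_cases i <;> simp [k, he]
  refine ⟨fun i j => ?_, h.contDiffOn_translationPart 1, fun z _ => rotR_mem_linGroup _, ?_, ?_,
    fun z => spinMat (k z), f, fun i j => ?_, hf, fun z hz => ⟨⟨k z, ?_, rfl⟩, ?_, ?_⟩⟩
  · simp only [rotR, rotCS, Matrix.add_apply, Matrix.smul_apply, smul_eq_mul]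
    exact ((Real.contDiff_cos.comp_contDiffOn hre).mul contDiffOn_const).add
      ((Real.contDiff_sin.comp_contDiffOn hre).mul contDiffOn_const)
  · simp only [h.phi_zero, Complex.zero_re, zero_div, rotR_zero]
  · funext i
    simp only [translationPart, h.frameLoop_zero]
    rfl
  · simp only [spinMat, Matrix.sub_apply, Matrix.smul_apply, smul_eq_mul]
    exact ((((hk 0).mul contDiffOn_const).sub ((hk 1).mul contDiffOn_const)).sub
      ((hk 2).mul contDiffOn_const)).sub ((hk 3).mul contDiffOn_const)
  · have he : Real.exp (-f z) ^ 2 * n z = 1 := by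
      rw [← Real.exp_nat_mul]
      simp only [f]
      rw [Nat.cast_ofNat, mul_neg, mul_div_cancel₀ _ two_ne_zero, Real.exp_neg,
        Real.exp_log (hpos z hz), inv_mul_cancel₀ (hpos z hz).ne']
    rw [← he]
    simp only [n, Fin.sum_univ_four, k]
    simp
    ring
  · rw [h.dx_translationPart hz, ← hcol, Matrix.mulVec_smul, Matrix.mulVec_mulVec]
  · rw [h.dy_translationPart hz, ← hcol, Matrix.mulVec_smul, Matrix.mulVec_smul,
      ← spinMat_mulVec_single_two, Matrix.mulVec_mulVec]

/-- At `λ = 1` the form has an `L_i` part of degree `2` and translation parts of degree `-1` (`dz`)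
and `1` (`dz̄`). Restoring the power of `λ` attached to each degree reproduces the equation of the
explicit frame. -/
theorem isExtendedLiftOf_translationPart (h : WeierstrassData Ω z₀ φ a b η)
    (hY : ∀ z ∈ Ω, frameVec φ a b η z ≠ 0) :
    IsExtendedLiftOf Ω z₀ (frameLoop φ η) (translationPart (frameLoop φ η) 1) := by
  refine ⟨h.isConformalLagrangianImmersion_translationPart hY,
    h.isHamiltonianStationary_translationPart hY, fun z hz => frameLoop_mem (h.twistedVec_eta hz),
    _, h.isLCLI_translationPart hY, fun l => ⟨h.frameLoop_zero l, fun z hz => ?_⟩⟩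
  have hmc := mcDz_eq (F := fun z => rotR ((φ z).re / 2))
    (X := translationPart (frameLoop φ η) 1) (U := fun z => frameLoop φ η z 1)
    (fun z => by
      rw [← halfBeta_one_re]
      exact rotE_eq_map (halfBeta_im 1))
    (fun z i => Complex.ext rfl (transPart_im 1 i)) (h.frameLoop_solvesOn 1) hz
    (rotE_neg_mul_rotE (halfBeta φ (1 : Circle) z))
  have hLj := h.Lj_mulVec_frameVec hz
  simp only [Circle.coe_one, one_zpow, inv_one, one_smul, mul_one] at hmc
  have hLjc : Lj ℂ *ᵥ (fun i => starRingEnd ℂ (frameVec φ a b η z i)) =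
      -Complex.I • fun i => starRingEnd ℂ (frameVec φ a b η z i) := by
    funext i
    rw [← conj_Lj_mulVec, hLj]
    simp
  obtain ⟨p1, p2, p3, -⟩ := proj_fst_of_Li (ξ := mcDz _ _ z) (by rw [hmc.1])
  obtain ⟨q1, q2, q3⟩ := proj_snd_of_I (ξ := mcDz _ _ z) (by rw [hmc.1]; exact hLj)
  obtain ⟨r1, -, r3, r4⟩ := proj_fst_of_Li (ξ := mcDzbar _ _ z) (by rw [hmc.2])
  obtain ⟨s1, s2, s3⟩ := proj_snd_of_neg_I (ξ := mcDzbar _ _ z) (by rw [hmc.2]; exact hLjc)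
  have e' : extDz (fun z => rotR ((φ z).re / 2)) (translationPart (frameLoop φ η) 1) l z =
      ((deriv φ z / 4 * (l : ℂ) ^ (-2 : ℤ)) • Li ℂ, (l : ℂ)⁻¹ • frameVec φ a b η z) := by
    refine Prod.ext ?_ ?_
    · simp only [extDz, Prod.fst_add, Prod.smul_fst, p1, p2, p3]
      rw [hmc.1]
      module
    · simp only [extDz, Prod.snd_add, Prod.smul_snd, q1, q2, q3]
      rw [hmc.1]
      module
  have e'' : extDzbar (fun z => rotR ((φ z).re / 2)) (translationPart (frameLoop φ η) 1) l z =
      ((starRingEnd ℂ (deriv φ z) / 4 * (l : ℂ) ^ (2 : ℤ)) • Li ℂ,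
        (l : ℂ) • fun i => starRingEnd ℂ (frameVec φ a b η z i)) := by
    rw [zpow_ofNat]
    refine Prod.ext ?_ ?_
    · simp only [extDzbar, Prod.fst_add, Prod.smul_fst, r1, r3, r4]
      rw [hmc.2]
      module
    · simp only [extDzbar, Prod.snd_add, Prod.smul_snd, s1, s2, s3]
      rw [hmc.2]
      module
  rw [e', e'']
  exact h.frameLoop_solvesOn l z hz

end WeierstrassData

/-! ### Dependence on the values on the domain -/

theorem isImmersion_congr {Ω : Set ℂ} (hΩ : IsOpen Ω) {X X' : ℂ → Vec ℝ} (h : Set.EqOn X X' Ω)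
    (hX : IsImmersion Ω X) : IsImmersion Ω X' := by
  refine ⟨hX.1.congr fun z hz => (h hz).symm, fun z hz => ?_⟩
  rw [← (h.eventuallyEq_of_mem (hΩ.mem_nhds hz)).fderiv_eq]
  exact hX.2 z hz

theorem isExtendedLiftOf_congr {Ω : Set ℂ} (hΩ : IsOpen Ω) {z₀ : ℂ} (hz₀ : z₀ ∈ Ω)
    {U U' : ℂ → Loop} (h : Set.EqOn U U' Ω) {X : ℂ → Vec ℝ} (hU : IsExtendedLiftOf Ω z₀ U X) :
    IsExtendedLiftOf Ω z₀ U' X := by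
  obtain ⟨h1, h2, h3, F, h4, h5⟩ := hU
  refine ⟨h1, h2, fun z hz => h hz ▸ h3 z hz, F, h4, fun l => ⟨h hz₀ ▸ (h5 l).1, fun z hz => ?_⟩⟩
  have he := h.eventuallyEq_of_mem (hΩ.mem_nhds hz)
  have hz' : U' z l = U z l := by rw [h hz]
  simp only [hz']
  refine ⟨fun i j => (((h5 l).2 z hz).1 i j).congr_of_eventuallyEq ?_,
    fun i => (((h5 l).2 z hz).2 i).congr_of_eventuallyEq ?_⟩
  · filter_upwards [he] with w hw
    rw [hw]
  · filter_upwards [he] with w hw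
    rw [hw]

end

end HamStat

/-! ### Assembly of the theorem -/

theorem mainTheorem8 (Ω : Set ℂ) (hΩo : IsOpen Ω) (hΩ : IsSimplyConnected Ω)
    (z₀ : ℂ) (hz₀ : z₀ ∈ Ω)
    (β : ℂ → ℝ) (hβ : InnerProductSpace.HarmonicOnNhd β Ω) (hβ₀ : β z₀ = 0)
    (a b : ℂ → ℂ) (ha : DifferentiableOn ℂ a Ω) (hb : DifferentiableOn ℂ b Ω) :
    (∃ γ : ℂ → ℝ, IsHarmonicConjugate Ω z₀ β γ) ∧
    (∃ H : ℂ → Loop, IntegratesPotential Ω z₀ β a b H) ∧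
    ∀ γ : ℂ → ℝ, IsHarmonicConjugate Ω z₀ β γ →
      (∀ z ∈ Ω, weierstrassMap Ω z₀ β γ a b z ∈ LoopG) ∧
      (∀ H : ℂ → Loop, IntegratesPotential Ω z₀ β a b H → ∀ z ∈ Ω,
        (∃ V ∈ LoopPlus, H z = weierstrassMap Ω z₀ β γ a b z * V) ∧
        ∀ U' ∈ LoopG, ∀ V' ∈ LoopPlus, H z = U' * V' → U' = weierstrassMap Ω z₀ β γ a b z) ∧
      ∀ l : Circle,
        (∃ X : ℂ → Vec ℝ, IsExtendedLiftOf Ω z₀ (weierstrassMap Ω z₀ β γ a b) X) ↔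
          IsImmersion Ω (translationPart (weierstrassMap Ω z₀ β γ a b) l) := by
  have hdata : ∀ γ : ℂ → ℝ, IsHarmonicConjugate Ω z₀ β γ →
      ∃ η, WeierstrassData Ω z₀ (fun z => (β z : ℂ) + Complex.I * (γ z : ℂ)) a b η := fun γ hγ =>
    exists_weierstrassData hΩo hΩ hz₀ hγ.1 (by simp [hβ₀, hγ.2]) ha hb
  have hre : ∀ (γ : ℂ → ℝ) (z : ℂ), ((β z : ℂ) + Complex.I * (γ z : ℂ)).re = β z := by simp
  obtain ⟨γ₀, hγ₀⟩ := exists_isHarmonicConjugate hΩo hΩ hz₀ hβ hβ₀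
  obtain ⟨η₀, h₀⟩ := hdata γ₀ hγ₀
  refine ⟨⟨γ₀, hγ₀⟩, ⟨_, h₀.holLoop_integratesPotential (hre γ₀)⟩, fun γ hγ => ?_⟩
  obtain ⟨η, h⟩ := hdata γ hγ
  -- The Weierstrass map is only controlled on `Ω`, so every claim is transferred to the explicit
  -- frame through equality there.
  have hU : Set.EqOn (weierstrassMap Ω z₀ β γ a b) (frameLoop _ η) Ω := fun z hz =>
    h.weierstrassMap_eq (fun _ => rfl) hz
  refine ⟨fun z hz => ?_, fun H hH z hz => ?_, fun l => ?_⟩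
  · rw [hU hz]
    exact frameLoop_mem (h.twistedVec_eta hz)
  · have htw := h.twistedVec_eta hz
    rw [hU hz, h.eq_holLoop (hre γ) hH hz]
    exact ⟨⟨_, plusLoop_mem htw, holLoop_eq⟩, fun U' hU' V' hV' he =>
      left_factor_unique (frameLoop_mem htw) hU' (plusLoop_mem htw) hV' (holLoop_eq.symm.trans he)⟩
  · have hX : Set.EqOn (translationPart (weierstrassMap Ω z₀ β γ a b) l)
        (translationPart (frameLoop _ η) l) Ω := fun z hz => by
      unfold translationPart
      rw [hU hz]
    constructor
    · rintro ⟨X, hX'⟩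
      exact isImmersion_congr hΩo hX.symm ((h.isImmersion_translationPart l).2 fun z hz =>
        h.frameVec_ne_zero (isExtendedLiftOf_congr hΩo hz₀ hU hX') hz)
    · intro hI
      -- The immersion exhibited is the translation component at `λ = 1` for every `l`: the
      -- immersion hypothesis at `l` is used only through the nonvanishing of `frameVec`.
      exact ⟨_, isExtendedLiftOf_congr hΩo hz₀ hU.symm (h.isExtendedLiftOf_translationPart
        ((h.isImmersion_translationPart l).1 (isImmersion_congr hΩo hX hI)))⟩
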